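/- **Peridynamic Green function in the Laplace domain.** Let $d\in\{1,2,3\}$, let $\rho>0$, and let $s\in\mathbb C$ be such that $s^2$ is neither $0$ nor a negative real number. Let the micromodulus $C:\mathbb R^d\to\mathbb R^{d\times d}$ be a radial tensor function, $C(\xi)=a(|\xi|)I+b(|\xi|)\,\xi\otimes\xi$ with real functions $a,b$, such that $|\xi|^nC(\xi)$ is integrable for every $n\ge 0$ (for instance, $C$ integrable with a bounded horizon, or of Gaussian decay). For an (angular) wave vector $\kappa$ put $$M(\kappa)=\int_{\mathbb R^d}\bigl(1-\cos(\kappa\cdot\xi)\bigr)C(\xi)\,d\xi ,$$ and assume that $M(\kappa)$ is positive semidefinite for every $\kappa$. Let $e_0,e_1,\dots$ be the coordinate basis, and put $M_\Vert(k)=e_0\cdot M(ke_0)e_0$ and, for $d\ge2$, $M_\perp(k)=e_1\cdot M(ke_0)e_1$; for $d=1$ put $M_\perp=M_\Vert=M$. Write $P(k)=\frac1{\rho s^2+M_\Vert(k)}$, $Q(k)=\frac1{\rho s^2+M_\perp(k)}$, $x=|\mathbf x|$, and $\mathcal Ff(\mathbf k)=\int f(\mathbf x)e^{-2\pi i\mathbf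 x\cdot\mathbf k}d\mathbf x$ (extended to tempered distributions). An integral $\int_0^\infty f(\mathbf x,k)\,dk$ that stands for a distribution means the limit, as $R\to\infty$, of the functions $\int_0^Rf(\cdot,k)\,dk$ in the sense of tempered distributions. Products of such an integral with $x_ix_j/x^2$ are understood in the same way, with the factor multiplied into the integrand. Then: 1. For all $i,j$ and $\kappa\neq0$, $M_{ij}(\kappa)=M_\perp(|\kappa|)\delta_{ij}+\frac{\kappa_i\kappa_j}{|\kappa|^2}\bigl(M_\Vert(|\kappa|)-M_\perp(|\kappa|)\bigr)$, and $\rho s^2I+M(\kappa)$ is invertible for every $\kappa$. 2. For each $i$ the Laplace-transformed bond-based peridynamic equation $$\rho s^2 u(\mathbf x)=\int_{\mathbb R^d} C(\xi)\,[u(\mathbf x+\xi)-u(\mathbf x)]\,d\xi+\delta(\mathbf x)e_i$$ has exactly one solution $u_{i}=(u_{ij})_j$ among the vectors of tempered distributions on $\mathbb R^d$, namely $u_{i}=\mathcal F^{-1}\bigl[(\rho s^2I+M(2\pi\mathbf k))^{-1}e_i\bigr]$. In components, $$u_{ij}=\mathcal F^{-1}\Bigl[\delta_{ij}\,Q(2\pi|\mathbf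 k|)+\tfrac{k_ik_j}{|\mathbf k|^2}\bigl(P(2\pi|\mathbf k|)-Q(2\pi|\mathbf k|)\bigr)\Bigr].$$ 3. $u_{ij}=u_A\,\delta_{ij}+\frac{x_ix_j}{x^2}u_B$, where $u_A,u_B$ are the tempered distributions given by the following integrals (which converge in the sense above): - $d=1$: $u_A=\frac1\pi\int_0^\infty\cos(kx)P(k)\,dk$ and $u_B=0$; - $d=2$: $u_A=\frac1{2\pi}\int_0^\infty\bigl[J_0(kx)Q+\frac{J_1(kx)}{kx}(P-Q)\bigr]k\,dk$ and $u_B=\frac1{2\pi}\int_0^\infty\bigl[J_0(kx)-2\frac{J_1(kx)}{kx}\bigr](P-Q)\,k\,dk$, with the Bessel functions $J_0,J_1$ of the first kind; - $d=3$: $u_A=\frac1{2\pi^2}\int_0^\infty\Bigl(\bigl[\frac{\sin kx}{(kx)^3}-\frac{\cos kx}{(kx)^2}\bigr](P-Q)k^2+\frac{\sin kx}{x}kQ\Bigr)dk$ and $u_B=\frac1{2\pi^2}\int_0^\infty\bigl[\frac{\sin kx}{kx}+\frac{3\cos kx}{(kx)^2}-\frac{3\sin kx}{(kx)^3}\bigr](P-Q)k^2\,dk$.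 4. $M_\Vert(k)$ and $M_\perp(k)$ have a common real limit $M(\infty)$ as $k\to\infty$; $\rho s^2+M(\infty)\ne0$; and with $c=\frac1{\rho s^2+M(\infty)}$ the divergent part of $u_A$ is split off as $u_A=c\,\delta(\mathbf x)+w$, where - $d=1$: $w=\frac1\pi\int_0^\infty\bigl[\cos(kx)P-\cos(kx)\,c\bigr]dk$; - $d=2$: $w=\frac1{2\pi}\int_0^\infty\bigl(J_0(kx)(Q-c)k+\frac{J_1(kx)}{x}(P-Q)\bigr)dk$; - $d=3$: $w=\frac1{2\pi^2}\int_0^\infty\Bigl(\frac{\sin kx}{x}(kQ-kc)+\bigl[\frac{\sin kx}{(kx)^3}-\frac{\cos kx}{(kx)^2}\bigr](P-Q)k^2\Bigr)dk$, again as improper integrals in the sense of tempered distributions. If moreover $k^{d-1}(M_\Vert(k)-M(\infty))$ and $k^{d-1}(M_\perp(k)-M(\infty))$ are integrable on $(0,\infty)$, then for every $\mathbf x\ne0$ the integrals for $w$ and $u_B$ are absolutely convergent Lebesgue integrals, and the distributions $w$, $u_B$ and $\frac{x_ix_j}{x^2}u_B$ are the functions that these integrals define pointwise. -/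

import Mathlib

open MeasureTheory Filter Topology SchwartzMap FourierTransform

noncomputable section

namespace Peridynamics

/-- The physical space `ℝᵈ`. -/
abbrev Space (d : ℕ) : Type := EuclideanSpace ℝ (Fin d)

variable {d : ℕ}

/-- `C` is a radial (isotropic) symmetric tensor function:
`C(ξ) = a(|ξ|) I + b(|ξ|) ξ ⊗ ξ`. The purely central springs are the case `a = 0`. -/
def IsRadialTensor (C : Space d → Matrix (Fin d) (Fin d) ℝ) : Prop :=
  ∃ a b : ℝ → ℝ, ∀ (ξ : Space d) (i j : Fin d),
    C ξ i j = a ‖ξ‖ * (if i = j then 1 else 0) + b ‖ξ‖ * (ξ i * ξ j)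

/-- The stiffness tensor `M(κ) = ∫ (1 - cos (κ · ξ)) C(ξ) dξ`, as a function of the angular
wave vector `κ`. -/
def stiffness (C : Space d → Matrix (Fin d) (Fin d) ℝ) (κ : Space d) :
    Matrix (Fin d) (Fin d) ℝ :=
  fun i j => ∫ ξ : Space d, (1 - Real.cos (inner ℝ κ ξ)) * C ξ i j

/-- The tensile stiffness `M_∥(k) = e₀ · M(k e₀) e₀`. In one dimension this is `M(k)`. -/
def tensile [NeZero d] (C : Space d → Matrix (Fin d) (Fin d) ℝ) (k : ℝ) : ℝ :=
  stiffness C (EuclideanSpace.single 0 k) 0 0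

/-- The shear stiffness `M_⊥(k) = e₁ · M(k e₀) e₁`, for `d ≥ 2`.
(For `d = 1` the index `1 : Fin 1` is `0`, and this is again `M(k)`.) -/
def shear [NeZero d] (C : Space d → Matrix (Fin d) (Fin d) ℝ) (k : ℝ) : ℝ :=
  stiffness C (EuclideanSpace.single 0 k) 1 1

/-- The matrix `ρ s² I + M(κ)`. -/
def dynamicStiffness (C : Space d → Matrix (Fin d) (Fin d) ℝ) (ρ : ℝ) (s : ℂ) (κ : Space d) :
    Matrix (Fin d) (Fin d) ℂ :=
  ((ρ : ℂ) * s ^ 2) • (1 : Matrix (Fin d) (Fin d) ℂ) + (stiffness C κ).map (fun t => (t : ℂ))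

/-- The scalar `1 / (ρ s² + m)`. -/
def compliance (ρ : ℝ) (s : ℂ) (m : ℝ) : ℂ := 1 / ((ρ : ℂ) * s ^ 2 + (m : ℂ))

/-- `v = (v_j)` is a tempered solution on all of `ℝᵈ` of the Laplace-transformed bond-based
peridynamic equation with a unit point force in direction `e_i`,
`ρ s² v(x) = ∫ C(ξ) [v(x + ξ) - v(x)] dξ + δ(x) e_i`.
The equation is tested with Schwartz functions `φ`: the nonlocal operator is transposed to
`φ ↦ ∫ C(ξ) [φ(· - ξ) - φ] dξ`, whose entries `ψ_l` are required to be Schwartz functions. -/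
def IsFundamentalSolution (C : Space d → Matrix (Fin d) (Fin d) ℝ) (ρ : ℝ) (s : ℂ) (i : Fin d)
    (v : Fin d → 𝓢'(Space d, ℂ)) : Prop :=
  ∀ (j : Fin d) (φ : 𝓢(Space d, ℂ)), ∃ ψ : Fin d → 𝓢(Space d, ℂ),
    (∀ (l : Fin d) (x : Space d),
      ψ l x = ∫ ξ : Space d, (C ξ j l : ℂ) * (φ (x - ξ) - φ x)) ∧
    (ρ : ℂ) * s ^ 2 * v j φ = ∑ l, v l (ψ l) + (if i = j then φ 0 else 0)

/-- The distribution `T` is the function `f`. -/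
def IsFunction (T : 𝓢'(Space d, ℂ)) (f : Space d → ℂ) : Prop :=
  ∀ φ : 𝓢(Space d, ℂ), Integrable (fun x => φ x * f x) ∧ T φ = ∫ x, φ x * f x

/-- `T = ∫₀^∞ f(·, k) dk` as an improper integral in the sense of tempered distributions: the
functions `x ↦ ∫₀^R f(x, k) dk` converge to `T` as `R → ∞`, when tested with any Schwartz
function. (The value of `f` at the single point `x = 0` is immaterial.) -/
def IsImproperIntegral (T : 𝓢'(Space d, ℂ)) (f : Space d → ℝ → ℂ) : Prop :=
  (∀ x : Space d, x ≠ 0 → ∀ R : ℝ, 0 ≤ R → IntervalIntegrable (f x) volume 0 R) ∧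
  (∀ R : ℝ, 0 ≤ R → ∀ φ : 𝓢(Space d, ℂ),
    Integrable (fun x : Space d => φ x * ∫ k in (0 : ℝ)..R, f x k)) ∧
  ∀ φ : 𝓢(Space d, ℂ),
    Tendsto (fun R : ℝ => ∫ x : Space d, φ x * ∫ k in (0 : ℝ)..R, f x k) atTop (𝓝 (T φ))

/-- The Bessel function of the first kind `J_n`, by Bessel's integral. -/
def besselJ (n : ℕ) (z : ℝ) : ℝ :=
  1 / Real.pi * ∫ θ in (0 : ℝ)..Real.pi, Real.cos (n * θ - z * Real.sin θ)

/-- The integrand of `u_A` in dimension `d = 1, 2, 3`, at distance `r = |x|` and radial wave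
number `k`, where `P = 1/(ρ s² + M_∥)` and `Q = 1/(ρ s² + M_⊥)`. -/
def integrandA (d : ℕ) (P Q : ℝ → ℂ) (r k : ℝ) : ℂ :=
  match d with
  | 1 => ((1 / Real.pi * Real.cos (k * r) : ℝ) : ℂ) * P k
  | 2 => ((1 / (2 * Real.pi) : ℝ) : ℂ) *
      (((besselJ 0 (k * r) : ℝ) : ℂ) * Q k
        + ((besselJ 1 (k * r) / (k * r) : ℝ) : ℂ) * (P k - Q k)) * (k : ℂ)
  | 3 => ((1 / (2 * Real.pi ^ 2) : ℝ) : ℂ) *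
      (((Real.sin (k * r) / (k * r) ^ 3 - Real.cos (k * r) / (k * r) ^ 2 : ℝ) : ℂ)
          * (P k - Q k) * (k : ℂ) ^ 2
        + ((Real.sin (k * r) / r : ℝ) : ℂ) * ((k : ℂ) * Q k))
  | _ => 0

/-- The integrand of `u_B` in dimension `d = 1, 2, 3`. -/
def integrandB (d : ℕ) (P Q : ℝ → ℂ) (r k : ℝ) : ℂ :=
  match d with
  | 2 => ((1 / (2 * Real.pi) : ℝ) : ℂ) *
      ((besselJ 0 (k * r) - 2 * (besselJ 1 (k * r) / (k * r)) : ℝ) : ℂ)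
        * (P k - Q k) * (k : ℂ)
  | 3 => ((1 / (2 * Real.pi ^ 2) : ℝ) : ℂ) *
      ((Real.sin (k * r) / (k * r) + 3 * Real.cos (k * r) / (k * r) ^ 2
          - 3 * Real.sin (k * r) / (k * r) ^ 3 : ℝ) : ℂ)
        * (P k - Q k) * (k : ℂ) ^ 2
  | _ => 0

/-- The integrand of the part of `u_A` that remains after the Dirac function has been split off;
`c = 1/(ρ s² + M(∞))`. -/
def integrandARegular (d : ℕ) (P Q : ℝ → ℂ) (c : ℂ) (r k : ℝ) : ℂ :=
  match d with
  | 1 => ((1 / Real.pi : ℝ) : ℂ) *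
      (((Real.cos (k * r) : ℝ) : ℂ) * P k - ((Real.cos (k * r) : ℝ) : ℂ) * c)
  | 2 => ((1 / (2 * Real.pi) : ℝ) : ℂ) *
      (((besselJ 0 (k * r) : ℝ) : ℂ) * (Q k - c) * (k : ℂ)
        + ((besselJ 1 (k * r) / r : ℝ) : ℂ) * (P k - Q k))
  | 3 => ((1 / (2 * Real.pi ^ 2) : ℝ) : ℂ) *
      (((Real.sin (k * r) / r : ℝ) : ℂ) * ((k : ℂ) * Q k - (k : ℂ) * c)
        + ((Real.sin (k * r) / (k * r) ^ 3 - Real.cos (k * r) / (k * r) ^ 2 : ℝ) : ℂ)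
          * (P k - Q k) * (k : ℂ) ^ 2)
  | _ => 0

/-- The coefficient `x_i x_j / x²`. -/
def directionTensor (i j : Fin d) (x : Space d) : ℝ := x i * x j / ‖x‖ ^ 2

/-- The integrands of `u_A`, of `u_B` and of the regular part of `u_A` for the material with
micromodulus `C` and density `ρ`, as functions of the position `x` and the wave number `k`. -/
def greenA [NeZero d] (C : Space d → Matrix (Fin d) (Fin d) ℝ) (ρ : ℝ) (s : ℂ)
    (x : Space d) (k : ℝ) : ℂ :=
  integrandA d (fun k => compliance ρ s (tensile C k)) (fun k => compliance ρ s (shear C k)) ‖x‖ k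

/-- See `greenA`. -/
def greenB [NeZero d] (C : Space d → Matrix (Fin d) (Fin d) ℝ) (ρ : ℝ) (s : ℂ)
    (x : Space d) (k : ℝ) : ℂ :=
  integrandB d (fun k => compliance ρ s (tensile C k)) (fun k => compliance ρ s (shear C k)) ‖x‖ k

/-- See `greenA`. -/
def greenARegular [NeZero d] (C : Space d → Matrix (Fin d) (Fin d) ℝ) (ρ : ℝ) (s : ℂ) (Minf : ℝ)
    (x : Space d) (k : ℝ) : ℂ :=
  integrandARegular d (fun k => compliance ρ s (tensile C k))
    (fun k => compliance ρ s (shear C k)) (compliance ρ s Minf) ‖x‖ k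

end Peridynamics

end

/-! The Fourier transform turns the equation into multiplication by `D(k) = ρ s² I + M(2πk)`. All
moments of `C` are finite, so `D` is smooth with bounded derivatives; positivity of `M`, with `s²`
off the closed negative axis, bounds the inverse. The inverse is the adjugate over a determinant
that stays away from zero, so it acts as a multiplier on Schwartz functions
(`hasTemperateGrowth_greenSymbol`), and division by `D` gives existence and uniqueness
(`isFundamentalSolution_iff`). A radial `C` makes `M` equivariant under isometries, and reflections
leave only one longitudinal and one transverse value (`IsIsotropic.apply_eq`).

For the radial integrals the symbol is cut off at `|κ| < R` and transformed in polar coordinates. In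
every dimension two kernels appear: `J(z)`, the integral of `cos (z ω₀)` over the unit sphere, and
`L(z) = ∫₀¹ q^(d-1) J(qz) dq`. Up to the factor `(2π)⁻ᵈ` the integrand of `u_A` is `k^(d-1) (J Q + L
(P - Q))` and that of `u_B` is `k^(d-1) (J - d L) (P - Q)`. As `(k^d L(kr))' = k^(d-1) J(kr)`, an
integration by parts turns the `u_A` integral up to `R` into the transform over the ball of the
radial symbol `Q + Θ(R) - Θ(|κ|)`, where `Θ(R) = ∫₀ᴿ (P - Q)/k dk`. If `Θ` converges, these symbols
are uniformly bounded and converge pointwise, and dominated convergence on the Fourier side gives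
the tempered limit (`isImproperIntegral_of_symbols`).

The hard point is the convergence of `Θ`, because Riemann–Lebesgue gives `P - Q → 0` without a rate.
A tail `∫ (P - Q)/k` over `[r₁, r₂]` is, up to a nonzero factor, the value at the origin of the
inverse transform of the `(0,0)` entry of the inverse symbol times `(κ₀²/|κ|² - 1/d)/|κ|^d` on an
annulus. Without the symbol this transform is a multiple of `(y₀²/|y|² - 1/d) (L(r₂|y|) -
L(r₁|y|))`, which is bounded and tends to zero pointwise as the annulus escapes. The inverse `N` of
`D` satisfies `N = c I + c Ĉ N`, so inserting it leads to a convolution equation. There `c C` is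
split into a Schwartz part, whose contribution vanishes by dominated convergence, and a remainder of
mass less than one, which is a contraction (`tendsto_zero_of_le_add_convolution`).

A constant symbol `c` transforms into `c δ`, which is the singular part of `u_A`. What remains is
dominated uniformly in the position, since `J` and `L` are bounded and the compliances are Lipschitz
in the stiffness. -/

open MeasureTheory Filter Topology SchwartzMap FourierTransform

noncomputable section

namespace Peridynamics

variable {d : ℕ}

/-! ### Isotropic matrix functions -/

/-- The bilinear form of a matrix on real vectors. -/
def tensorForm (N : Matrix (Fin d) (Fin d) ℂ) (u v : Space d) : ℂ :=
  ∑ i, ∑ j, ((u i * v j : ℝ) : ℂ) * N i j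

/-- A matrix function is isotropic if it is equivariant under all linear isometries. -/
def IsIsotropic (N : Space d → Matrix (Fin d) (Fin d) ℂ) : Prop :=
  ∀ (R : Space d ≃ₗᵢ[ℝ] Space d) (κ u v : Space d),
    tensorForm (N (R κ)) (R u) (R v) = tensorForm (N κ) u v

/-- The coordinate basis vector `e_i`. -/
abbrev basisVec (i : Fin d) : Space d := EuclideanSpace.single i 1

theorem tensorForm_basisVec (N : Matrix (Fin d) (Fin d) ℂ) (i j : Fin d) :
    tensorForm N (basisVec i) (basisVec j) = N i j := by
  rw [tensorForm, Finset.sum_eq_single i, Finset.sum_eq_single j] <;>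
    simp +contextual [basisVec]

theorem tensorForm_neg_left (N : Matrix (Fin d) (Fin d) ℂ) (u v : Space d) :
    tensorForm N (-u) v = -tensorForm N u v := by
  simp [tensorForm, Finset.sum_neg_distrib]

theorem tensorForm_neg_right (N : Matrix (Fin d) (Fin d) ℂ) (u v : Space d) :
    tensorForm N u (-v) = -tensorForm N u v := by
  simp [tensorForm, Finset.sum_neg_distrib]

theorem inner_basisVec_left (i : Fin d) (x : Space d) : inner ℝ (basisVec i) x = x i := by
  simp [basisVec, EuclideanSpace.inner_single_left]

theorem inner_basisVec_right (i : Fin d) (x : Space d) : inner ℝ x (basisVec i) = x i := by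
  simp [basisVec, EuclideanSpace.inner_single_right]

/-- Only inner products occur on the right, so isometries preserve it. The same formula later
evaluates an axis-aligned tensor on rotated basis vectors. -/
theorem tensorForm_radial (a b : ℂ) (ξ : Space d) (N : Matrix (Fin d) (Fin d) ℂ)
    (hN : ∀ i j, N i j = a * (if i = j then 1 else 0) + b * ((ξ i * ξ j : ℝ) : ℂ))
    (u v : Space d) :
    tensorForm N u v = a * ((inner ℝ u v : ℝ) : ℂ)
      + b * (((inner ℝ ξ u : ℝ) : ℂ) * ((inner ℝ ξ v : ℝ) : ℂ)) := by
  simp only [tensorForm, hN, PiLp.inner_apply, RCLike.inner_apply, conj_trivial,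
    Complex.ofReal_sum, mul_add, Finset.sum_add_distrib, Complex.ofReal_mul]
  congr 1
  · simp only [Finset.mul_sum]
    refine Finset.sum_congr rfl fun i _ => ?_
    simp
    ring
  · rw [Finset.sum_mul_sum, Finset.mul_sum]
    refine Finset.sum_congr rfl fun i _ => ?_
    rw [Finset.mul_sum]
    refine Finset.sum_congr rfl fun j _ => ?_
    ring

theorem isIsotropic_of_radial (a b : ℝ → ℂ) (N : Space d → Matrix (Fin d) (Fin d) ℂ)
    (hN : ∀ ξ i j, N ξ i j =
      a ‖ξ‖ * (if i = j then 1 else 0) + b ‖ξ‖ * ((ξ i * ξ j : ℝ) : ℂ)) :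
    IsIsotropic N := by
  intro R κ u v
  rw [tensorForm_radial _ _ _ _ (hN (R κ)), tensorForm_radial _ _ _ _ (hN κ)]
  simp

/-- Integrating an isotropic matrix function against an invariant kernel. -/
theorem IsIsotropic.integral {C : Space d → Matrix (Fin d) (Fin d) ℂ} (hC : IsIsotropic C)
    (F : Space d → Space d → ℂ)
    (hF : ∀ (R : Space d ≃ₗᵢ[ℝ] Space d) κ ξ, F (R κ) (R ξ) = F κ ξ)
    (hint : ∀ κ i j, Integrable fun ξ => F κ ξ * C ξ i j) :
    IsIsotropic fun κ => Matrix.of fun i j => ∫ ξ, F κ ξ * C ξ i j := by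
  have key : ∀ κ u v, tensorForm (Matrix.of fun i j => ∫ ξ, F κ ξ * C ξ i j) u v =
      ∫ ξ, F κ ξ * tensorForm (C ξ) u v := by
    intro κ u v
    simp only [tensorForm, Matrix.of_apply, Finset.mul_sum]
    rw [integral_finsetSum]
    · refine Finset.sum_congr rfl fun i _ => ?_
      rw [integral_finsetSum]
      · refine Finset.sum_congr rfl fun j _ => ?_
        rw [← integral_const_mul]
        congr 1
        ext ξ
        ring
      · intro j _
        refine ((hint κ i j).const_mul ((u i * v j : ℝ) : ℂ)).congr (ae_of_all _ fun ξ => ?_)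
        simp only
        ring
    · intro i _
      refine integrable_finsetSum _ fun j _ => ?_
      refine ((hint κ i j).const_mul ((u i * v j : ℝ) : ℂ)).congr (ae_of_all _ fun ξ => ?_)
      simp only
      ring
  intro R κ u v
  -- An isometry preserves Lebesgue measure, so `ξ` may be replaced by `R ξ` in the integral on the
  -- left.
  rw [key, key, ← R.measurePreserving.integral_comp R.toHomeomorph.measurableEmbedding]
  congr 1
  ext ξ
  rw [hF, hC]

theorem inner_basisVec_basisVec (i j : Fin d) :
    inner ℝ (basisVec i) (basisVec j) = if i = j then (1 : ℝ) else 0 := by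
  rw [inner_basisVec_left]
  simp [basisVec, PiLp.single_apply]

theorem reflection_fix {u x : Space d} (h : inner ℝ u x = 0) :
    (ℝ ∙ u)ᗮ.reflection x = x :=
  Submodule.reflection_mem_subspace_eq_self
    (Submodule.mem_orthogonal_singleton_iff_inner_right.2 h)

/-- The reflection that exchanges `e_i` and `e_j` fixes every `κ` whose two coordinates agree. -/
theorem IsIsotropic.diag_eq {N : Space d → Matrix (Fin d) (Fin d) ℂ} (hN : IsIsotropic N)
    {κ : Space d} {i j : Fin d} (hi : κ i = κ j) : N κ i i = N κ j j := by
  have hfix : (ℝ ∙ (basisVec i - basisVec j : Space d))ᗮ.reflection κ = κ := by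
    apply reflection_fix
    rw [inner_sub_left, inner_basisVec_left, inner_basisVec_left, hi, sub_self]
  have hsw : (ℝ ∙ (basisVec i - basisVec j : Space d))ᗮ.reflection (basisVec i) = basisVec j :=
    Submodule.reflection_sub (by simp)
  have h := hN (ℝ ∙ (basisVec i - basisVec j : Space d))ᗮ.reflection κ (basisVec i) (basisVec i)
  rw [hfix, hsw, tensorForm_basisVec, tensorForm_basisVec] at h
  exact h.symm

/-! ### Longitudinal and transverse parts of an isotropic tensor -/

section Structure

variable [NeZero d]

/-- The numeral `1 : Fin d` is `0` when `d = 1`; a nonzero index excludes that case, and then `1` is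
a genuine transverse direction. -/
theorem one_ne_zero_of_ne_zero {i : Fin d} (hi : i ≠ 0) : (1 : Fin d) ≠ 0 := by
  have h2 : 2 ≤ d := by
    by_contra h
    have : d = 1 := by have := NeZero.pos d; omega
    subst this
    exact hi (Subsingleton.elim _ _)
  intro h
  have := congrArg Fin.val h
  rw [Fin.val_one', Fin.val_zero, Nat.mod_eq_of_lt (by omega)] at this
  omega

/-- One of the two indices is not the axis. The reflection that flips its basis vector fixes the
axis and the other basis vector, so the entry equals its own negative. -/
theorem IsIsotropic.axis_off_diag {N : Space d → Matrix (Fin d) (Fin d) ℂ} (hN : IsIsotropic N)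
    (k : ℝ) {i j : Fin d} (hij : i ≠ j) : N (EuclideanSpace.single 0 k) i j = 0 := by
  have hfix : ∀ l : Fin d, l ≠ 0 → (ℝ ∙ (basisVec l : Space d))ᗮ.reflection
      (EuclideanSpace.single 0 k) = EuclideanSpace.single (0 : Fin d) k := by
    intro l hl
    apply reflection_fix
    rw [inner_basisVec_left]
    simp [hl]
  have hne : ∀ l m : Fin d, l ≠ m → (ℝ ∙ (basisVec l : Space d))ᗮ.reflection
      (basisVec m) = basisVec m := by
    intro l m hl
    apply reflection_fix
    rw [inner_basisVec_basisVec, if_neg hl]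
  have hneg : ∀ l : Fin d, (ℝ ∙ (basisVec l : Space d))ᗮ.reflection (basisVec l) = -basisVec l :=
    fun l => Submodule.reflection_orthogonalComplement_singleton_eq_neg _
  by_cases hi : i = 0
  · have hj : j ≠ 0 := fun h => hij (hi.trans h.symm)
    have h := hN (ℝ ∙ (basisVec j : Space d))ᗮ.reflection (EuclideanSpace.single 0 k)
      (basisVec i) (basisVec j)
    rw [hfix j hj, hne j i hij.symm, hneg, tensorForm_neg_right, tensorForm_basisVec] at h
    exact self_eq_neg.1 h.symm
  · have h := hN (ℝ ∙ (basisVec i : Space d))ᗮ.reflection (EuclideanSpace.single 0 k)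
      (basisVec i) (basisVec j)
    rw [hfix i hi, hne i j hij, hneg, tensorForm_neg_left, tensorForm_basisVec] at h
    exact self_eq_neg.1 h.symm

theorem IsIsotropic.axis_apply {N : Space d → Matrix (Fin d) (Fin d) ℂ} (hN : IsIsotropic N)
    (k : ℝ) (i j : Fin d) : N (EuclideanSpace.single 0 k) i j =
      N (EuclideanSpace.single 0 k) 1 1 * (if i = j then 1 else 0) +
      (N (EuclideanSpace.single 0 k) 0 0 - N (EuclideanSpace.single 0 k) 1 1) *
        (((basisVec 0 : Space d) i * (basisVec 0 : Space d) j : ℝ) : ℂ) := by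
  by_cases hij : i = j
  · subst hij
    by_cases hi : i = 0
    · subst hi; simp [basisVec]
    · rw [hN.diag_eq (i := i) (j := 1)]
      · simp [basisVec, hi]
      · simp [hi, one_ne_zero_of_ne_zero hi]
  · rw [hN.axis_off_diag k hij]
    by_cases hi : i = 0
    · have : j ≠ 0 := fun h => hij (hi.trans h.symm)
      simp [hij, this]
    · simp [hij, hi]

/-- A reflection serves. The second conjunct is its self-adjointness, which makes it an involution
and lets it be moved from basis vectors to the axis. -/
theorem exists_isometry_axis (κ : Space d) : ∃ R : Space d ≃ₗᵢ[ℝ] Space d,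
    R (EuclideanSpace.single 0 ‖κ‖) = κ ∧ ∀ u v : Space d, inner ℝ (R u) v = inner ℝ u (R v) := by
  refine ⟨(ℝ ∙ (EuclideanSpace.single 0 ‖κ‖ - κ : Space d))ᗮ.reflection,
    Submodule.reflection_sub (by simp), fun u v => ?_⟩
  conv_lhs => rw [← Submodule.reflection_reflection
    (ℝ ∙ (EuclideanSpace.single 0 ‖κ‖ - κ : Space d))ᗮ v]
  rw [LinearIsometryEquiv.inner_map_map]

/-- An isotropic matrix function is determined by its longitudinal and transverse parts. -/
theorem IsIsotropic.apply_eq {N : Space d → Matrix (Fin d) (Fin d) ℂ} (hN : IsIsotropic N)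
    (κ : Space d) (i j : Fin d) : N κ i j =
      N (EuclideanSpace.single 0 ‖κ‖) 1 1 * (if i = j then 1 else 0) +
      (directionTensor i j κ : ℂ) *
        (N (EuclideanSpace.single 0 ‖κ‖) 0 0 - N (EuclideanSpace.single 0 ‖κ‖) 1 1) := by
  by_cases hκ : κ = 0
  · subst hκ
    have hd : directionTensor i j (0 : Space d) = 0 := by simp [directionTensor]
    have h0 : (EuclideanSpace.single 0 ‖(0 : Space d)‖ : Space d) = 0 := by simp
    rw [hd, h0]
    by_cases hij : i = j
    · subst hij
      rw [hN.diag_eq (κ := 0) (i := i) (j := 1) (by simp)]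
      simp
    · have := hN.axis_off_diag 0 hij
      rw [show (EuclideanSpace.single 0 0 : Space d) = 0 by simp] at this
      simp [hij, this]
  · obtain ⟨R, hR, hs⟩ := exists_isometry_axis κ
    have hnorm : ‖κ‖ ≠ 0 := by simpa using hκ
    have hRe : R (basisVec 0) = ‖κ‖⁻¹ • κ := by
      have : (EuclideanSpace.single 0 ‖κ‖ : Space d) = ‖κ‖ • basisVec 0 := by
        ext l; simp [basisVec, PiLp.single_apply]
      rw [this, map_smul] at hR
      rw [eq_inv_smul_iff₀ hnorm, hR]
    have hRR : ∀ x, R (R x) = x := by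
      intro x
      refine ext_inner_right ℝ fun y => ?_
      rw [hs, LinearIsometryEquiv.inner_map_map]
    -- Since `R` is an involution, `R (R e_i) = e_i`: the entry of `N κ` becomes the form of the
    -- axis tensor at `R e_i`, `R e_j`, whose axial components are `κ_i / |κ|` and `κ_j / |κ|`.
    have h := hN R (EuclideanSpace.single 0 ‖κ‖) (R (basisVec i)) (R (basisVec j))
    rw [hR, hRR, hRR, tensorForm_basisVec, tensorForm_radial _ _ _ _ (hN.axis_apply ‖κ‖)] at h
    rw [h, LinearIsometryEquiv.inner_map_map, inner_basisVec_basisVec, ← hs, ← hs, hRe,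
      inner_basisVec_right, inner_basisVec_right]
    have : directionTensor i j κ = (‖κ‖⁻¹ • κ) i * (‖κ‖⁻¹ • κ) j := by
      simp only [directionTensor, PiLp.smul_apply, smul_eq_mul]
      field_simp
    rw [this]
    push_cast
    split_ifs <;> simp <;> ring

end Structure

/-! ### The stiffness tensor: isotropy, growth at zero, limit at infinity -/

section Stiffness

variable {C : Space d → Matrix (Fin d) (Fin d) ℝ}

/-- The micromodulus as a complex matrix function. -/
abbrev complexModulus (C : Space d → Matrix (Fin d) (Fin d) ℝ) (ξ : Space d) :
    Matrix (Fin d) (Fin d) ℂ := (C ξ).map fun t => (t : ℂ)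

theorem IsRadialTensor.isIsotropic (hC : IsRadialTensor C) : IsIsotropic (complexModulus C) := by
  obtain ⟨a, b, h⟩ := hC
  refine isIsotropic_of_radial (fun r => (a r : ℂ)) (fun r => (b r : ℂ)) _ fun ξ i j => ?_
  simp only [Matrix.map_apply, h]
  push_cast
  split_ifs <;> simp

theorem IsRadialTensor.neg_apply (hC : IsRadialTensor C) (ξ : Space d) : C (-ξ) = C ξ := by
  obtain ⟨a, b, h⟩ := hC
  ext i j
  simp [h]

theorem IsRadialTensor.symm_apply (hC : IsRadialTensor C) (ξ : Space d) (i j : Fin d) :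
    C ξ i j = C ξ j i := by
  obtain ⟨a, b, h⟩ := hC
  simp only [h, eq_comm (a := i), mul_comm (ξ i)]

theorem integrable_cos_mul {f : Space d → ℝ} (hf : Integrable f) (κ : Space d) :
    Integrable fun ξ => Real.cos (inner ℝ κ ξ) * f ξ := by
  refine hf.bdd_mul (c := 1) (by fun_prop) (ae_of_all _ fun ξ => ?_)
  simpa using Real.abs_cos_le_one _

theorem integrable_one_sub_cos_mul {f : Space d → ℝ} (hf : Integrable f) (κ : Space d) :
    Integrable fun ξ => (1 - Real.cos (inner ℝ κ ξ)) * f ξ := by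
  simp only [sub_mul, one_mul]
  exact hf.sub (integrable_cos_mul hf κ)

theorem stiffness_apply_eq_sub (hint : ∀ i j, Integrable fun ξ => C ξ i j) (κ : Space d)
    (i j : Fin d) : stiffness C κ i j =
      (∫ ξ, C ξ i j) - ∫ ξ, Real.cos (inner ℝ κ ξ) * C ξ i j := by
  simp only [stiffness, sub_mul, one_mul]
  exact integral_sub (hint i j) (integrable_cos_mul (hint i j) κ)

theorem isIsotropic_stiffness (hC : IsRadialTensor C)
    (hint : ∀ i j, Integrable fun ξ => C ξ i j) :
    IsIsotropic fun κ => (stiffness C κ).map fun t => (t : ℂ) := by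
  have h := hC.isIsotropic.integral
    (fun κ ξ => ((1 - Real.cos (inner ℝ κ ξ) : ℝ) : ℂ)) (by simp) (fun κ i j => by
      simpa using (integrable_one_sub_cos_mul (hint i j) κ).ofReal (𝕜 := ℂ))
  convert h using 2 with κ
  ext i j
  simp only [Matrix.map_apply, stiffness, Matrix.of_apply, ← Complex.ofReal_mul]
  exact integral_ofReal.symm

theorem isIsotropic_const_integral (hC : IsRadialTensor C)
    (hint : ∀ i j, Integrable fun ξ => C ξ i j) :
    IsIsotropic fun _ : Space d => Matrix.of fun i j => ((∫ ξ, C ξ i j : ℝ) : ℂ) := by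
  have h := hC.isIsotropic.integral (fun _ _ => 1) (by simp) (fun κ i j => by
      simpa using (hint i j).ofReal (𝕜 := ℂ))
  convert h using 2 with κ
  ext i j
  simp only [Matrix.map_apply, Matrix.of_apply, one_mul]
  exact integral_ofReal.symm

/-- From `1 - cos t ≤ t² / 2`. The quadratic vanishing at zero is what makes `(P - Q)/k` continuous
there. -/
theorem abs_stiffness_le_sq (hint : ∀ i j, Integrable fun ξ => ‖ξ‖ ^ 2 * C ξ i j) (κ : Space d)
    (i j : Fin d) : |stiffness C κ i j| ≤ ‖κ‖ ^ 2 * ∫ ξ, |‖ξ‖ ^ 2 * C ξ i j| := by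
  rw [← integral_const_mul, ← Real.norm_eq_abs]
  refine norm_integral_le_of_norm_le ((hint i j).abs.const_mul _) (ae_of_all _ fun ξ => ?_)
  rw [Real.norm_eq_abs, abs_mul, abs_mul, abs_of_nonneg (sub_nonneg.2 (Real.cos_le_one _)),
    ← mul_assoc, abs_of_nonneg (sq_nonneg ‖ξ‖)]
  refine mul_le_mul_of_nonneg_right ?_ (abs_nonneg _)
  have h1 := Real.one_sub_sq_div_two_le_cos (x := inner ℝ κ ξ)
  have h2 : (inner ℝ κ ξ) ^ 2 ≤ ‖κ‖ ^ 2 * ‖ξ‖ ^ 2 := by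
    rw [← mul_pow, ← sq_abs]
    exact pow_le_pow_left₀ (abs_nonneg _) (abs_real_inner_le_norm κ ξ) 2
  nlinarith [sq_nonneg ‖κ‖, sq_nonneg ‖ξ‖, sq_nonneg (inner ℝ κ ξ)]

theorem continuous_stiffness (hint : ∀ i j, Integrable fun ξ => C ξ i j) (i j : Fin d) :
    Continuous fun κ => stiffness C κ i j := by
  simp only [stiffness]
  refine continuous_of_dominated (bound := fun ξ => 2 * |C ξ i j|)
    (fun κ => (integrable_one_sub_cos_mul (hint i j) κ).aestronglyMeasurable) (fun κ => ?_)
    ((hint i j).abs.const_mul 2) (ae_of_all _ fun ξ => by fun_prop)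
  refine ae_of_all _ fun ξ => ?_
  rw [Real.norm_eq_abs, abs_mul]
  refine mul_le_mul_of_nonneg_right ?_ (abs_nonneg _)
  rw [abs_le]
  constructor <;> linarith [Real.cos_le_one (inner ℝ κ ξ), Real.neg_one_le_cos (inner ℝ κ ξ)]

theorem integral_odd_eq_zero {E F : Type*} [NormedAddCommGroup E] [MeasureSpace E] [BorelSpace E]
    [(volume : Measure E).IsNegInvariant] [NormedAddCommGroup F] [NormedSpace ℝ F] {f : E → F}
    (hf : ∀ x, f (-x) = -f x) : ∫ x, f x = 0 := by
  have h := integral_neg_eq_self f volume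
  simp only [hf, integral_neg] at h
  have h2 : (2 : ℝ) • ∫ x, f x = 0 := by
    rw [two_smul]
    nth_rw 1 [← h]
    exact neg_add_cancel _
  exact (smul_eq_zero.1 h2).resolve_left two_ne_zero

/-- The Fourier transform of an even real function is its cosine transform. -/
theorem fourier_even {f : Space d → ℝ} (hf : Integrable f) (he : ∀ ξ, f (-ξ) = f ξ)
    (k : Space d) : 𝓕 (fun ξ => (f ξ : ℂ)) k =
      ((∫ ξ, Real.cos (inner ℝ ((2 * Real.pi) • k) ξ) * f ξ : ℝ) : ℂ) := by
  rw [Real.fourier_eq', ← integral_complex_ofReal]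
  have hsin : Integrable fun ξ => Real.sin (inner ℝ ((2 * Real.pi) • k) ξ) * f ξ := by
    refine hf.bdd_mul (c := 1) (by fun_prop) (ae_of_all _ fun ξ => ?_)
    simpa using Real.abs_sin_le_one _
  have hodd : ∫ ξ, Real.sin (inner ℝ ((2 * Real.pi) • k) ξ) * f ξ = 0 := by
    refine integral_odd_eq_zero fun ξ => ?_
    simp [he]
  have hodd' : ∫ ξ, ((Real.sin (inner ℝ ((2 * Real.pi) • k) ξ) * f ξ : ℝ) : ℂ) = 0 := by
    rw [integral_complex_ofReal, hodd, Complex.ofReal_zero]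
  rw [← sub_zero (∫ ξ, Complex.ofReal _), ← mul_zero Complex.I, ← hodd', ← integral_const_mul,
    ← integral_sub (integrable_cos_mul hf _).ofReal (hsin.ofReal.const_mul _)]
  congr 1
  ext ξ
  have : (↑(-2 * Real.pi * inner ℝ ξ k) * Complex.I : ℂ) =
      ((-(inner ℝ ((2 * Real.pi) • k) ξ : ℝ) : ℝ) : ℂ) * Complex.I := by
    rw [real_inner_smul_left, real_inner_comm]
    push_cast
    ring
  rw [this, Complex.exp_mul_I, ← Complex.ofReal_cos, ← Complex.ofReal_sin, Real.cos_neg,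
    Real.sin_neg]
  simp
  ring

/-- The symbol of the nonlocal operator in terms of the Fourier transform of the micromodulus. -/
theorem stiffness_eq_fourier (hC : IsRadialTensor C) (hint : ∀ i j, Integrable fun ξ => C ξ i j)
    (k : Space d) (i j : Fin d) : ((stiffness C ((2 * Real.pi) • k) i j : ℝ) : ℂ) =
      ((∫ ξ, C ξ i j : ℝ) : ℂ) - 𝓕 (fun ξ => (C ξ i j : ℂ)) k := by
  rw [fourier_even (hint i j) (fun ξ => by rw [hC.neg_apply]), stiffness_apply_eq_sub hint]
  push_cast
  ring

/-- Riemann–Lebesgue: the stiffness is the total integral of `C` minus a Fourier transform of an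
integrable function. -/
theorem tendsto_stiffness (hint : ∀ i j, Integrable fun ξ => C ξ i j) (hC : IsRadialTensor C)
    (i j : Fin d) :
    Tendsto (fun κ => stiffness C κ i j) (cocompact (Space d)) (𝓝 (∫ ξ, C ξ i j)) := by
  have h := tendsto_integral_exp_inner_smul_cocompact (fun ξ => (C ξ i j : ℂ))
  have hs : Tendsto (fun κ : Space d => (2 * Real.pi)⁻¹ • κ) (cocompact _) (cocompact _) :=
    (Homeomorph.smulOfNeZero (2 * Real.pi)⁻¹ (by positivity)).isClosedEmbedding.tendsto_cocompact
  have h2 : Tendsto (fun κ : Space d => ((∫ ξ, C ξ i j : ℝ) : ℂ) -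
      𝓕 (fun ξ => (C ξ i j : ℂ)) ((2 * Real.pi)⁻¹ • κ)) (cocompact _)
      (𝓝 (((∫ ξ, C ξ i j : ℝ) : ℂ) - 0)) := by
    refine tendsto_const_nhds.sub ?_
    have := h.comp hs
    simpa only [Function.comp_def, Real.fourier_eq] using this
  rw [sub_zero] at h2
  have h3 := (Complex.continuous_re.tendsto _).comp h2
  rw [Complex.ofReal_re] at h3
  refine h3.congr fun κ => ?_
  rw [Function.comp_apply, ← stiffness_eq_fourier hC hint, smul_smul,
    mul_inv_cancel₀ (by positivity), one_smul, Complex.ofReal_re]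

end Stiffness

/-! ### The direction projection and the inverse symbol -/

/-- For `κ ≠ 0` this is the orthogonal projection onto the line of `κ`; at `κ = 0` the division by
zero makes it the zero matrix, which is idempotent too. -/
theorem directionTensor_mul_self (κ : Space d) (i j : Fin d) :
    ∑ l, directionTensor i l κ * directionTensor l j κ = directionTensor i j κ := by
  by_cases hκ : κ = 0
  · simp [directionTensor, hκ]
  have hn : ‖κ‖ ≠ 0 := by simpa using hκ
  have h : ∑ l, κ l * κ l = ‖κ‖ ^ 2 := by
    rw [EuclideanSpace.real_norm_sq_eq]
    exact Finset.sum_congr rfl fun l _ => (sq _).symm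
  have : ∀ l, directionTensor i l κ * directionTensor l j κ =
      κ i * κ j / ‖κ‖ ^ 4 * (κ l * κ l) := fun l => by
    simp only [directionTensor]
    field_simp
  rw [Finset.sum_congr rfl fun l _ => this l, ← Finset.mul_sum, h, directionTensor]
  field_simp

theorem abs_directionTensor_le (i j : Fin d) (κ : Space d) : |directionTensor i j κ| ≤ 1 := by
  rw [directionTensor, abs_div, abs_mul, abs_of_nonneg (sq_nonneg ‖κ‖), sq]
  refine div_le_one_of_le₀ ?_ (by positivity)
  have h : ∀ l, |κ l| ≤ ‖κ‖ := fun l => PiLp.norm_apply_le κ l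
  exact mul_le_mul (h i) (h j) (abs_nonneg _) (norm_nonneg _)

section Symbol

variable [NeZero d] {C : Space d → Matrix (Fin d) (Fin d) ℝ}

theorem stiffness_apply_eq (hC : IsRadialTensor C) (hint : ∀ i j, Integrable fun ξ => C ξ i j)
    (κ : Space d) (i j : Fin d) : stiffness C κ i j =
      shear C ‖κ‖ * (if i = j then 1 else 0) +
        directionTensor i j κ * (tensile C ‖κ‖ - shear C ‖κ‖) := by
  have h := (isIsotropic_stiffness hC hint).apply_eq κ i j
  simp only [Matrix.map_apply] at h
  apply Complex.ofReal_injective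
  rw [h]
  simp only [shear, tensile]
  push_cast
  split_ifs <;> simp

/-- A constant isotropic matrix is scalar. Hence both stiffnesses have the same limit, and `∫ C₀₀`
is the value `M(∞)`. -/
theorem integral_modulus (hC : IsRadialTensor C) (hint : ∀ i j, Integrable fun ξ => C ξ i j)
    (i j : Fin d) : ∫ ξ, C ξ i j = if i = j then ∫ ξ, C ξ 0 0 else 0 := by
  have hI := isIsotropic_const_integral hC hint
  have h := hI.apply_eq 0 i j
  have h' := hI.diag_eq (κ := 0) (i := 1) (j := 0) (by simp)
  simp only [Matrix.of_apply] at h h'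
  rw [h'] at h
  apply Complex.ofReal_injective
  rw [h]
  split_ifs <;> simp

theorem tendsto_single_cocompact :
    Tendsto (fun k : ℝ => (EuclideanSpace.single 0 k : Space d)) atTop (cocompact (Space d)) := by
  rw [← Metric.cobounded_eq_cocompact, ← tendsto_norm_atTop_iff_cobounded]
  simpa using tendsto_abs_atTop_atTop (G := ℝ)

theorem tendsto_tensile (hC : IsRadialTensor C) (hint : ∀ i j, Integrable fun ξ => C ξ i j) :
    Tendsto (tensile C) atTop (𝓝 (∫ ξ, C ξ 0 0)) :=
  (tendsto_stiffness hint hC 0 0).comp tendsto_single_cocompact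

theorem tendsto_shear (hC : IsRadialTensor C) (hint : ∀ i j, Integrable fun ξ => C ξ i j) :
    Tendsto (shear C) atTop (𝓝 (∫ ξ, C ξ 0 0)) := by
  have h := integral_modulus hC hint 1 1
  rw [if_pos rfl] at h
  rw [← h]
  exact (tendsto_stiffness hint hC 1 1).comp tendsto_single_cocompact

theorem tensile_nonneg (hM : ∀ κ, (stiffness C κ).PosSemidef) (k : ℝ) : 0 ≤ tensile C k :=
  (hM _).diag_nonneg

theorem shear_nonneg (hM : ∀ κ, (stiffness C κ).PosSemidef) (k : ℝ) : 0 ≤ shear C k :=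
  (hM _).diag_nonneg

theorem continuous_single : Continuous fun k : ℝ => (EuclideanSpace.single 0 k : Space d) := by
  have : (fun k : ℝ => (EuclideanSpace.single 0 k : Space d)) =
      fun k => k • (basisVec 0 : Space d) := by
    ext k l
    simp [basisVec, PiLp.single_apply]
  rw [this]
  fun_prop

theorem continuous_tensile (hint : ∀ i j, Integrable fun ξ => C ξ i j) :
    Continuous (tensile C) := (continuous_stiffness hint 0 0).comp continuous_single

theorem continuous_shear (hint : ∀ i j, Integrable fun ξ => C ξ i j) :
    Continuous (shear C) := (continuous_stiffness hint 1 1).comp continuous_single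

/-- A number off the closed negative axis keeps a positive distance from it. -/
theorem exists_pos_le_norm_add {z : ℂ} (hz : z ∈ Complex.slitPlane) :
    ∃ δ > 0, ∀ m : ℝ, 0 ≤ m → δ ≤ ‖z + m‖ := by
  rcases hz with h | h
  · refine ⟨z.re, h, fun m hm => ?_⟩
    calc z.re ≤ (z + m).re := by simp [hm]
      _ ≤ ‖z + m‖ := Complex.re_le_norm _
  · refine ⟨|z.im|, abs_pos.2 h, fun m hm => ?_⟩
    calc |z.im| = |(z + m).im| := by simp
      _ ≤ ‖z + m‖ := Complex.abs_im_le_norm _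

theorem exists_pos_le_norm_dynamic {ρ : ℝ} {s : ℂ} (hρ : 0 < ρ) (hs : s ^ 2 ∈ Complex.slitPlane) :
    ∃ δ > 0, ∀ m : ℝ, 0 ≤ m → δ ≤ ‖(ρ : ℂ) * s ^ 2 + m‖ := by
  apply exists_pos_le_norm_add
  rcases hs with h | h
  · left; simpa using mul_pos hρ h
  · right; simpa using ⟨hρ.ne', h⟩

theorem continuous_compliance {ρ : ℝ} {s : ℂ} (hρ : 0 < ρ) (hs : s ^ 2 ∈ Complex.slitPlane)
    {m : ℝ → ℝ} (hm : Continuous m) (hm0 : ∀ k, 0 ≤ m k) :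
    Continuous fun k => compliance ρ s (m k) := by
  obtain ⟨δ, hδ, h⟩ := exists_pos_le_norm_dynamic hρ hs
  refine Continuous.div (by fun_prop) (by fun_prop) fun k h0 => ?_
  have := h (m k) (hm0 k)
  rw [h0, norm_zero] at this
  linarith

theorem exists_norm_compliance_le {ρ : ℝ} {s : ℂ} (hρ : 0 < ρ) (hs : s ^ 2 ∈ Complex.slitPlane) :
    ∃ B, ∀ m : ℝ, 0 ≤ m → ‖compliance ρ s m‖ ≤ B := by
  obtain ⟨δ, hδ, h⟩ := exists_pos_le_norm_dynamic hρ hs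
  refine ⟨1 / δ, fun m hm => ?_⟩
  rw [compliance, norm_div, norm_one]
  exact one_div_le_one_div_of_le hδ (h m hm)

/-- The inverse of `ρ s² I + M(κ)`, in components. -/
def greenSymbol (C : Space d → Matrix (Fin d) (Fin d) ℝ) (ρ : ℝ) (s : ℂ) (κ : Space d) :
    Matrix (Fin d) (Fin d) ℂ :=
  Matrix.of fun i j => (if i = j then 1 else 0) * compliance ρ s (shear C ‖κ‖) +
    (directionTensor i j κ : ℂ) *
      (compliance ρ s (tensile C ‖κ‖) - compliance ρ s (shear C ‖κ‖))

/-- Both factors are combinations of the identity and one idempotent `T`, so the product only needs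
`T * T = T` and the two scalar inverses `P` and `Q`. -/
theorem dynamicStiffness_mul_greenSymbol {ρ : ℝ} {s : ℂ} (hρ : 0 < ρ)
    (hs : s ^ 2 ∈ Complex.slitPlane) (hC : IsRadialTensor C)
    (hint : ∀ i j, Integrable fun ξ => C ξ i j) (hM : ∀ κ, (stiffness C κ).PosSemidef)
    (κ : Space d) : dynamicStiffness C ρ s κ * greenSymbol C ρ s κ = 1 := by
  obtain ⟨δ, hδ, h⟩ := exists_pos_le_norm_dynamic hρ hs
  have hne : ∀ m : ℝ, 0 ≤ m → (ρ : ℂ) * s ^ 2 + m ≠ 0 := fun m hm h0 => by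
    have := h m hm
    rw [h0, norm_zero] at this
    linarith
  set Q := compliance ρ s (shear C ‖κ‖) with hQ
  set P := compliance ρ s (tensile C ‖κ‖) with hP
  set T : Matrix (Fin d) (Fin d) ℂ := Matrix.of fun i j => (directionTensor i j κ : ℂ) with hT
  have hTT : T * T = T := by
    ext i j
    rw [Matrix.mul_apply, hT]
    simp only [Matrix.of_apply, ← Complex.ofReal_mul, ← Complex.ofReal_sum,
      directionTensor_mul_self]
  have hD : dynamicStiffness C ρ s κ = ((ρ : ℂ) * s ^ 2 + shear C ‖κ‖) • 1 +
      ((tensile C ‖κ‖ : ℂ) - shear C ‖κ‖) • T := by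
    ext i j
    simp only [dynamicStiffness, Matrix.add_apply, Matrix.smul_apply, Matrix.map_apply,
      stiffness_apply_eq hC hint κ i j, Matrix.one_apply, hT, Matrix.of_apply, smul_eq_mul]
    push_cast
    split_ifs <;> simp <;> ring
  have hG : greenSymbol C ρ s κ = Q • 1 + (P - Q) • T := by
    ext i j
    simp only [greenSymbol, Matrix.add_apply, Matrix.smul_apply, Matrix.one_apply, hT,
      Matrix.of_apply, smul_eq_mul]
    split_ifs <;> simp <;> ring
  have h1 : ((ρ : ℂ) * s ^ 2 + shear C ‖κ‖) * Q = 1 :=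
    mul_one_div_cancel (hne _ (shear_nonneg hM _))
  have h2 : ((ρ : ℂ) * s ^ 2 + tensile C ‖κ‖) * P = 1 :=
    mul_one_div_cancel (hne _ (tensile_nonneg hM _))
  rw [hD, hG, add_mul, mul_add, mul_add]
  simp only [smul_mul_smul_comm, mul_one, one_mul, hTT, h1, one_smul]
  rw [add_assoc, ← add_smul, ← add_smul]
  have h3 : ((ρ : ℂ) * s ^ 2 + shear C ‖κ‖) * (P - Q) + (((tensile C ‖κ‖ : ℂ) - shear C ‖κ‖) * Q +
      ((tensile C ‖κ‖ : ℂ) - shear C ‖κ‖) * (P - Q)) = 0 := by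
    linear_combination h2 - h1
  rw [h3, zero_smul, add_zero]

theorem isUnit_dynamicStiffness {ρ : ℝ} {s : ℂ} (hρ : 0 < ρ)
    (hs : s ^ 2 ∈ Complex.slitPlane) (hC : IsRadialTensor C)
    (hint : ∀ i j, Integrable fun ξ => C ξ i j) (hM : ∀ κ, (stiffness C κ).PosSemidef)
    (κ : Space d) : IsUnit (dynamicStiffness C ρ s κ) :=
  (Matrix.isUnit_iff_isUnit_det _).2 (Matrix.isUnit_det_of_right_inverse
    (dynamicStiffness_mul_greenSymbol hρ hs hC hint hM κ))

theorem inv_dynamicStiffness {ρ : ℝ} {s : ℂ} (hρ : 0 < ρ)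
    (hs : s ^ 2 ∈ Complex.slitPlane) (hC : IsRadialTensor C)
    (hint : ∀ i j, Integrable fun ξ => C ξ i j) (hM : ∀ κ, (stiffness C κ).PosSemidef)
    (κ : Space d) : (dynamicStiffness C ρ s κ)⁻¹ = greenSymbol C ρ s κ :=
  Matrix.inv_eq_right_inv (dynamicStiffness_mul_greenSymbol hρ hs hC hint hM κ)

theorem greenSymbol_symm (ρ : ℝ) (s : ℂ) (κ : Space d) (i j : Fin d) :
    greenSymbol C ρ s κ i j = greenSymbol C ρ s κ j i := by
  simp only [greenSymbol, Matrix.of_apply, directionTensor, eq_comm (a := i), mul_comm (κ i)]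

theorem exists_norm_greenSymbol_le {ρ : ℝ} {s : ℂ} (hρ : 0 < ρ) (hs : s ^ 2 ∈ Complex.slitPlane)
    (hM : ∀ κ, (stiffness C κ).PosSemidef) :
    ∃ B, ∀ κ i j, ‖greenSymbol C ρ s κ i j‖ ≤ B := by
  obtain ⟨B, hB⟩ := exists_norm_compliance_le hρ hs
  have hB0 : 0 ≤ B := (norm_nonneg _).trans (hB 0 le_rfl)
  refine ⟨B + 1 * (B + B), fun κ i j => ?_⟩
  rw [greenSymbol, Matrix.of_apply]
  refine (norm_add_le _ _).trans (add_le_add ?_ ?_)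
  · rw [norm_mul]
    refine (mul_le_of_le_one_left (norm_nonneg _) ?_).trans (hB _ (shear_nonneg hM _))
    split_ifs <;> simp
  · rw [norm_mul]
    refine mul_le_mul ?_ ((norm_sub_le _ _).trans (add_le_add (hB _ (tensile_nonneg hM _))
      (hB _ (shear_nonneg hM _)))) (norm_nonneg _) zero_le_one
    simpa using abs_directionTensor_le i j κ

end Symbol

/-! ### Smooth symbols of temperate growth -/

section TemperateGrowth

open scoped ContDiff

variable {E : Type*} [NormedAddCommGroup E] [NormedSpace ℝ E]

/-- Each moment yields one more derivative, bounded by an `L¹` norm; so the polynomial exponent can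
be taken to be `0`. -/
theorem hasTemperateGrowth_fourier {f : Space d → ℂ}
    (hf : ∀ n : ℕ, Integrable fun x => ‖x‖ ^ n * ‖f x‖) (hm : AEStronglyMeasurable f) :
    (𝓕 f).HasTemperateGrowth := by
  refine ⟨Real.contDiff_fourier (N := ⊤) fun n _ => hf n, fun n => ?_⟩
  refine ⟨0, ∫ x, ‖VectorFourier.fourierPowSMulRight (innerSL ℝ) f x n‖, fun x => ?_⟩
  rw [Real.iteratedFDeriv_fourier (N := ⊤) (fun n _ => hf n) hm (by exact_mod_cast le_top), pow_zero,
    mul_one]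
  exact VectorFourier.norm_fourierIntegral_le_integral_norm _ _ _ _ _

/-- The values of `f` lie in an open annulus whose closure is compact and avoids the origin. There
`z ↦ z⁻¹` has bounded derivatives of every order, and composition preserves temperate growth. -/
theorem hasTemperateGrowth_inv {f : E → ℂ} (hf : f.HasTemperateGrowth) {δ B : ℝ} (hδ : 0 < δ)
    (h1 : ∀ x, δ ≤ ‖f x‖) (h2 : ∀ x, ‖f x‖ ≤ B) :
    (fun x => (f x)⁻¹).HasTemperateGrowth := by
  set t : Set ℂ := {z | δ / 2 < ‖z‖ ∧ ‖z‖ < B + 1} with ht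
  have hto : IsOpen t :=
    (isOpen_lt continuous_const continuous_norm).inter (isOpen_lt continuous_norm continuous_const)
  set K : Set ℂ := {z | δ / 2 ≤ ‖z‖ ∧ ‖z‖ ≤ B + 1} with hK
  have hKc : IsCompact K := by
    have : K = {z | δ / 2 ≤ ‖z‖} ∩ Metric.closedBall 0 (B + 1) := by
      ext z; simp [hK]
    rw [this]
    exact (isCompact_closedBall _ _).inter_left (isClosed_le continuous_const continuous_norm)
  have hKne : ∀ z ∈ K, z ≠ 0 := fun z hz h0 => by
    have := hz.1
    rw [h0, norm_zero] at this
    linarith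
  have htK : t ⊆ K := fun z hz => ⟨hz.1.le, hz.2.le⟩
  have hbound : ∀ n : ℕ, ∃ c, ∀ z ∈ K, ‖iteratedFDeriv ℝ n (fun z : ℂ => z⁻¹) z‖ ≤ c := by
    intro n
    apply hKc.exists_bound_of_continuousOn
    intro z hz
    have hcd : ContDiffAt ℝ ∞ (fun z : ℂ => z⁻¹) z := contDiffAt_inv ℝ (hKne z hz)
    exact (hcd.continuousAt_iteratedFDeriv (by exact_mod_cast le_top)).continuousWithinAt
  choose c hc using hbound
  refine Function.HasTemperateGrowth.comp' (g := fun z : ℂ => z⁻¹) (t := t) ?_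
    hto.uniqueDiffOn ?_ ?_ hf
  · rintro _ ⟨x, rfl⟩
    exact ⟨by linarith [h1 x], by linarith [h2 x]⟩
  · exact fun z hz => (contDiffAt_inv ℝ (hKne z (htK hz))).contDiffWithinAt
  · intro N
    refine ⟨0, ∑ n ∈ Finset.range (N + 1), |c n|, Finset.sum_nonneg fun _ _ => abs_nonneg _,
      fun n hn z hz => ?_⟩
    rw [iteratedFDerivWithin_of_isOpen n hto hz, pow_zero, mul_one]
    refine (hc n z (htK hz)).trans ((le_abs_self _).trans ?_)
    exact Finset.single_le_sum (f := fun n => |c n|) (fun _ _ => abs_nonneg _)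
      (Finset.mem_range.2 (Nat.lt_succ_of_le hn))

theorem hasTemperateGrowth_prod {ι : Type*} (s : Finset ι) {f : ι → E → ℂ}
    (hf : ∀ i ∈ s, (f i).HasTemperateGrowth) :
    (fun x => ∏ i ∈ s, f i x).HasTemperateGrowth := by
  classical
  induction s using Finset.induction_on with
  | empty => simp
  | insert a s has ih =>
    simp only [Finset.prod_insert has]
    exact (hf a (Finset.mem_insert_self a s)).mul
      (ih fun i hi => hf i (Finset.mem_insert_of_mem hi))

theorem hasTemperateGrowth_det {A : E → Matrix (Fin d) (Fin d) ℂ}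
    (hA : ∀ i j, (fun x => A x i j).HasTemperateGrowth) :
    (fun x => (A x).det).HasTemperateGrowth := by
  simp only [Matrix.det_apply']
  refine Function.HasTemperateGrowth.sum fun σ _ => ?_
  exact (Function.HasTemperateGrowth.const _).mul (hasTemperateGrowth_prod _ fun i _ => hA _ _)

theorem hasTemperateGrowth_adjugate {A : E → Matrix (Fin d) (Fin d) ℂ}
    (hA : ∀ i j, (fun x => A x i j).HasTemperateGrowth) (i j : Fin d) :
    (fun x => (A x).adjugate i j).HasTemperateGrowth := by
  simp only [Matrix.adjugate_apply]
  refine hasTemperateGrowth_det fun k l => ?_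
  by_cases hk : k = j
  · subst hk
    simp
  · simpa [Matrix.updateRow_ne hk] using hA k l

end TemperateGrowth

/-! ### Inverse Fourier transforms of bounded symbols -/

section Distributions

/-- The tempered distribution whose Fourier transform is the bounded function `m`. -/
def invFourierOfBounded (m : Space d → ℂ) (hm : MemLp m ⊤) : 𝓢'(Space d, ℂ) :=
  𝓕⁻ (Lp.toTemperedDistribution (hm.toLp m))

theorem invFourierOfBounded_apply {m : Space d → ℂ} (hm : MemLp m ⊤) (φ : 𝓢(Space d, ℂ)) :
    invFourierOfBounded m hm φ = ∫ k, (𝓕⁻ φ) k * m k := by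
  rw [invFourierOfBounded, TemperedDistribution.fourierInv_apply, Lp.toTemperedDistribution_apply]
  refine integral_congr_ae ?_
  filter_upwards [hm.coeFn_toLp] with k hk
  rw [hk, smul_eq_mul]

theorem fourier_invFourierOfBounded_apply {m : Space d → ℂ} (hm : MemLp m ⊤)
    (φ : 𝓢(Space d, ℂ)) : 𝓕 (invFourierOfBounded m hm) φ = ∫ k, φ k * m k := by
  rw [TemperedDistribution.fourier_apply, invFourierOfBounded_apply,
    FourierTransform.fourierInv_fourier_eq]

theorem integrable_mul_of_memLp_top (φ : 𝓢(Space d, ℂ)) {m : Space d → ℂ} (hm : MemLp m ⊤) :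
    Integrable fun k => φ k * m k :=
  φ.integrable.mul_of_top_left hm

theorem isFunction_fourier_invFourierOfBounded {m : Space d → ℂ} (hm : MemLp m ⊤) :
    IsFunction (𝓕 (invFourierOfBounded m hm)) m :=
  fun φ => ⟨integrable_mul_of_memLp_top φ hm, fourier_invFourierOfBounded_apply hm φ⟩

end Distributions

/-! ### Existence and uniqueness of the fundamental solution -/

section FundamentalSolution

variable {C : Space d → Matrix (Fin d) (Fin d) ℝ}

theorem integrable_of_moments (hint : ∀ (n : ℕ) (i j : Fin d),
    Integrable fun ξ : Space d => ‖ξ‖ ^ n * C ξ i j) (i j : Fin d) :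
    Integrable fun ξ => C ξ i j := by
  simpa using hint 0 i j

theorem exists_norm_dynamicStiffness_le (hint : ∀ i j, Integrable fun ξ => C ξ i j) (ρ : ℝ)
    (s : ℂ) : ∃ B, ∀ κ i j, ‖dynamicStiffness C ρ s κ i j‖ ≤ B := by
  refine ⟨‖(ρ : ℂ) * s ^ 2‖ + ∑ i, ∑ j, ∫ ξ, 2 * |C ξ i j|, fun κ i j => ?_⟩
  simp only [dynamicStiffness, Matrix.add_apply, Matrix.map_apply, Matrix.smul_apply]
  refine (norm_add_le _ _).trans (add_le_add ?_ ?_)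
  · rw [Matrix.one_apply, smul_eq_mul, norm_mul]
    refine mul_le_of_le_one_right (norm_nonneg _) ?_
    split_ifs <;> simp
  · have h0 : ∀ i j, 0 ≤ ∫ ξ, 2 * |C ξ i j| := fun i j =>
      integral_nonneg fun ξ => mul_nonneg zero_le_two (abs_nonneg _)
    have h1 : ‖((stiffness C κ i j : ℝ) : ℂ)‖ ≤ ∫ ξ, 2 * |C ξ i j| := by
      rw [Complex.norm_real]
      refine norm_integral_le_of_norm_le ((hint i j).abs.const_mul 2) (ae_of_all _ fun ξ => ?_)
      rw [Real.norm_eq_abs, abs_mul]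
      refine mul_le_mul_of_nonneg_right ?_ (abs_nonneg _)
      rw [abs_le]
      constructor <;>
        linarith [Real.cos_le_one (inner ℝ κ ξ), Real.neg_one_le_cos (inner ℝ κ ξ)]
    refine h1.trans ((Finset.single_le_sum (f := fun j => ∫ ξ, 2 * |C ξ i j|)
      (fun j _ => h0 i j) (Finset.mem_univ j)).trans ?_)
    exact Finset.single_le_sum (f := fun i => ∑ j, ∫ ξ, 2 * |C ξ i j|)
      (fun i _ => Finset.sum_nonneg fun j _ => h0 i j) (Finset.mem_univ i)

/-- The stiffness entry as a complex function of the frequency `k = κ / 2π`. -/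
def stiffnessSymbol (C : Space d → Matrix (Fin d) (Fin d) ℝ) (i j : Fin d) (k : Space d) : ℂ :=
  (stiffness C ((2 * Real.pi) • k) i j : ℝ)

theorem hasTemperateGrowth_stiffnessSymbol (hC : IsRadialTensor C)
    (hint : ∀ (n : ℕ) (i j : Fin d), Integrable fun ξ : Space d => ‖ξ‖ ^ n * C ξ i j)
    (i j : Fin d) : (stiffnessSymbol C i j).HasTemperateGrowth := by
  have h : stiffnessSymbol C i j = fun k => ((∫ ξ, C ξ i j : ℝ) : ℂ) -
      𝓕 (fun ξ => (C ξ i j : ℂ)) k :=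
    funext fun k => stiffness_eq_fourier hC (integrable_of_moments hint) k i j
  rw [h]
  refine Function.HasTemperateGrowth.fun_sub (.const _) (hasTemperateGrowth_fourier (fun n => ?_) ?_)
  · refine (hint n i j).norm.congr (ae_of_all _ fun x => ?_)
    simp
  · exact (integrable_of_moments hint i j).ofReal.aestronglyMeasurable

/-- The transposed nonlocal operator is a Fourier multiplier. -/
theorem fourier_stiffness_mul (hC : IsRadialTensor C)
    (hint : ∀ (n : ℕ) (i j : Fin d), Integrable fun ξ : Space d => ‖ξ‖ ^ n * C ξ i j)
    (i j : Fin d) (φ : 𝓢(Space d, ℂ)) (x : Space d) :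
    (-𝓕 (SchwartzMap.smulLeftCLM ℂ (stiffnessSymbol C i j) (𝓕⁻ φ)) : 𝓢(Space d, ℂ)) x =
      ∫ ξ, (C ξ i j : ℂ) * (φ (x - ξ) - φ x) := by
  have hint0 := integrable_of_moments hint
  set h := 𝓕⁻ φ with hh
  have hφ : φ = 𝓕 h := (FourierTransform.fourier_fourierInv_eq φ).symm
  have hφx : ∀ y, φ y = ∫ k, Real.fourierChar (-inner ℝ k y) • h k := fun y => by
    rw [hφ, SchwartzMap.fourier_coe, Real.fourier_eq]
  set g : Space d → ℂ := fun k => Real.fourierChar (-inner ℝ k x) • h k with hg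
  have hgi : Integrable g := (Real.fourierIntegral_convergent_iff x).2 h.integrable
  have hCi : Integrable fun ξ => (C ξ i j : ℂ) := (hint0 i j).ofReal
  have hgF : ∀ ξ, 𝓕 g ξ = φ (x + ξ) := by
    intro ξ
    rw [Real.fourier_eq, hφx]
    congr 1
    ext k
    rw [hg, smul_smul, ← AddChar.map_add_eq_mul, inner_add_right, neg_add, add_comm]
  -- The self-adjointness of the Fourier integral moves the transform from `C` to the modulated
  -- function `g`, whose transform is a translate of `φ`.
  have hflip : ∫ k, 𝓕 (fun ξ => (C ξ i j : ℂ)) k * g k = ∫ ξ, (C ξ i j : ℂ) * φ (x + ξ) := by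
    have := VectorFourier.integral_fourierIntegral_smul_eq_flip (L := innerₗ (Space d))
      (μ := volume) (ν := volume) Real.continuous_fourierChar continuous_inner hCi hgi
    rw [flip_innerₗ] at this
    simp only [smul_eq_mul] at this
    rw [show (∫ ξ, (C ξ i j : ℂ) * φ (x + ξ)) = ∫ ξ, (C ξ i j : ℂ) * 𝓕 g ξ by simp only [hgF]]
    exact this
  have hbd : Integrable fun k => 𝓕 (fun ξ => (C ξ i j : ℂ)) k * g k := by
    refine hgi.bdd_mul (c := ∫ ξ, ‖(C ξ i j : ℂ)‖) ?_ (ae_of_all _ fun k =>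
      VectorFourier.norm_fourierIntegral_le_integral_norm _ _ _ _ _)
    exact (hasTemperateGrowth_fourier (fun n => by
      simpa using (hint n i j).norm) hCi.aestronglyMeasurable).1.continuous.aestronglyMeasurable
  -- Evenness of `C` makes the operator equal to its own spatial transpose.
  have hev : ∫ ξ, (C ξ i j : ℂ) * φ (x + ξ) = ∫ ξ, (C ξ i j : ℂ) * φ (x - ξ) := by
    rw [← integral_neg_eq_self]
    simp only [hC.neg_apply, sub_eq_add_neg]
  have hφb : Integrable fun ξ => (C ξ i j : ℂ) * φ (x - ξ) := by
    refine hCi.mul_bdd (c := SchwartzMap.seminorm ℝ 0 0 φ)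
      (by fun_prop) (ae_of_all _ fun ξ => SchwartzMap.norm_le_seminorm ℝ φ _)
  simp only [mul_sub]
  rw [integral_sub hφb (hCi.mul_const _), integral_mul_const, ← hev, ← hflip]
  rw [neg_apply, SchwartzMap.fourier_coe, Real.fourier_eq]
  have e1 : ∀ k, Real.fourierChar (-inner ℝ k x) •
      (SchwartzMap.smulLeftCLM ℂ (stiffnessSymbol C i j) h) k =
      ((∫ ξ, C ξ i j : ℝ) : ℂ) * g k - 𝓕 (fun ξ => (C ξ i j : ℂ)) k * g k := by
    intro k
    rw [SchwartzMap.smulLeftCLM_apply_apply (hasTemperateGrowth_stiffnessSymbol hC hint i j),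
      stiffnessSymbol, stiffness_eq_fourier hC hint0, hg]
    simp only [Circle.smul_def, smul_eq_mul]
    ring
  simp only [e1]
  rw [integral_sub (hgi.const_mul _) hbd, integral_const_mul, ← hφx, integral_complex_ofReal]
  ring

theorem hasTemperateGrowth_dynamicStiffness (hC : IsRadialTensor C)
    (hint : ∀ (n : ℕ) (i j : Fin d), Integrable fun ξ : Space d => ‖ξ‖ ^ n * C ξ i j)
    (ρ : ℝ) (s : ℂ) (i j : Fin d) :
    (fun k : Space d => dynamicStiffness C ρ s ((2 * Real.pi) • k) i j).HasTemperateGrowth := by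
  simp only [dynamicStiffness, Matrix.add_apply, Matrix.map_apply]
  exact Function.HasTemperateGrowth.fun_add (.const _) (hasTemperateGrowth_stiffnessSymbol hC hint i j)

variable {ρ : ℝ} {s : ℂ}

/-- Test functions are written as `φ = 𝓕 h`. The required `ψ_l` are then forced to be multiplier
images of `h`, and the point force becomes the constant symbol, as `(𝓕 h) 0 = ∫ h`. -/
theorem isFundamentalSolution_iff_fourier (hC : IsRadialTensor C)
    (hint : ∀ (n : ℕ) (i j : Fin d), Integrable fun ξ : Space d => ‖ξ‖ ^ n * C ξ i j)
    (i : Fin d) (v : Fin d → 𝓢'(Space d, ℂ)) :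
    IsFundamentalSolution C ρ s i v ↔ ∀ (j : Fin d) (h : 𝓢(Space d, ℂ)),
      (ρ : ℂ) * s ^ 2 * 𝓕 (v j) h +
        ∑ l, 𝓕 (v l) (SchwartzMap.smulLeftCLM ℂ (stiffnessSymbol C j l) h) =
        if i = j then ∫ k, h k else 0 := by
  have hzero : ∀ h : 𝓢(Space d, ℂ), (𝓕 h) 0 = ∫ k, h k := fun h => by
    rw [SchwartzMap.fourier_coe, Real.fourier_eq]
    simp
  constructor
  · intro H j h
    obtain ⟨ψ, hψ, heq⟩ := H j (𝓕 h)
    have hψ' : ∀ l, ψ l = -𝓕 (SchwartzMap.smulLeftCLM ℂ (stiffnessSymbol C j l) h) := fun l => by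
      ext x
      have h1 := fourier_stiffness_mul hC hint j l (𝓕 h) x
      rw [FourierTransform.fourierInv_fourier_eq] at h1
      rw [hψ, h1]
    simp only [hψ', map_neg, Finset.sum_neg_distrib, hzero] at heq
    simp only [TemperedDistribution.fourier_apply]
    rw [heq]
    ring
  · intro H j φ
    refine ⟨fun l => -𝓕 (SchwartzMap.smulLeftCLM ℂ (stiffnessSymbol C j l) (𝓕⁻ φ)),
      fun l x => fourier_stiffness_mul hC hint j l φ x, ?_⟩
    have h1 := H j (𝓕⁻ φ)
    rw [← hzero] at h1
    simp only [TemperedDistribution.fourier_apply, FourierTransform.fourier_fourierInv_eq] at h1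
    rw [← h1]
    simp only [map_neg, Finset.sum_neg_distrib]
    ring

variable [NeZero d]

/-- The formula in components hides smoothness at the origin, where the direction tensor jumps.
Cramer's rule shows it: adjugate and determinant are polynomials in smooth entries, and the
determinant is bounded below because its product with the bounded determinant of the inverse is `1`.
-/
theorem hasTemperateGrowth_greenSymbol (hρ : 0 < ρ) (hs : s ^ 2 ∈ Complex.slitPlane)
    (hC : IsRadialTensor C)
    (hint : ∀ (n : ℕ) (i j : Fin d), Integrable fun ξ : Space d => ‖ξ‖ ^ n * C ξ i j)
    (hM : ∀ κ, (stiffness C κ).PosSemidef) (i j : Fin d) :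
    (fun k : Space d => greenSymbol C ρ s ((2 * Real.pi) • k) i j).HasTemperateGrowth := by
  have hint0 := integrable_of_moments hint
  obtain ⟨B, hB⟩ := exists_norm_greenSymbol_le hρ hs hM
  obtain ⟨B', hB'⟩ := exists_norm_dynamicStiffness_le hint0 ρ s
  have hD : ∀ κ, dynamicStiffness C ρ s κ * greenSymbol C ρ s κ = 1 :=
    dynamicStiffness_mul_greenSymbol hρ hs hC hint0 hM
  have hG : ∀ κ, ‖(greenSymbol C ρ s κ).det‖ ≤ d.factorial * B ^ d + 1 := fun κ => by
    have := Matrix.det_le (abv := NormedField.toAbsoluteValue ℂ) (hB κ)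
    simp only [Fintype.card_fin, nsmul_eq_mul] at this
    exact this.trans (by linarith)
  have hU : ∀ κ, ‖(dynamicStiffness C ρ s κ).det‖ ≤ d.factorial * B' ^ d := fun κ => by
    have := Matrix.det_le (abv := NormedField.toAbsoluteValue ℂ) (hB' κ)
    simp only [Fintype.card_fin, nsmul_eq_mul] at this
    exact this
  -- The added `1` makes the bound strictly positive, so that it can be inverted without asking
  -- whether `B` vanishes.
  have hpos : 0 < d.factorial * B ^ d + 1 := by
    have : 0 ≤ B := (norm_nonneg _).trans (hB 0 0 0)
    positivity
  have hL : ∀ κ, (d.factorial * B ^ d + 1)⁻¹ ≤ ‖(dynamicStiffness C ρ s κ).det‖ := fun κ => by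
    have h1 : ‖(dynamicStiffness C ρ s κ).det‖ * ‖(greenSymbol C ρ s κ).det‖ = 1 := by
      rw [← norm_mul, ← Matrix.det_mul, hD, Matrix.det_one, norm_one]
    rw [inv_le_iff_one_le_mul₀ hpos]
    exact h1.symm.le.trans (mul_le_mul_of_nonneg_left (hG κ) (norm_nonneg _))
  have heq : (fun k : Space d => greenSymbol C ρ s ((2 * Real.pi) • k) i j) = fun k =>
      ((dynamicStiffness C ρ s ((2 * Real.pi) • k)).det)⁻¹ *
        (dynamicStiffness C ρ s ((2 * Real.pi) • k)).adjugate i j := by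
    ext k
    rw [← inv_dynamicStiffness hρ hs hC hint0 hM, Matrix.inv_def, Ring.inverse_eq_inv',
      Matrix.smul_apply, smul_eq_mul]
  rw [heq]
  exact (hasTemperateGrowth_inv (hasTemperateGrowth_det
    (hasTemperateGrowth_dynamicStiffness hC hint ρ s)) (inv_pos.2 hpos) (fun k => hL _)
    fun k => hU _).fun_mul (hasTemperateGrowth_adjugate
    (hasTemperateGrowth_dynamicStiffness hC hint ρ s) i j)

theorem memLp_top_greenSymbol (hρ : 0 < ρ) (hs : s ^ 2 ∈ Complex.slitPlane)
    (hC : IsRadialTensor C)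
    (hint : ∀ (n : ℕ) (i j : Fin d), Integrable fun ξ : Space d => ‖ξ‖ ^ n * C ξ i j)
    (hM : ∀ κ, (stiffness C κ).PosSemidef) (i j : Fin d) :
    MemLp (fun k : Space d => greenSymbol C ρ s ((2 * Real.pi) • k) i j) ⊤ := by
  obtain ⟨B, hB⟩ := exists_norm_greenSymbol_le hρ hs hM
  exact memLp_top_of_bound (hasTemperateGrowth_greenSymbol hρ hs hC hint
    hM i j).1.continuous.aestronglyMeasurable B (ae_of_all _ fun k => hB _ i j)

/-- The unique tempered fundamental solution is the inverse Fourier transform of the symbol. -/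
theorem isFundamentalSolution_iff (hρ : 0 < ρ) (hs : s ^ 2 ∈ Complex.slitPlane)
    (hC : IsRadialTensor C)
    (hint : ∀ (n : ℕ) (i j : Fin d), Integrable fun ξ : Space d => ‖ξ‖ ^ n * C ξ i j)
    (hM : ∀ κ, (stiffness C κ).PosSemidef) (i : Fin d) (v : Fin d → 𝓢'(Space d, ℂ)) :
    IsFundamentalSolution C ρ s i v ↔ v = fun j => invFourierOfBounded _
      (memLp_top_greenSymbol hρ hs hC hint hM i j) := by
  have hint0 := integrable_of_moments hint
  have hD : ∀ κ i j, (ρ : ℂ) * s ^ 2 * greenSymbol C ρ s κ i j +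
      ∑ l, (stiffness C κ i l : ℂ) * greenSymbol C ρ s κ l j = if i = j then 1 else 0 := by
    intro κ i j
    have h := congrFun₂ (dynamicStiffness_mul_greenSymbol hρ hs hC hint0 hM κ) i j
    rw [dynamicStiffness, add_mul, smul_mul_assoc, one_mul, Matrix.add_apply, Matrix.smul_apply,
      Matrix.mul_apply, Matrix.one_apply] at h
    exact h
  have hsymm : ∀ κ i j, stiffness C κ i j = stiffness C κ j i := fun κ i j => by
    simp only [stiffness, hC.symm_apply _ i j]
  have hTS := hasTemperateGrowth_stiffnessSymbol hC hint
  have hTG := hasTemperateGrowth_greenSymbol hρ hs hC hint hM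
  rw [isFundamentalSolution_iff_fourier hC hint]
  constructor
  · intro H
    ext m φ
    -- Testing the `j`-th equation with `G_{jm} h` and summing over `j` applies the transposed
    -- matrix to the `m`-th column of its inverse. As `M` is symmetric, only the component `v m`
    -- survives.
    have key : ∀ l (h : 𝓢(Space d, ℂ)),
        ((ρ : ℂ) * s ^ 2) • SchwartzMap.smulLeftCLM ℂ
          (fun k => greenSymbol C ρ s ((2 * Real.pi) • k) l m) h +
        ∑ j, SchwartzMap.smulLeftCLM ℂ (stiffnessSymbol C j l) (SchwartzMap.smulLeftCLM ℂ
          (fun k => greenSymbol C ρ s ((2 * Real.pi) • k) j m) h) =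
        if l = m then h else 0 := by
      intro l h
      ext k
      simp only [add_apply, smul_apply, sum_apply,
        SchwartzMap.smulLeftCLM_apply_apply (hTS _ _), SchwartzMap.smulLeftCLM_apply_apply (hTG _ _),
        stiffnessSymbol, smul_eq_mul]
      have h2 := hD ((2 * Real.pi) • k) l m
      simp only [hsymm _ _ l]
      simp only [← mul_assoc, ← Finset.sum_mul, ← add_mul, h2]
      split_ifs <;> simp
    have hsum := Finset.sum_congr (rfl : (Finset.univ : Finset (Fin d)) = _) fun j _ =>
      H j (SchwartzMap.smulLeftCLM ℂ (fun k => greenSymbol C ρ s ((2 * Real.pi) • k) j m) (𝓕⁻ φ))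
    rw [Finset.sum_add_distrib, Finset.sum_comm, ← Finset.sum_add_distrib] at hsum
    have hl : ∀ l, (ρ : ℂ) * s ^ 2 * 𝓕 (v l) (SchwartzMap.smulLeftCLM ℂ
          (fun k => greenSymbol C ρ s ((2 * Real.pi) • k) l m) (𝓕⁻ φ)) +
        ∑ j, 𝓕 (v l) (SchwartzMap.smulLeftCLM ℂ (stiffnessSymbol C j l) (SchwartzMap.smulLeftCLM ℂ
          (fun k => greenSymbol C ρ s ((2 * Real.pi) • k) j m) (𝓕⁻ φ))) =
        if l = m then 𝓕 (v l) (𝓕⁻ φ) else 0 := by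
      intro l
      rw [← smul_eq_mul, ← map_smul, ← map_sum, ← map_add, key]
      split_ifs <;> simp
    simp only [hl, Finset.sum_ite_eq, Finset.sum_ite_eq', Finset.mem_univ, if_true] at hsum
    rw [TemperedDistribution.fourier_apply, FourierTransform.fourier_fourierInv_eq] at hsum
    rw [hsum, invFourierOfBounded_apply]
    congr 1
    ext k
    rw [SchwartzMap.smulLeftCLM_apply_apply (hTG _ _), smul_eq_mul, mul_comm]
  · rintro rfl j h
    simp only [fourier_invFourierOfBounded_apply, SchwartzMap.smulLeftCLM_apply_apply (hTS _ _)]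
    have hi : ∀ l, Integrable fun k => stiffnessSymbol C j l k • h k *
        greenSymbol C ρ s ((2 * Real.pi) • k) i l := fun l => by
      have := integrable_mul_of_memLp_top (SchwartzMap.smulLeftCLM ℂ (stiffnessSymbol C j l) h)
        (memLp_top_greenSymbol hρ hs hC hint hM i l)
      simpa only [SchwartzMap.smulLeftCLM_apply_apply (hTS _ _)] using this
    rw [← integral_const_mul, ← integral_finsetSum _ fun l _ => hi l,
      ← integral_add ((integrable_mul_of_memLp_top h
        (memLp_top_greenSymbol hρ hs hC hint hM i j)).const_mul _)
        (integrable_finsetSum _ fun l _ => hi l)]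
    have e : ∀ k, (ρ : ℂ) * s ^ 2 * (h k * greenSymbol C ρ s ((2 * Real.pi) • k) i j) +
        ∑ l, stiffnessSymbol C j l k • h k * greenSymbol C ρ s ((2 * Real.pi) • k) i l =
        (if i = j then 1 else 0) * h k := by
      intro k
      have h2 := hD ((2 * Real.pi) • k) j i
      simp only [greenSymbol_symm _ _ _ _ i] at h2
      rw [show (if i = j then (1 : ℂ) else 0) = if j = i then 1 else 0 by simp only [eq_comm], ← h2,
        add_mul, Finset.sum_mul]
      refine congrArg₂ _ (by ring) (Finset.sum_congr rfl fun l _ => ?_)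
      simp only [stiffnessSymbol, smul_eq_mul]
      ring
    simp only [e]
    split_ifs <;> simp

end FundamentalSolution

/-! ### Polar coordinates in dimensions one, two and three -/

section Polar

/-- The integral of a function of the cosine of the polar angle over the unit sphere of `ℝᵈ`,
`d = 1, 2, 3`. -/
def axialIntegral (d : ℕ) (f : ℝ → ℝ) : ℝ :=
  match d with
  | 1 => f 1 + f (-1)
  | 2 => 2 * ∫ θ in (0 : ℝ)..Real.pi, f (Real.cos θ)
  | 3 => 2 * Real.pi * ∫ θ in (0 : ℝ)..Real.pi, Real.sin θ * f (Real.cos θ)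
  | _ => 0

theorem integral_eq_of_polar {f : ℝ × ℝ → ℂ} {G : ℝ × ℝ → ℂ} (hG : Continuous G) {R a b : ℝ}
    (hR : 0 ≤ R) (hab : a ≤ b) (ha : -Real.pi ≤ a) (hb : b ≤ Real.pi)
    (hf : ∀ p ∈ polarCoord.target, p.1 • f (polarCoord.symm p) =
      (Set.Ioo 0 R ×ˢ Set.Ioo a b).indicator G p) :
    ∫ p, f p = ∫ k in (0 : ℝ)..R, ∫ θ in a..b, G (k, θ) := by
  have hS : MeasurableSet (Set.Ioo (0 : ℝ) R ×ˢ Set.Ioo a b) :=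
    measurableSet_Ioo.prod measurableSet_Ioo
  have hsub : Set.Ioo (0 : ℝ) R ×ˢ Set.Ioo a b ⊆ polarCoord.target := by
    rintro ⟨k, θ⟩ ⟨hk, hθ⟩
    exact ⟨hk.1, ha.trans_lt hθ.1, hθ.2.trans_le hb⟩
  rw [← integral_comp_polarCoord_symm,
    setIntegral_congr_fun polarCoord.open_target.measurableSet hf,
    setIntegral_indicator hS, Set.inter_eq_right.2 hsub, Measure.volume_eq_prod,
    setIntegral_prod, intervalIntegral.integral_of_le hR, integral_Ioc_eq_integral_Ioo]
  · refine setIntegral_congr_fun measurableSet_Ioo fun k _ => ?_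
    rw [intervalIntegral.integral_of_le hab, integral_Ioc_eq_integral_Ioo]
  · rw [← Measure.volume_eq_prod]
    exact (hG.continuousOn.integrableOn_compact (isCompact_Icc.prod isCompact_Icc)).mono_set
      (Set.prod_mono Set.Ioo_subset_Icc_self Set.Ioo_subset_Icc_self)

/-- The Euclidean norm of a pair. -/
abbrev pairNorm (x y : ℝ) : ℝ := Real.sqrt (x ^ 2 + y ^ 2)

theorem pairNorm_polar {k : ℝ} (hk : 0 < k) (θ : ℝ) :
    pairNorm (k * Real.cos θ) (k * Real.sin θ) = k := by
  have : (k * Real.cos θ) ^ 2 + (k * Real.sin θ) ^ 2 = k ^ 2 := by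
    linear_combination k ^ 2 * Real.sin_sq_add_cos_sq θ
  rw [pairNorm, this, Real.sqrt_sq hk.le]

theorem abs_div_pairNorm_le (x y : ℝ) : |x / pairNorm x y| ≤ 1 := by
  rw [abs_div, abs_of_nonneg (Real.sqrt_nonneg _)]
  refine div_le_one_of_le₀ ?_ (Real.sqrt_nonneg _)
  rw [← Real.sqrt_sq_eq_abs]
  exact Real.sqrt_le_sqrt (by nlinarith)

/-- A function of the norm and of the polar angle, cut off at radius `R`, in the plane. -/
def planeCutoff (H : ℝ × ℝ → ℂ) (R x y : ℝ) : ℂ :=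
  if pairNorm x y < R then H (pairNorm x y, x / pairNorm x y) else 0

theorem exists_norm_planeCutoff_le {H : ℝ × ℝ → ℂ} (hH : Continuous H) (R : ℝ) :
    ∃ B, ∀ x y, ‖planeCutoff H R x y‖ ≤ B := by
  obtain ⟨B, hB⟩ := (isCompact_Icc.prod isCompact_Icc :
    IsCompact (Set.Icc (0 : ℝ) R ×ˢ Set.Icc (-1 : ℝ) 1)).exists_bound_of_continuousOn
      hH.continuousOn
  refine ⟨max B 0, fun x y => ?_⟩
  rw [planeCutoff]
  split_ifs with h
  · exact (hB _ ⟨⟨Real.sqrt_nonneg _, h.le⟩, abs_le.1 (abs_div_pairNorm_le x y)⟩).trans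
      (le_max_left _ _)
  · simp

theorem measurable_planeCutoff {H : ℝ × ℝ → ℂ} (hH : Continuous H) (R : ℝ) :
    Measurable fun p : ℝ × ℝ => planeCutoff H R p.1 p.2 := by
  unfold planeCutoff
  have hn : Measurable fun p : ℝ × ℝ => pairNorm p.1 p.2 := by
    unfold pairNorm; fun_prop
  refine Measurable.ite (measurableSet_lt hn measurable_const) ?_ measurable_const
  exact hH.measurable.comp (hn.prodMk (measurable_fst.div hn))

theorem integral_planeCutoff {H : ℝ × ℝ → ℂ} (hH : Continuous H) {R : ℝ} (hR : 0 ≤ R) :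
    ∫ p : ℝ × ℝ, planeCutoff H R p.1 p.2 =
      ∫ k in (0 : ℝ)..R, (k : ℂ) * (2 * ∫ θ in (0 : ℝ)..Real.pi, H (k, Real.cos θ)) := by
  rw [integral_eq_of_polar (G := fun p => (p.1 : ℂ) * H (p.1, Real.cos p.2)) (by fun_prop) hR
    (by linarith [Real.pi_pos] : -Real.pi ≤ Real.pi) le_rfl le_rfl]
  · congr 1
    ext k
    simp only
    rw [intervalIntegral.integral_const_mul]
    congr 1
    have hc : Continuous fun θ : ℝ => H (k, Real.cos θ) := by fun_prop
    rw [← intervalIntegral.integral_add_adjacent_intervals (hc.intervalIntegrable _ 0)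
      (hc.intervalIntegrable 0 _), two_mul]
    congr 1
    have := intervalIntegral.integral_comp_neg (a := 0) (b := Real.pi)
      (fun θ : ℝ => H (k, Real.cos θ))
    simp only [Real.cos_neg, neg_zero] at this
    exact this.symm
  · rintro ⟨k, θ⟩ ⟨hk, hθ⟩
    simp only [polarCoord_symm_apply, planeCutoff, pairNorm_polar hk]
    rw [mul_div_cancel_left₀ _ (ne_of_gt hk)]
    by_cases h : k < R
    · rw [if_pos h, Set.indicator_of_mem (show (k, θ) ∈ Set.Ioo 0 R ×ˢ Set.Ioo (-Real.pi) Real.pi from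
        ⟨⟨hk, h⟩, hθ⟩), Complex.real_smul]
    · rw [if_neg h, Set.indicator_of_notMem (fun hm => h hm.1.2), smul_zero]

/-- The half plane is a meridian section of space, and the factor `p.2` is the distance from the
axis that remains after integrating around it. The angle therefore runs over `[0, π]` only. -/
theorem integral_halfPlaneCutoff {H : ℝ × ℝ → ℂ} (hH : Continuous H) {R : ℝ} (hR : 0 ≤ R) :
    ∫ p : ℝ × ℝ, (if 0 < p.2 then (p.2 : ℂ) * planeCutoff H R p.1 p.2 else 0) =
      ∫ k in (0 : ℝ)..R, (k : ℂ) ^ 2 *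
        ∫ θ in (0 : ℝ)..Real.pi, (Real.sin θ : ℂ) * H (k, Real.cos θ) := by
  rw [integral_eq_of_polar
    (G := fun p => (p.1 : ℂ) ^ 2 * ((Real.sin p.2 : ℂ) * H (p.1, Real.cos p.2))) (by fun_prop) hR
    Real.pi_pos.le (by linarith [Real.pi_pos]) le_rfl]
  · simp only [intervalIntegral.integral_const_mul]
  · rintro ⟨k, θ⟩ ⟨hk, hθ⟩
    simp only [polarCoord_symm_apply, planeCutoff, pairNorm_polar hk]
    rw [mul_div_cancel_left₀ _ (ne_of_gt hk)]
    by_cases h : k < R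
    · by_cases h0 : 0 < θ
      · have : 0 < k * Real.sin θ := mul_pos hk (Real.sin_pos_of_pos_of_lt_pi h0 hθ.2)
        rw [if_pos h, if_pos this, Set.indicator_of_mem
          (show (k, θ) ∈ Set.Ioo 0 R ×ˢ Set.Ioo 0 Real.pi from ⟨⟨hk, h⟩, h0, hθ.2⟩), Complex.real_smul]
        push_cast
        ring
      · have : ¬ 0 < k * Real.sin θ := not_lt.2 (mul_nonpos_of_nonneg_of_nonpos (le_of_lt hk)
          (Real.sin_nonpos_of_nonpos_of_neg_pi_le (not_lt.1 h0) hθ.1.le))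
        rw [if_neg this, Set.indicator_of_notMem (fun hm => h0 hm.2.1), smul_zero]
    · rw [if_neg h, Set.indicator_of_notMem (fun hm => h hm.1.2)]
      simp

theorem integral_planeRadial (Φ : ℝ → ℂ) :
    ∫ p : ℝ × ℝ, Φ (pairNorm p.1 p.2) = 2 * Real.pi * ∫ k in Set.Ioi (0 : ℝ), (k : ℂ) * Φ k := by
  rw [← integral_comp_polarCoord_symm]
  have : ∀ p ∈ polarCoord.target, p.1 • Φ (pairNorm (polarCoord.symm p).1 (polarCoord.symm p).2) =
      (p.1 : ℂ) * Φ p.1 * 1 := by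
    rintro ⟨k, θ⟩ ⟨hk, hθ⟩
    simp only [polarCoord_symm_apply, pairNorm_polar hk, Complex.real_smul, mul_one]
  rw [setIntegral_congr_fun polarCoord.open_target.measurableSet this, polarCoord_target,
    Measure.volume_eq_prod, setIntegral_prod_mul (fun k : ℝ => (k : ℂ) * Φ k) (fun _ => (1 : ℂ)),
    setIntegral_const, mul_comm, Measure.real, Real.volume_Ioo, ENNReal.toReal_ofReal
    (by linarith [Real.pi_pos])]
  congr 1
  simp
  ring

theorem integrable_of_bounded_cutoff {X : Type*} [NormedAddCommGroup X] [MeasureSpace X]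
    [OpensMeasurableSpace X] [ProperSpace X] [IsFiniteMeasureOnCompacts (volume : Measure X)]
    {f : X → ℂ} {B R : ℝ} (hm : Measurable f) (hB : ∀ x, ‖f x‖ ≤ B)
    (h0 : ∀ x, R < ‖x‖ → f x = 0) : Integrable f := by
  have : f = (Metric.closedBall (0 : X) R).indicator f := by
    ext x
    by_cases hx : x ∈ Metric.closedBall (0 : X) R
    · rw [Set.indicator_of_mem hx]
    · rw [Set.indicator_of_notMem hx, h0]
      simpa using hx
  rw [this, integrable_indicator_iff Metric.isClosed_closedBall.measurableSet]
  exact Measure.integrableOn_of_bounded (isCompact_closedBall _ _).measure_lt_top.ne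
    hm.aestronglyMeasurable (ae_of_all _ hB)

/-- The coordinates of a point of the plane, as a pair. -/
theorem integral_space_two (f : ℝ × ℝ → ℂ) :
    ∫ κ : Space 2, f (κ 0, κ 1) = ∫ p, f p := by
  have h1 := (volume_preserving_finTwoArrow ℝ).comp (PiLp.volume_preserving_ofLp (Fin 2))
  have h2 : MeasurableEmbedding ((MeasurableEquiv.finTwoArrow (α := ℝ)) ∘
      (WithLp.ofLp : Space 2 → Fin 2 → ℝ)) :=
    (MeasurableEquiv.measurableEmbedding _).comp
      (MeasurableEquiv.toLp 2 (Fin 2 → ℝ)).symm.measurableEmbedding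
  rw [← h1.integral_comp h2]
  rfl

theorem integral_space_three (f : ℝ × ℝ × ℝ → ℂ) :
    ∫ κ : Space 3, f (κ 0, κ 1, κ 2) = ∫ p, f p := by
  have h1 := (((MeasurePreserving.id (volume : Measure ℝ)).prod
    (volume_preserving_finTwoArrow ℝ)).comp
      (volume_preserving_piFinSuccAbove (fun _ : Fin 3 => ℝ) 0)).comp
      (PiLp.volume_preserving_ofLp (Fin 3))
  have h2 : MeasurableEmbedding ((Prod.map id (MeasurableEquiv.finTwoArrow (α := ℝ))) ∘
      (MeasurableEquiv.piFinSuccAbove (fun _ : Fin 3 => ℝ) 0) ∘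
      (WithLp.ofLp : Space 3 → Fin 3 → ℝ)) :=
    ((MeasurableEquiv.prodCongr (MeasurableEquiv.refl ℝ)
      (MeasurableEquiv.finTwoArrow (α := ℝ))).measurableEmbedding).comp
      ((MeasurableEquiv.measurableEmbedding _).comp
      (MeasurableEquiv.toLp 2 (Fin 3 → ℝ)).symm.measurableEmbedding)
  exact h1.integral_comp h2 f

theorem integral_space_one (f : ℝ → ℂ) : ∫ κ : Space 1, f (κ 0) = ∫ p, f p := by
  have h1 := (volume_preserving_funUnique (Fin 1) ℝ).comp (PiLp.volume_preserving_ofLp (Fin 1))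
  have h2 : MeasurableEmbedding ((MeasurableEquiv.funUnique (Fin 1) ℝ) ∘
      (WithLp.ofLp : Space 1 → Fin 1 → ℝ)) :=
    (MeasurableEquiv.measurableEmbedding _).comp
      (MeasurableEquiv.toLp 2 (Fin 1 → ℝ)).symm.measurableEmbedding
  rw [← h1.integral_comp h2]
  rfl

theorem setIntegral_ball_eq {R : ℝ} (H : ℝ × ℝ → ℂ) [NeZero d] :
    ∫ κ in Metric.ball (0 : Space d) R, H (‖κ‖, κ 0 / ‖κ‖) =
      ∫ κ : Space d, if ‖κ‖ < R then H (‖κ‖, κ 0 / ‖κ‖) else 0 := by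
  rw [← integral_indicator Metric.isOpen_ball.measurableSet]
  refine integral_congr_ae (ae_of_all _ fun κ => ?_)
  by_cases h : ‖κ‖ < R
  · simp only [if_pos h]
    exact Set.indicator_of_mem (mem_ball_zero_iff.2 h) _
  · simp only [if_neg h]
    exact Set.indicator_of_notMem (fun hm => h (mem_ball_zero_iff.1 hm)) _

theorem polar_one {H : ℝ × ℝ → ℂ} (hH : Continuous H) {R : ℝ} (hR : 0 ≤ R) :
    ∫ κ in Metric.ball (0 : Space 1) R, H (‖κ‖, κ 0 / ‖κ‖) =
      ∫ k in (0 : ℝ)..R, (H (k, 1) + H (k, -1)) := by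
  have hn : ∀ κ : Space 1, ‖κ‖ = |κ 0| := fun κ => by
    rw [EuclideanSpace.norm_eq]; simp [Real.sqrt_sq_eq_abs]
  rw [setIntegral_ball_eq]
  simp only [hn]
  rw [integral_space_one fun x => if |x| < R then H (|x|, x / |x|) else 0]
  have e1 : ∀ x : ℝ, (if |x| < R then H (|x|, x / |x|) else 0) =
      (Set.Ioo (-R) R).indicator (fun x => H (|x|, x / |x|)) x := fun x => by
    simp [Set.indicator_apply, abs_lt]
  simp only [e1]
  rw [integral_indicator measurableSet_Ioo, ← integral_Ioc_eq_integral_Ioo,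
    ← intervalIntegral.integral_of_le (by linarith)]
  have hc1 : Continuous fun k : ℝ => H (k, 1) := by fun_prop
  have hc2 : Continuous fun k : ℝ => H (k, -1) := by fun_prop
  have hc3 : Continuous fun k : ℝ => H (-k, -1) := by fun_prop
  have p1 : Set.EqOn (fun x : ℝ => H (x, 1)) (fun x => H (|x|, x / |x|)) (Set.Ioo 0 R) :=
    fun x hx => by simp [abs_of_pos hx.1, div_self hx.1.ne']
  have p2 : Set.EqOn (fun x : ℝ => H (-x, -1)) (fun x => H (|x|, x / |x|)) (Set.Ioo (-R) 0) :=
    fun x hx => by simp [abs_of_neg hx.2, div_neg, div_self hx.2.ne]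
  have q1 : ∫ x in (0 : ℝ)..R, H (|x|, x / |x|) = ∫ x in (0 : ℝ)..R, H (x, 1) := by
    rw [intervalIntegral.integral_of_le hR, intervalIntegral.integral_of_le hR,
      integral_Ioc_eq_integral_Ioo, integral_Ioc_eq_integral_Ioo]
    exact (setIntegral_congr_fun measurableSet_Ioo p1).symm
  have q2 : ∫ x in (-R)..0, H (|x|, x / |x|) = ∫ x in (0 : ℝ)..R, H (x, -1) := by
    have h := intervalIntegral.integral_comp_neg (a := -R) (b := 0) fun x : ℝ => H (x, -1)
    rw [neg_neg, neg_zero] at h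
    rw [← h, intervalIntegral.integral_of_le (by linarith),
      intervalIntegral.integral_of_le (by linarith),
      integral_Ioc_eq_integral_Ioo, integral_Ioc_eq_integral_Ioo]
    exact (setIntegral_congr_fun measurableSet_Ioo p2).symm
  have i1 : IntervalIntegrable (fun x => H (|x|, x / |x|)) volume 0 R := by
    refine (hc1.intervalIntegrable 0 R).congr_uIoo ?_
    rwa [Set.uIoo_of_le hR]
  have i2 : IntervalIntegrable (fun x => H (|x|, x / |x|)) volume (-R) 0 := by
    refine (hc3.intervalIntegrable (-R) 0).congr_uIoo ?_
    rwa [Set.uIoo_of_le (by linarith)]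
  rw [← intervalIntegral.integral_add_adjacent_intervals i2 i1, q1, q2,
    intervalIntegral.integral_add (hc1.intervalIntegrable _ _) (hc2.intervalIntegrable _ _),
    add_comm]

theorem polar_two {H : ℝ × ℝ → ℂ} (hH : Continuous H) {R : ℝ} (hR : 0 ≤ R) :
    ∫ κ in Metric.ball (0 : Space 2) R, H (‖κ‖, κ 0 / ‖κ‖) =
      ∫ k in (0 : ℝ)..R, (k : ℂ) * (2 * ∫ θ in (0 : ℝ)..Real.pi, H (k, Real.cos θ)) := by
  have hn : ∀ κ : Space 2, ‖κ‖ = pairNorm (κ 0) (κ 1) := fun κ => by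
    rw [EuclideanSpace.norm_eq]; simp [pairNorm]
  rw [setIntegral_ball_eq, ← integral_planeCutoff hH hR,
    ← integral_space_two fun p => planeCutoff H R p.1 p.2]
  simp only [hn, planeCutoff]

/-- Cylindrical coordinates about the zeroth axis come first: the plane of the other two coordinates
contributes a circle. Polar coordinates in the meridian half plane then give the spherical formula.
-/
theorem polar_three {H : ℝ × ℝ → ℂ} (hH : Continuous H) {R : ℝ} (hR : 0 ≤ R) :
    ∫ κ in Metric.ball (0 : Space 3) R, H (‖κ‖, κ 0 / ‖κ‖) =
      ∫ k in (0 : ℝ)..R, (k : ℂ) ^ 2 *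
        (2 * Real.pi * ∫ θ in (0 : ℝ)..Real.pi, (Real.sin θ : ℂ) * H (k, Real.cos θ)) := by
  have hn : ∀ κ : Space 3, ‖κ‖ = pairNorm (κ 0) (pairNorm (κ 1) (κ 2)) := fun κ => by
    rw [EuclideanSpace.norm_eq, pairNorm, pairNorm, Real.sq_sqrt (by positivity)]
    simp [Fin.sum_univ_three, add_assoc]
  obtain ⟨B, hB⟩ := exists_norm_planeCutoff_le hH R
  have hB0 : 0 ≤ B := (norm_nonneg _).trans (hB 0 0)
  have hlarge : ∀ x y, planeCutoff H R x y ≠ 0 → |x| ≤ R ∧ |y| ≤ R := by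
    intro x y h
    have h1 : pairNorm x y < R := by
      by_contra h2
      exact h (by rw [planeCutoff, if_neg h2])
    constructor <;> refine le_trans ?_ h1.le <;> rw [← Real.sqrt_sq_eq_abs] <;>
      exact Real.sqrt_le_sqrt (by nlinarith)
  have hm := measurable_planeCutoff hH R
  have hpn : Measurable fun p : ℝ × ℝ => pairNorm p.1 p.2 := by
    unfold pairNorm; fun_prop
  have hle : ∀ x y, |x| ≤ pairNorm x y ∧ |y| ≤ pairNorm x y := fun x y => by
    constructor <;> rw [← Real.sqrt_sq_eq_abs] <;> exact Real.sqrt_le_sqrt (by nlinarith)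
  have hi1 : Integrable fun p : ℝ × ℝ × ℝ => planeCutoff H R p.1 (pairNorm p.2.1 p.2.2) := by
    refine integrable_of_bounded_cutoff (B := B) (R := R)
      (hm.comp (measurable_fst.prodMk (hpn.comp measurable_snd))) (fun p => hB _ _) fun p hp => ?_
    by_contra h
    obtain ⟨h1, h2⟩ := hlarge _ _ h
    rw [abs_of_nonneg (Real.sqrt_nonneg _)] at h2
    refine absurd hp (not_lt.2 ?_)
    rw [Prod.norm_def, Prod.norm_def]
    exact max_le h1 (max_le ((hle _ _).1.trans h2) ((hle _ _).2.trans h2))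
  have hi2 : Integrable fun p : ℝ × ℝ =>
      if 0 < p.2 then (p.2 : ℂ) * planeCutoff H R p.1 p.2 else 0 := by
    refine integrable_of_bounded_cutoff (B := R * B) (R := R) ?_ (fun p => ?_) fun p hp => ?_
    · exact Measurable.ite (measurableSet_lt measurable_const measurable_snd)
        ((Complex.measurable_ofReal.comp measurable_snd).mul hm) measurable_const
    · split_ifs with h
      · by_cases h0 : planeCutoff H R p.1 p.2 = 0
        · rw [h0, mul_zero, norm_zero]; positivity
        · rw [norm_mul, Complex.norm_real]
          exact mul_le_mul (hlarge _ _ h0).2 (hB _ _) (norm_nonneg _) hR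
      · rw [norm_zero]; positivity
    · split_ifs with h
      · by_contra h0
        obtain ⟨h1, h2⟩ := hlarge _ _ (right_ne_zero_of_mul h0)
        refine absurd hp (not_lt.2 ?_)
        rw [Prod.norm_def]
        exact max_le h1 h2
      · rfl
  rw [setIntegral_ball_eq]
  simp only [hn]
  have e1 := integral_space_three fun p => planeCutoff H R p.1 (pairNorm p.2.1 p.2.2)
  simp only [planeCutoff] at e1
  rw [e1]
  have e2 : ∀ x : ℝ, (∫ q : ℝ × ℝ, planeCutoff H R x (pairNorm q.1 q.2)) =
      2 * Real.pi * ∫ y : ℝ, if 0 < y then (y : ℂ) * planeCutoff H R x y else 0 := by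
    intro x
    rw [integral_planeRadial fun y => planeCutoff H R x y, ← integral_indicator measurableSet_Ioi]
    rfl
  have e3 := integral_prod _ hi1
  have e4 := integral_prod _ hi2
  rw [← Measure.volume_eq_prod] at e3 e4
  simp only [e2, integral_const_mul] at e3
  simp only [planeCutoff] at e3 e4
  have e5 := integral_halfPlaneCutoff hH hR
  simp only [planeCutoff] at e5
  rw [e3, ← e4, e5, ← intervalIntegral.integral_const_mul]
  congr 1
  ext k
  ring

/-- Puts the sphere integral into the form in which `polar_one`, `polar_two` and `polar_three`
produce it. -/
theorem ofReal_axialIntegral_mul (hd : d = 1 ∨ d = 2 ∨ d = 3) (f : ℝ → ℝ) (c : ℂ) :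
    (axialIntegral d f : ℂ) * c = match d with
      | 1 => (f 1 : ℂ) * c + (f (-1) : ℂ) * c
      | 2 => 2 * ∫ θ in (0 : ℝ)..Real.pi, (f (Real.cos θ) : ℂ) * c
      | 3 => 2 * Real.pi * ∫ θ in (0 : ℝ)..Real.pi, (Real.sin θ : ℂ) * ((f (Real.cos θ) : ℂ) * c)
      | _ => 0 := by
  rcases hd with rfl | rfl | rfl
  · simp only [axialIntegral]
    push_cast
    ring
  · simp only [axialIntegral, intervalIntegral.integral_mul_const, intervalIntegral.integral_ofReal]
    push_cast
    ring
  · simp only [axialIntegral, ← mul_assoc, intervalIntegral.integral_mul_const,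
      ← Complex.ofReal_mul, intervalIntegral.integral_ofReal]
    push_cast
    ring

/-- Integration over a ball of a function of the norm and of the polar angle. -/
theorem setIntegral_ball_polar [NeZero d] (hd : d = 1 ∨ d = 2 ∨ d = 3) {h : ℝ × ℝ → ℝ}
    (hh : Continuous h) {g : ℝ → ℂ} (hg : Continuous g) {R : ℝ} (hR : 0 ≤ R) :
    ∫ κ in Metric.ball (0 : Space d) R, (h (‖κ‖, κ 0 / ‖κ‖) : ℂ) * g ‖κ‖ =
      ∫ k in (0 : ℝ)..R, (k : ℂ) ^ (d - 1) * ((axialIntegral d fun t => h (k, t)) * g k) := by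
  have hH : Continuous fun p : ℝ × ℝ => (h p : ℂ) * g p.1 := by fun_prop
  simp only [ofReal_axialIntegral_mul hd]
  rcases hd with rfl | rfl | rfl
  · rw [polar_one (H := fun p => (h p : ℂ) * g p.1) hH hR]
    simp
  · rw [polar_two (H := fun p => (h p : ℂ) * g p.1) hH hR]
    simp
  · rw [polar_three (H := fun p => (h p : ℂ) * g p.1) hH hR]
    simp

end Polar

/-! ### The spherical kernels `J` and `L` and their closed forms -/

section Kernels

/-- The integral `∫ cos (z cos θ) sin ^ n θ dθ` over `[0, π]`. -/
def cosSinIntegral (n : ℕ) (z : ℝ) : ℝ :=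
  ∫ θ in (0 : ℝ)..Real.pi, Real.cos (z * Real.cos θ) * Real.sin θ ^ n

theorem hasDerivAt_cosSinIntegral (n : ℕ) (z : ℝ) : HasDerivAt (cosSinIntegral n)
    (-∫ θ in (0 : ℝ)..Real.pi, Real.sin (z * Real.cos θ) * Real.cos θ * Real.sin θ ^ n) z := by
  have h := intervalIntegral.hasDerivAt_integral_of_dominated_loc_of_deriv_le
    (F := fun z θ => Real.cos (z * Real.cos θ) * Real.sin θ ^ n)
    (F' := fun z θ => -(Real.sin (z * Real.cos θ) * Real.cos θ * Real.sin θ ^ n))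
    (μ := volume) (a := 0) (b := Real.pi) (x₀ := z) (s := Set.univ) (bound := fun _ => 1)
    Filter.univ_mem
    (Filter.Eventually.of_forall fun z => (by fun_prop : Continuous _).aestronglyMeasurable)
    ((by fun_prop : Continuous _).intervalIntegrable _ _)
    (by fun_prop : Continuous _).aestronglyMeasurable
    (ae_of_all _ fun θ _ x _ => by
      rw [norm_neg, norm_mul, norm_mul, norm_pow]
      simp only [Real.norm_eq_abs]
      exact mul_le_one₀ (mul_le_one₀ (Real.abs_sin_le_one _) (abs_nonneg _)
        (Real.abs_cos_le_one _)) (by positivity)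
        (pow_le_one₀ (abs_nonneg _) (Real.abs_sin_le_one _)))
    (intervalIntegrable_const)
    (ae_of_all _ fun θ _ x _ => by
      have h1 : HasDerivAt (fun x => x * Real.cos θ) (Real.cos θ) x := by
        simpa using (hasDerivAt_id x).mul_const (Real.cos θ)
      exact ((h1.cos).mul_const (Real.sin θ ^ n)).congr_deriv (by ring))
  rw [← intervalIntegral.integral_neg]
  exact h.2

/-- The derivative of `cos (z cos θ) cos θ sin^(n+1) θ` integrates to zero over `[0, π]`, because
the positive power of the sine vanishes at both ends. -/
theorem cosSinIntegral_recurrence (n : ℕ) (z : ℝ) :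
    z * (∫ θ in (0 : ℝ)..Real.pi, Real.sin (z * Real.cos θ) * Real.cos θ * Real.sin θ ^ (n + 2)) =
      (n + 2) * cosSinIntegral (n + 2) z - (n + 1) * cosSinIntegral n z := by
  have hd : ∀ θ : ℝ, HasDerivAt
      (fun θ => Real.cos (z * Real.cos θ) * Real.cos θ * Real.sin θ ^ (n + 1))
      (z * (Real.sin (z * Real.cos θ) * Real.cos θ * Real.sin θ ^ (n + 2)) -
        ((n + 2) * (Real.cos (z * Real.cos θ) * Real.sin θ ^ (n + 2)) -
          (n + 1) * (Real.cos (z * Real.cos θ) * Real.sin θ ^ n))) θ := by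
    intro θ
    have h1 := ((Real.hasDerivAt_cos θ).const_mul z).cos
    have h2 := (Real.hasDerivAt_sin θ).pow (n + 1)
    refine ((h1.mul (Real.hasDerivAt_cos θ)).mul h2).congr_deriv ?_
    have hs := Real.sin_sq_add_cos_sq θ
    simp only [Nat.add_sub_cancel, Pi.mul_apply, Pi.pow_apply]
    push_cast
    linear_combination (n + 1) * Real.cos (z * Real.cos θ) * Real.sin θ ^ n * hs
  have hFTC := intervalIntegral.integral_eq_sub_of_hasDerivAt (a := 0) (b := Real.pi)
    (fun θ _ => hd θ) ((by fun_prop : Continuous _).intervalIntegrable _ _)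
  rw [Real.sin_pi, Real.sin_zero, zero_pow (Nat.succ_ne_zero n), mul_zero, mul_zero, sub_zero,
    intervalIntegral.integral_sub ((by fun_prop : Continuous _).intervalIntegrable _ _)
      ((by fun_prop : Continuous _).intervalIntegrable _ _),
    intervalIntegral.integral_sub ((by fun_prop : Continuous _).intervalIntegrable _ _)
      ((by fun_prop : Continuous _).intervalIntegrable _ _),
    intervalIntegral.integral_const_mul, intervalIntegral.integral_const_mul,
    intervalIntegral.integral_const_mul] at hFTC
  simp only [cosSinIntegral]
  linarith

theorem continuous_cosSinIntegral (n : ℕ) : Continuous (cosSinIntegral n) :=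
  continuous_iff_continuousAt.2 fun z => (hasDerivAt_cosSinIntegral n z).continuousAt

/-- By the recurrence, `q^(n+2) I_{n+2}(qz)` has derivative `(n+1) q^(n+1) I_n(qz)`, with `I_n` for
`cosSinIntegral n`. This turns the radial average in `sphericalL` into an explicit kernel. -/
theorem integral_pow_mul_cosSinIntegral (n : ℕ) (z : ℝ) :
    (n + 1) * ∫ q in (0 : ℝ)..1, q ^ (n + 1) * cosSinIntegral n (q * z) =
      cosSinIntegral (n + 2) z := by
  have hd : ∀ q : ℝ, HasDerivAt (fun q => q ^ (n + 2) * cosSinIntegral (n + 2) (q * z))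
      ((n + 1) * (q ^ (n + 1) * cosSinIntegral n (q * z))) q := by
    intro q
    have h1 : HasDerivAt (fun q => q * z) z q := by
      simpa using (hasDerivAt_id q).mul_const z
    have h2 := (hasDerivAt_cosSinIntegral (n + 2) (q * z)).comp q h1
    refine ((hasDerivAt_pow (n + 2) q).mul h2).congr_deriv ?_
    have h3 := cosSinIntegral_recurrence n (q * z)
    rw [show (cosSinIntegral (n + 2) ∘ fun q => q * z) q = cosSinIntegral (n + 2) (q * z) from rfl]
    push_cast
    linear_combination -q ^ (n + 1) * h3
  have hc := continuous_cosSinIntegral n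
  have hFTC := intervalIntegral.integral_eq_sub_of_hasDerivAt (a := 0) (b := 1)
    (fun q _ => hd q) ((by fun_prop : Continuous _).intervalIntegrable _ _)
  rw [intervalIntegral.integral_const_mul] at hFTC
  simpa using hFTC

/-- The spherical mean kernel `∫ cos (z ω₀) dω` over the unit sphere. -/
def sphericalJ (d : ℕ) (z : ℝ) : ℝ := axialIntegral d fun t => Real.cos (z * t)

/-- The kernel `∫ cos (z ω₀) ω₁² dω` over the unit sphere (for `d ≥ 2`), written as the Fourier
transform of a ball. -/
def sphericalL (d : ℕ) (z : ℝ) : ℝ := ∫ q in (0 : ℝ)..1, q ^ (d - 1) * sphericalJ d (q * z)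

theorem sphericalJ_one (z : ℝ) : sphericalJ 1 z = 2 * Real.cos z := by
  simp [sphericalJ, axialIntegral]
  ring

theorem sphericalJ_two (z : ℝ) : sphericalJ 2 z = 2 * cosSinIntegral 0 z := by
  simp [sphericalJ, axialIntegral, cosSinIntegral]

theorem sphericalJ_three (z : ℝ) : sphericalJ 3 z = 2 * Real.pi * cosSinIntegral 1 z := by
  simp [sphericalJ, axialIntegral, cosSinIntegral, mul_comm]

theorem sphericalL_two (z : ℝ) : sphericalL 2 z = 2 * cosSinIntegral 2 z := by
  have h := integral_pow_mul_cosSinIntegral 0 z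
  simp only [sphericalL, sphericalJ_two, ← h]
  rw [← intervalIntegral.integral_const_mul, ← intervalIntegral.integral_const_mul]
  congr 1
  ext q
  push_cast
  ring

theorem sphericalL_three (z : ℝ) : sphericalL 3 z = Real.pi * cosSinIntegral 3 z := by
  have h := integral_pow_mul_cosSinIntegral 1 z
  simp only [sphericalL, sphericalJ_three, ← h]
  rw [← intervalIntegral.integral_const_mul, ← intervalIntegral.integral_const_mul]
  congr 1
  ext q
  push_cast
  ring

theorem continuous_sphericalJ (hd : d = 1 ∨ d = 2 ∨ d = 3) : Continuous (sphericalJ d) := by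
  rcases hd with rfl | rfl | rfl
  · simp only [funext sphericalJ_one]; fun_prop
  · simp only [funext sphericalJ_two]; exact (continuous_cosSinIntegral 0).const_mul 2
  · simp only [funext sphericalJ_three]; exact (continuous_cosSinIntegral 1).const_mul _

theorem abs_cosSinIntegral_le (n : ℕ) (z : ℝ) : |cosSinIntegral n z| ≤ Real.pi := by
  rw [cosSinIntegral, ← Real.norm_eq_abs]
  refine (intervalIntegral.norm_integral_le_of_norm_le_const (C := 1) fun θ _ => ?_).trans ?_
  · rw [norm_mul, norm_pow]
    exact mul_le_one₀ (Real.abs_cos_le_one _) (by positivity)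
      (pow_le_one₀ (norm_nonneg _) (Real.abs_sin_le_one _))
  · rw [sub_zero, abs_of_pos Real.pi_pos, one_mul]

theorem exists_abs_sphericalJ_le (hd : d = 1 ∨ d = 2 ∨ d = 3) :
    ∃ B, ∀ z, |sphericalJ d z| ≤ B := by
  rcases hd with rfl | rfl | rfl
  · exact ⟨2, fun z => by
      rw [sphericalJ_one, abs_mul, abs_two]; linarith [Real.abs_cos_le_one z]⟩
  · exact ⟨2 * Real.pi, fun z => by
      rw [sphericalJ_two, abs_mul, abs_two]; linarith [abs_cosSinIntegral_le 0 z]⟩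
  · exact ⟨2 * Real.pi * Real.pi, fun z => by
      rw [sphericalJ_three, abs_mul, abs_of_pos Real.two_pi_pos]
      exact mul_le_mul_of_nonneg_left (abs_cosSinIntegral_le 1 z) Real.two_pi_pos.le⟩

theorem exists_abs_sphericalL_le (hd : d = 1 ∨ d = 2 ∨ d = 3) :
    ∃ B, ∀ z, |sphericalL d z| ≤ B := by
  obtain ⟨B, hB⟩ := exists_abs_sphericalJ_le hd
  refine ⟨B, fun z => ?_⟩
  rw [sphericalL, ← Real.norm_eq_abs]
  refine (intervalIntegral.norm_integral_le_of_norm_le_const (C := B) fun q hq => ?_).trans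
    (by simp)
  rw [Set.uIoc_of_le zero_le_one] at hq
  rw [norm_mul, norm_pow, Real.norm_of_nonneg hq.1.le]
  exact (mul_le_of_le_one_left (norm_nonneg _) (pow_le_one₀ hq.1.le hq.2)).trans (hB _)

theorem continuous_sphericalL (hd : d = 1 ∨ d = 2 ∨ d = 3) : Continuous (sphericalL d) := by
  have := continuous_sphericalJ hd
  unfold sphericalL
  exact intervalIntegral.continuous_parametric_intervalIntegral_of_continuous' (by fun_prop) 0 1

theorem pow_mul_sphericalL (hd : d = 1 ∨ d = 2 ∨ d = 3) (k r : ℝ) :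
    k ^ d * sphericalL d (k * r) = ∫ q in (0 : ℝ)..k, q ^ (d - 1) * sphericalJ d (q * r) := by
  have h := intervalIntegral.smul_integral_comp_mul_left (a := 0) (b := 1)
    (fun q => q ^ (d - 1) * sphericalJ d (q * r)) k
  rw [mul_zero, mul_one] at h
  have hd1 : d = d - 1 + 1 := by omega
  rw [← h, sphericalL, smul_eq_mul]
  conv_lhs => rw [hd1, pow_succ', mul_assoc, ← hd1, ← intervalIntegral.integral_const_mul]
  congr 2
  ext q
  rw [mul_pow, mul_assoc, show q * (k * r) = k * q * r by ring]

/-- The fundamental theorem of calculus after rescaling. It drives the integration by parts that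
rewrites `u_A` with the kernel `J` alone. -/
theorem hasDerivAt_pow_mul_sphericalL (hd : d = 1 ∨ d = 2 ∨ d = 3) (r k : ℝ) :
    HasDerivAt (fun k => k ^ d * sphericalL d (k * r)) (k ^ (d - 1) * sphericalJ d (k * r)) k := by
  have hJ := continuous_sphericalJ hd
  simp only [pow_mul_sphericalL hd]
  exact (by fun_prop : Continuous fun q => q ^ (d - 1) * sphericalJ d (q * r)).integral_hasStrictDerivAt
    0 k |>.hasDerivAt

/-- Writing `t² = 1 - sin² θ` splits off the transverse kernel. For `d = 1` the factor `d - 1`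
removes it, in accordance with `t² = 1` at both poles. -/
theorem axialIntegral_cos_mul_sq (hd : d = 1 ∨ d = 2 ∨ d = 3) (z : ℝ) :
    axialIntegral d (fun t => Real.cos (z * t) * t ^ 2) =
      sphericalJ d z - (d - 1) * sphericalL d z := by
  have key : ∀ n : ℕ, ∫ θ in (0 : ℝ)..Real.pi,
      Real.sin θ ^ n * (Real.cos (z * Real.cos θ) * Real.cos θ ^ 2) =
      cosSinIntegral n z - cosSinIntegral (n + 2) z := by
    intro n
    rw [cosSinIntegral, cosSinIntegral, ← intervalIntegral.integral_sub
      ((by fun_prop : Continuous _).intervalIntegrable _ _)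
      ((by fun_prop : Continuous _).intervalIntegrable _ _)]
    congr 1
    ext θ
    rw [Real.cos_sq']
    ring
  rcases hd with rfl | rfl | rfl
  · simp [sphericalJ, axialIntegral]
  · have h := key 0
    simp only [pow_zero, one_mul, zero_add] at h
    rw [sphericalJ_two, sphericalL_two, axialIntegral, h]
    push_cast
    ring
  · have h := key 1
    simp only [pow_one] at h
    rw [sphericalJ_three, sphericalL_three, axialIntegral, h]
    push_cast
    ring

/-- The integrand `cos (z sin θ)` has period `π`, so a shift by `π/2` replaces the sine by the
cosine. -/
theorem besselJ_zero_eq (z : ℝ) : besselJ 0 z = cosSinIntegral 0 z / Real.pi := by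
  have hper : Function.Periodic (fun θ => Real.cos (z * Real.sin θ)) Real.pi := fun θ => by
    simp [Real.sin_add_pi]
  have h1 := hper.intervalIntegral_add_eq (Real.pi / 2) 0
  have h2 := intervalIntegral.integral_comp_add_right (a := 0) (b := Real.pi)
    (fun θ => Real.cos (z * Real.sin θ)) (Real.pi / 2)
  simp only [Real.sin_add_pi_div_two, zero_add] at h1 h2
  rw [add_comm Real.pi, h1] at h2
  simp only [besselJ, cosSinIntegral, Nat.cast_zero, zero_mul, zero_sub, Real.cos_neg, pow_zero,
    mul_one, h2]
  ring

/-- In the expansion of `cos (θ - z sin θ)` the cosine product changes sign under `θ ↦ π - θ`. The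
sine product is shifted by `π/2` and integrated by parts. -/
theorem besselJ_one_eq (z : ℝ) : besselJ 1 z = z * cosSinIntegral 2 z / Real.pi := by
  have hodd : ∫ θ in (0 : ℝ)..Real.pi, Real.cos θ * Real.cos (z * Real.sin θ) = 0 := by
    have h := intervalIntegral.integral_comp_sub_left (a := 0) (b := Real.pi)
      (fun θ => Real.cos θ * Real.cos (z * Real.sin θ)) Real.pi
    simp only [Real.cos_pi_sub, Real.sin_pi_sub, sub_self, sub_zero, neg_mul,
      intervalIntegral.integral_neg] at h
    linarith
  have hper : Function.Periodic (fun θ => Real.sin θ * Real.sin (z * Real.sin θ)) Real.pi :=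
    fun θ => by simp [Real.sin_add_pi]
  have h1 := hper.intervalIntegral_add_eq (Real.pi / 2) 0
  have h2 := intervalIntegral.integral_comp_add_right (a := 0) (b := Real.pi)
    (fun θ => Real.sin θ * Real.sin (z * Real.sin θ)) (Real.pi / 2)
  simp only [Real.sin_add_pi_div_two, zero_add] at h1 h2
  rw [add_comm Real.pi, h1] at h2
  have hd : ∀ θ : ℝ, HasDerivAt (fun θ => Real.sin θ * Real.sin (z * Real.cos θ))
      (Real.cos θ * Real.sin (z * Real.cos θ) -
        z * (Real.cos (z * Real.cos θ) * Real.sin θ ^ 2)) θ := fun θ =>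
    ((Real.hasDerivAt_sin θ).mul ((Real.hasDerivAt_cos θ).const_mul z).sin).congr_deriv (by ring)
  have h3 := intervalIntegral.integral_eq_sub_of_hasDerivAt (a := 0) (b := Real.pi)
    (fun θ _ => hd θ) ((by fun_prop : Continuous _).intervalIntegrable _ _)
  rw [intervalIntegral.integral_sub ((by fun_prop : Continuous _).intervalIntegrable _ _)
    ((by fun_prop : Continuous _).intervalIntegrable _ _), intervalIntegral.integral_const_mul] at h3
  simp only [Real.sin_pi, Real.sin_zero, zero_mul, sub_self] at h3
  simp only [besselJ, cosSinIntegral, Nat.cast_one, one_mul, Real.cos_sub]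
  rw [intervalIntegral.integral_add ((by fun_prop : Continuous _).intervalIntegrable _ _)
    ((by fun_prop : Continuous _).intervalIntegrable _ _), hodd, zero_add, ← h2,
    sub_eq_zero.1 h3]
  ring

theorem mul_cosSinIntegral_one (z : ℝ) : z * cosSinIntegral 1 z = 2 * Real.sin z := by
  have hd : ∀ θ : ℝ, HasDerivAt (fun θ => -Real.sin (z * Real.cos θ))
      (z * (Real.cos (z * Real.cos θ) * Real.sin θ ^ 1)) θ := fun θ =>
    (((Real.hasDerivAt_cos θ).const_mul z).sin.neg).congr_deriv (by ring)
  have h3 := intervalIntegral.integral_eq_sub_of_hasDerivAt (a := 0) (b := Real.pi)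
    (fun θ _ => hd θ) ((by fun_prop : Continuous _).intervalIntegrable _ _)
  rw [intervalIntegral.integral_const_mul] at h3
  rw [cosSinIntegral, h3]
  simp
  ring

/-- In the variable `t = cos θ` the integrand is a quadratic polynomial times `cos (z t)`, which has
the elementary antiderivative used here. -/
theorem pow_mul_cosSinIntegral_three (z : ℝ) :
    z ^ 3 * cosSinIntegral 3 z = 4 * (Real.sin z - z * Real.cos z) := by
  have hd : ∀ θ : ℝ, HasDerivAt (fun θ => -(Real.sin θ ^ 2 * z ^ 2 * Real.sin (z * Real.cos θ) -
      2 * z * Real.cos θ * Real.cos (z * Real.cos θ) + 2 * Real.sin (z * Real.cos θ)))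
      (z ^ 3 * (Real.cos (z * Real.cos θ) * Real.sin θ ^ 3)) θ := fun θ => by
    have hc := (Real.hasDerivAt_cos θ).const_mul z
    have h1 := (((Real.hasDerivAt_sin θ).pow 2).mul_const (z ^ 2)).mul hc.sin
    have h2 := ((Real.hasDerivAt_cos θ).const_mul (2 * z)).mul hc.cos
    refine (((h1.sub h2).add (hc.sin.const_mul 2)).neg).congr_deriv ?_
    simp only [Pi.pow_apply]
    push_cast
    ring
  have h3 := intervalIntegral.integral_eq_sub_of_hasDerivAt (a := 0) (b := Real.pi)
    (fun θ _ => hd θ) ((by fun_prop : Continuous _).intervalIntegrable _ _)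
  rw [intervalIntegral.integral_const_mul] at h3
  rw [cosSinIntegral, h3]
  simp
  ring

theorem sphericalJ_three_eq {z : ℝ} (hz : 0 < z) :
    sphericalJ 3 z = 4 * Real.pi * Real.sin z / z := by
  rw [sphericalJ_three, eq_div_iff hz.ne']
  linear_combination 2 * Real.pi * mul_cosSinIntegral_one z

theorem sphericalL_three_eq {z : ℝ} (hz : 0 < z) :
    sphericalL 3 z = 4 * Real.pi * (Real.sin z / z ^ 3 - Real.cos z / z ^ 2) := by
  have := pow_mul_cosSinIntegral_three z
  rw [sphericalL_three, div_sub_div _ _ (by positivity) (by positivity), ← mul_div_assoc,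
    eq_div_iff (by positivity)]
  linear_combination Real.pi * z ^ 2 * this

end Kernels

/-! ### The integrands of the theorem in terms of `J` and `L` -/

section Integrands

/-- The normalization `(2π)⁻ᵈ` of the angular Fourier inversion. -/
def fourierNorm (d : ℕ) : ℂ := (((2 * Real.pi) ^ d)⁻¹ : ℝ)

variable {P Q : ℝ → ℂ} {r k : ℝ}

/-- One formula for all dimensions. In dimension one the hypothesis `P = Q` removes the term with
`L`, which has no counterpart in the stated integrand. -/
theorem integrandA_eq (hd : d = 1 ∨ d = 2 ∨ d = 3) (h1 : d = 1 → P = Q) (hr : 0 < r) (hk : 0 < k) :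
    integrandA d P Q r k = fourierNorm d * ((k : ℂ) ^ (d - 1) *
      ((sphericalJ d (k * r) : ℂ) * Q k + (sphericalL d (k * r) : ℂ) * (P k - Q k))) := by
  have hz : 0 < k * r := mul_pos hk hr
  have hpi := Real.pi_pos
  have hzc : ((k * r : ℝ) : ℂ) ≠ 0 := by exact_mod_cast hz.ne'
  have hpc : (Real.pi : ℂ) ≠ 0 := by exact_mod_cast hpi.ne'
  have hkc : (k : ℂ) ≠ 0 := by exact_mod_cast hk.ne'
  have hrc : (r : ℂ) ≠ 0 := by exact_mod_cast hr.ne'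
  rcases hd with rfl | rfl | rfl
  · rw [h1 rfl]
    simp only [integrandA, fourierNorm, sphericalJ_one]
    push_cast
    field_simp
    ring
  · simp only [integrandA, fourierNorm, sphericalJ_two, sphericalL_two, besselJ_zero_eq,
      besselJ_one_eq]
    push_cast
    field_simp
  · have e1 := sphericalJ_three_eq hz
    have e2 := sphericalL_three_eq hz
    simp only [integrandA, fourierNorm, e1, e2]
    push_cast
    field_simp
    ring

theorem integrandB_eq (hd : d = 1 ∨ d = 2 ∨ d = 3) (h1 : d = 1 → P = Q) (hr : 0 < r) (hk : 0 < k) :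
    integrandB d P Q r k = fourierNorm d * ((k : ℂ) ^ (d - 1) *
      (((sphericalJ d (k * r) : ℂ) - d * (sphericalL d (k * r) : ℂ)) * (P k - Q k))) := by
  have hz : 0 < k * r := mul_pos hk hr
  have hpi := Real.pi_pos
  have hzc : ((k * r : ℝ) : ℂ) ≠ 0 := by exact_mod_cast hz.ne'
  have hpc : (Real.pi : ℂ) ≠ 0 := by exact_mod_cast hpi.ne'
  have hkc : (k : ℂ) ≠ 0 := by exact_mod_cast hk.ne'
  have hrc : (r : ℂ) ≠ 0 := by exact_mod_cast hr.ne'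
  rcases hd with rfl | rfl | rfl
  · simp [h1 rfl, integrandB]
  · simp only [integrandB, fourierNorm, sphericalJ_two, sphericalL_two, besselJ_zero_eq,
      besselJ_one_eq]
    push_cast
    field_simp
  · have e1 := sphericalJ_three_eq hz
    have e2 := sphericalL_three_eq hz
    simp only [integrandB, fourierNorm, e1, e2]
    push_cast
    field_simp
    ring

theorem integrandARegular_eq (hd : d = 1 ∨ d = 2 ∨ d = 3) (h1 : d = 1 → P = Q) (hr : 0 < r)
    (hk : 0 < k) (c : ℂ) : integrandARegular d P Q c r k =
      integrandA d P Q r k - integrandA d (fun _ => c) (fun _ => c) r k := by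
  have hz : 0 < k * r := mul_pos hk hr
  have hkc : (k : ℂ) ≠ 0 := by exact_mod_cast hk.ne'
  have hrc : (r : ℂ) ≠ 0 := by exact_mod_cast hr.ne'
  rcases hd with rfl | rfl | rfl
  · simp only [integrandARegular, integrandA]
    push_cast
    ring
  · simp only [integrandARegular, integrandA]
    push_cast
    field_simp
    ring
  · simp only [integrandARegular, integrandA]
    push_cast
    ring

end Integrands

/-! ### Transforms of radial and tensor symbols over balls -/

section BallTransforms

theorem setIntegral_ball_comp_isometry (S : Space d ≃ₗᵢ[ℝ] Space d) (R : ℝ) (f : Space d → ℂ) :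
    ∫ κ in Metric.ball (0 : Space d) R, f (S κ) = ∫ κ in Metric.ball (0 : Space d) R, f κ := by
  have h := S.measurePreserving.setIntegral_preimage_emb S.toHomeomorph.measurableEmbedding f
    (Metric.ball 0 R)
  rw [← h]
  congr 2
  ext κ
  simp

theorem sum_directionTensor {κ : Space d} (hκ : κ ≠ 0) : ∑ i, directionTensor i i κ = 1 := by
  have hn : ‖κ‖ ≠ 0 := by simpa using hκ
  simp only [directionTensor, ← Finset.sum_div, ← sq]
  rw [← EuclideanSpace.real_norm_sq_eq, div_self (pow_ne_zero 2 hn)]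

theorem measurable_directionTensor (i j : Fin d) :
    Measurable fun κ : Space d => directionTensor i j κ := by
  unfold directionTensor
  exact (by fun_prop : Measurable fun κ : Space d => κ i * κ j).div (by fun_prop)

theorem integrableOn_ball_of_bounded {f : Space d → ℂ} (hf : Measurable f) {B R : ℝ}
    (hB : ∀ κ ∈ Metric.ball (0 : Space d) R, ‖f κ‖ ≤ B) :
    IntegrableOn f (Metric.ball (0 : Space d) R) :=
  Measure.integrableOn_of_bounded measure_ball_lt_top.ne hf.aestronglyMeasurable
    ((ae_restrict_iff' Metric.isOpen_ball.measurableSet).2 (ae_of_all _ hB))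

theorem exists_norm_le_on_ball {g : ℝ → ℂ} (hg : Continuous g) (R : ℝ) :
    ∃ B, 0 ≤ B ∧ ∀ κ ∈ Metric.ball (0 : Space d) R, ‖g ‖κ‖‖ ≤ B := by
  obtain ⟨B, hB⟩ := (isCompact_Icc : IsCompact (Set.Icc (0 : ℝ) R)).exists_bound_of_continuousOn
    hg.continuousOn
  refine ⟨max B 0, le_max_right _ _, fun κ hκ => (hB _ ⟨norm_nonneg _, ?_⟩).trans
    (le_max_left _ _)⟩
  exact (mem_ball_zero_iff.1 hκ).le

theorem integrableOn_ball_cos_tensor {g : ℝ → ℂ} (hg : Continuous g) (R : ℝ) (x : Space d)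
    (i j : Fin d) : IntegrableOn (fun κ : Space d => (Real.cos (inner ℝ x κ) : ℂ) *
      ((directionTensor i j κ : ℂ) * g ‖κ‖)) (Metric.ball 0 R) := by
  obtain ⟨B, hB0, hB⟩ := exists_norm_le_on_ball (d := d) hg R
  refine integrableOn_ball_of_bounded (B := B) ?_ fun κ hκ => ?_
  · have h1 := Complex.measurable_ofReal.comp (measurable_directionTensor (d := d) i j)
    have h2 : Measurable fun κ : Space d => (Real.cos (inner ℝ x κ) : ℂ) :=
      (by fun_prop : Continuous _).measurable
    exact h2.mul (h1.mul (hg.comp continuous_norm).measurable)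
  · rw [norm_mul, norm_mul, Complex.norm_real, Complex.norm_real]
    have h1 := abs_directionTensor_le i j κ
    calc _ ≤ 1 * (1 * ‖g ‖κ‖‖) := by
          gcongr
          · exact Real.abs_cos_le_one _
          · exact h1
      _ ≤ B := by rw [one_mul, one_mul]; exact hB κ hκ

/-- Equivariance reduces the transform at a general position to its longitudinal and transverse
entries at a position on the axis. -/
theorem isIsotropic_ball_cos_tensor {g : ℝ → ℂ} (hg : Continuous g) (R : ℝ) :
    IsIsotropic fun x : Space d => Matrix.of fun i j =>
      ∫ κ in Metric.ball (0 : Space d) R, (Real.cos (inner ℝ x κ) : ℂ) *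
        ((directionTensor i j κ : ℂ) * g ‖κ‖) := by
  classical
  have hC : IsIsotropic fun κ : Space d => Matrix.of fun i j =>
      (directionTensor i j κ : ℂ) * if ‖κ‖ < R then g ‖κ‖ else 0 := by
    refine isIsotropic_of_radial (fun _ => 0) (fun r => (if r < R then g r else 0) / (r : ℂ) ^ 2) _
      fun ξ i j => ?_
    simp only [Matrix.of_apply, directionTensor]
    push_cast
    ring
  have e : ∀ (x : Space d) (i j : Fin d), (fun κ : Space d => (Real.cos (inner ℝ x κ) : ℂ) *
      ((directionTensor i j κ : ℂ) * if ‖κ‖ < R then g ‖κ‖ else 0)) =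
      (Metric.ball (0 : Space d) R).indicator fun κ => (Real.cos (inner ℝ x κ) : ℂ) *
        ((directionTensor i j κ : ℂ) * g ‖κ‖) := by
    intro x i j
    ext κ
    by_cases h : ‖κ‖ < R
    · rw [if_pos h, Set.indicator_of_mem (mem_ball_zero_iff.2 h)]
    · rw [if_neg h, Set.indicator_of_notMem fun hm => h (mem_ball_zero_iff.1 hm), mul_zero,
        mul_zero]
  have h := hC.integral (fun x κ => (Real.cos (inner ℝ x κ) : ℂ)) (by simp) fun x i j => by
    simp only [Matrix.of_apply]
    rw [e, integrable_indicator_iff Metric.isOpen_ball.measurableSet]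
    exact integrableOn_ball_cos_tensor hg R x i j
  simp only [Matrix.of_apply, e, integral_indicator Metric.isOpen_ball.measurableSet] at h
  exact h

variable [NeZero d]

theorem inner_axis (r : ℝ) (κ : Space d) :
    inner ℝ (EuclideanSpace.single 0 r) κ = ‖κ‖ * r * (κ 0 / ‖κ‖) := by
  by_cases hκ : κ = 0
  · simp [hκ]
  · have : ‖κ‖ ≠ 0 := by simpa using hκ
    rw [EuclideanSpace.inner_single_left, conj_trivial]
    field_simp

theorem setIntegral_ball_cos_radial (hd : d = 1 ∨ d = 2 ∨ d = 3) {g : ℝ → ℂ} (hg : Continuous g)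
    {R : ℝ} (hR : 0 ≤ R) (x : Space d) :
    ∫ κ in Metric.ball (0 : Space d) R, (Real.cos (inner ℝ x κ) : ℂ) * g ‖κ‖ =
      ∫ k in (0 : ℝ)..R, (k : ℂ) ^ (d - 1) * ((sphericalJ d (k * ‖x‖) : ℂ) * g k) := by
  obtain ⟨S, hS, -⟩ := exists_isometry_axis x
  rw [← setIntegral_ball_comp_isometry S]
  have e : ∀ κ : Space d, inner ℝ x (S κ) = ‖κ‖ * ‖x‖ * (κ 0 / ‖κ‖) := fun κ => by
    rw [← inner_axis, ← S.inner_map_map (EuclideanSpace.single 0 ‖x‖), hS]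
  simp only [e, LinearIsometryEquiv.norm_map]
  exact setIntegral_ball_polar hd (h := fun p => Real.cos (p.1 * ‖x‖ * p.2)) (by fun_prop) hg hR

/-- The longitudinal component of the transform of `κᵢ κⱼ / |κ|²`. -/
theorem setIntegral_ball_cos_axial (hd : d = 1 ∨ d = 2 ∨ d = 3) {g : ℝ → ℂ} (hg : Continuous g)
    {R : ℝ} (hR : 0 ≤ R) (r : ℝ) :
    ∫ κ in Metric.ball (0 : Space d) R,
      (Real.cos (inner ℝ (EuclideanSpace.single 0 r) κ) : ℂ) *
        ((directionTensor 0 0 κ : ℂ) * g ‖κ‖) =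
      ∫ k in (0 : ℝ)..R, (k : ℂ) ^ (d - 1) *
        (((sphericalJ d (k * r) - (d - 1) * sphericalL d (k * r) : ℝ) : ℂ) * g k) := by
  have h := setIntegral_ball_polar hd (h := fun p => Real.cos (p.1 * r * p.2) * p.2 ^ 2)
    (by fun_prop) hg hR
  simp only [axialIntegral_cos_mul_sq hd] at h
  rw [← h]
  congr 1
  ext κ
  rw [inner_axis, directionTensor, ← mul_assoc, ← Complex.ofReal_mul]
  congr 4
  rw [div_pow, sq (κ.ofLp 0)]

theorem ae_ne_zero : ∀ᵐ x : Space d, x ≠ 0 :=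
  compl_mem_ae_iff.2 (measure_singleton 0)

/-- The transverse component of the transform of `κᵢ κⱼ / |κ|²`, for `d ≥ 2`. -/
theorem setIntegral_ball_cos_transverse (hd : d = 2 ∨ d = 3) {g : ℝ → ℂ} (hg : Continuous g)
    {R : ℝ} (hR : 0 ≤ R) (r : ℝ) :
    ∫ κ in Metric.ball (0 : Space d) R,
      (Real.cos (inner ℝ (EuclideanSpace.single 0 r) κ) : ℂ) *
        ((directionTensor 1 1 κ : ℂ) * g ‖κ‖) =
      ∫ k in (0 : ℝ)..R, (k : ℂ) ^ (d - 1) * ((sphericalL d (k * r) : ℂ) * g k) := by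
  have hd' : d = 1 ∨ d = 2 ∨ d = 3 := Or.inr hd
  have hJ := continuous_sphericalJ hd'
  have hL := continuous_sphericalL hd'
  set x : Space d := EuclideanSpace.single 0 r with hx
  have hiso := isIsotropic_ball_cos_tensor (d := d) hg R
  have h1 := setIntegral_ball_cos_axial hd' hg hR r
  -- The direction tensor has trace one away from the origin and its transverse entries have equal
  -- transforms, so `d - 1` copies of the transverse value equal the radial transform minus the
  -- axial one.
  have hsum : ∑ i, ∫ κ in Metric.ball (0 : Space d) R, (Real.cos (inner ℝ x κ) : ℂ) *
      ((directionTensor i i κ : ℂ) * g ‖κ‖) =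
      ∫ κ in Metric.ball (0 : Space d) R, (Real.cos (inner ℝ x κ) : ℂ) * g ‖κ‖ := by
    rw [← integral_finsetSum _ fun i _ => integrableOn_ball_cos_tensor hg R x i i]
    refine integral_congr_ae (ae_restrict_of_ae ?_)
    filter_upwards [ae_ne_zero] with κ hκ
    rw [← Finset.mul_sum, ← Finset.sum_mul, ← Complex.ofReal_sum, sum_directionTensor hκ,
      Complex.ofReal_one, one_mul]
  have h2 : ∀ i : Fin d, i ≠ 0 → (∫ κ in Metric.ball (0 : Space d) R,
      (Real.cos (inner ℝ x κ) : ℂ) * ((directionTensor i i κ : ℂ) * g ‖κ‖)) =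
      ∫ κ in Metric.ball (0 : Space d) R,
      (Real.cos (inner ℝ x κ) : ℂ) * ((directionTensor 1 1 κ : ℂ) * g ‖κ‖) := fun i hi =>
    hiso.diag_eq (κ := x) (i := i) (j := 1) (by simp [hx, hi, one_ne_zero_of_ne_zero hi])
  rw [← Finset.add_sum_erase _ _ (Finset.mem_univ (0 : Fin d)),
    Finset.sum_congr rfl fun i hi => h2 i (Finset.ne_of_mem_erase hi), Finset.sum_const,
    Finset.card_erase_of_mem (Finset.mem_univ _), Finset.card_univ, Fintype.card_fin, h1,
    setIntegral_ball_cos_radial hd' hg hR] at hsum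
  have hxn : ∀ k : ℝ, sphericalJ d (k * ‖x‖) = sphericalJ d (k * r) := fun k => by
    rw [hx]
    simp only [PiLp.norm_single, Real.norm_eq_abs]
    rcases abs_choice r with h | h
    · rw [h]
    · rw [h, mul_neg]
      simp [sphericalJ]
  simp only [hxn] at hsum
  have hd1 : ((d : ℂ) - 1) ≠ 0 := by
    rcases hd with rfl | rfl <;> norm_num
  apply mul_left_cancel₀ hd1
  have hcast : ((d - 1 : ℕ) : ℂ) = (d : ℂ) - 1 := by
    rw [Nat.cast_sub (NeZero.one_le), Nat.cast_one]
  rw [nsmul_eq_mul, hcast] at hsum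
  rw [← eq_sub_iff_add_eq'] at hsum
  rw [hsum, ← intervalIntegral.integral_sub ((by fun_prop : Continuous _).intervalIntegrable _ _)
    ((by fun_prop : Continuous _).intervalIntegrable _ _), ← intervalIntegral.integral_const_mul]
  congr 1
  ext k
  push_cast
  ring

/-- The transform of `κᵢ κⱼ / |κ|²` times a radial function. -/
theorem setIntegral_ball_cos_tensor (hd : d = 1 ∨ d = 2 ∨ d = 3) {g : ℝ → ℂ} (hg : Continuous g)
    {R : ℝ} (hR : 0 ≤ R) {x : Space d} (hx : x ≠ 0) (i j : Fin d) :
    ∫ κ in Metric.ball (0 : Space d) R, (Real.cos (inner ℝ x κ) : ℂ) *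
        ((directionTensor i j κ : ℂ) * g ‖κ‖) =
      (if i = j then 1 else 0) *
        (∫ k in (0 : ℝ)..R, (k : ℂ) ^ (d - 1) * ((sphericalL d (k * ‖x‖) : ℂ) * g k)) +
      (directionTensor i j x : ℂ) * ∫ k in (0 : ℝ)..R, (k : ℂ) ^ (d - 1) *
        (((sphericalJ d (k * ‖x‖) : ℂ) - d * (sphericalL d (k * ‖x‖) : ℂ)) * g k) := by
  have hJ := continuous_sphericalJ hd
  have hL := continuous_sphericalL hd
  have hiso := isIsotropic_ball_cos_tensor (d := d) hg R
  have h := hiso.apply_eq x i j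
  simp only [Matrix.of_apply] at h
  have hxn : ‖x‖ ≠ 0 := by simpa using hx
  rw [h, setIntegral_ball_cos_axial hd hg hR]
  -- On the line the transverse index coincides with the axis, and the formula reduces to `L + (J -
  -- L) = J`.
  by_cases h1 : d = 1
  · subst h1
    have hij : i = j := Subsingleton.elim _ _
    have hdir : directionTensor i j x = 1 := by
      have := sum_directionTensor hx
      rw [Fin.sum_univ_one] at this
      rw [Subsingleton.elim i 0, Subsingleton.elim j 0, this]
    rw [hdir, if_pos hij, mul_one, Complex.ofReal_one, one_mul, one_mul, one_mul, add_sub_cancel,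
      ← intervalIntegral.integral_add ((by fun_prop : Continuous _).intervalIntegrable _ _)
        ((by fun_prop : Continuous _).intervalIntegrable _ _)]
    congr 1
    ext k
    push_cast
    ring
  · have hd2 : d = 2 ∨ d = 3 := hd.resolve_left h1
    rw [setIntegral_ball_cos_transverse hd2 hg hR,
      ← intervalIntegral.integral_sub ((by fun_prop : Continuous _).intervalIntegrable _ _)
        ((by fun_prop : Continuous _).intervalIntegrable _ _), mul_comm]
    congr 3
    ext k
    push_cast
    ring

/-- The kernel `L` is the Fourier transform of the unit ball, hence vanishes at infinity. -/
theorem tendsto_sphericalL (hd : d = 1 ∨ d = 2 ∨ d = 3) :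
    Tendsto (sphericalL d) atTop (𝓝 0) := by
  set f : Space d → ℝ := (Metric.ball (0 : Space d) 1).indicator fun _ => 1 with hf
  have hfi : Integrable f := by
    rw [hf, integrable_indicator_iff Metric.isOpen_ball.measurableSet]
    exact integrableOn_const measure_ball_lt_top.ne
  have hfe : ∀ ξ, f (-ξ) = f ξ := fun ξ => by
    have : -ξ ∈ Metric.ball (0 : Space d) 1 ↔ ξ ∈ Metric.ball (0 : Space d) 1 := by
      rw [mem_ball_zero_iff, mem_ball_zero_iff, norm_neg]
    by_cases hξ : ξ ∈ Metric.ball (0 : Space d) 1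
    · rw [hf, Set.indicator_of_mem hξ, Set.indicator_of_mem (this.2 hξ)]
    · rw [hf, Set.indicator_of_notMem hξ, Set.indicator_of_notMem (mt this.1 hξ)]
  have h1 : ∀ r : ℝ, 0 ≤ r → (sphericalL d r : ℂ) =
      𝓕 (fun ξ => (f ξ : ℂ)) ((2 * Real.pi)⁻¹ • EuclideanSpace.single 0 r) := by
    intro r hr
    rw [fourier_even hfi hfe, smul_smul, mul_inv_cancel₀ (by positivity), one_smul,
      ← integral_complex_ofReal]
    have h := setIntegral_ball_cos_radial hd (g := fun _ => 1) continuous_const zero_le_one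
      (EuclideanSpace.single 0 r : Space d)
    rw [← integral_indicator Metric.isOpen_ball.measurableSet] at h
    have e : ∀ ξ : Space d, ((Real.cos (inner ℝ (EuclideanSpace.single 0 r) ξ) * f ξ : ℝ) : ℂ) =
        (Metric.ball (0 : Space d) 1).indicator (fun κ =>
          (Real.cos (inner ℝ (EuclideanSpace.single 0 r) κ) : ℂ) * 1) ξ := fun ξ => by
      by_cases hξ : ξ ∈ Metric.ball (0 : Space d) 1 <;> simp [hf, hξ]
    simp only [e]
    rw [h, sphericalL, ← intervalIntegral.integral_ofReal]
    simp [abs_of_nonneg hr]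
  have h2 := tendsto_integral_exp_inner_smul_cocompact (fun ξ => (f ξ : ℂ))
  have hs : Tendsto (fun κ : Space d => (2 * Real.pi)⁻¹ • κ) (cocompact _) (cocompact _) :=
    (Homeomorph.smulOfNeZero (2 * Real.pi)⁻¹ (by positivity)).isClosedEmbedding.tendsto_cocompact
  have h3 := (h2.comp hs).comp (tendsto_single_cocompact (d := d))
  have h4 : Tendsto (fun r => (sphericalL d r : ℂ)) atTop (𝓝 0) := by
    refine h3.congr' ?_
    filter_upwards [eventually_ge_atTop 0] with r hr
    rw [h1 r hr, Real.fourier_eq]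
    rfl
  have h5 := (Complex.continuous_re.tendsto _).comp h4
  simpa [Function.comp_def] using h5

end BallTransforms

/-! ### Improper integrals as limits of tempered distributions -/

section Distributions

theorem continuous_fourierInv_of_integrable {g : Space d → ℂ} (hg : Integrable g) :
    Continuous (𝓕⁻ g) := by
  rw [show 𝓕⁻ g = fun x => 𝓕 g (-x) from funext (Real.fourierInv_eq_fourier_neg g)]
  exact (VectorFourier.fourierIntegral_continuous Real.continuous_fourierChar
    continuous_inner hg).comp continuous_neg

theorem norm_fourierInv_le (g : Space d → ℂ) (x : Space d) : ‖𝓕⁻ g x‖ ≤ ∫ k, ‖g k‖ := by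
  rw [Real.fourierInv_eq_fourier_neg]
  exact VectorFourier.norm_fourierIntegral_le_integral_norm _ _ _ _ _

theorem integral_schwartz_mul_fourierInv (φ : 𝓢(Space d, ℂ)) {g : Space d → ℂ}
    (hg : Integrable g) : Integrable (fun x => φ x * 𝓕⁻ g x) ∧
      ∫ x, φ x * 𝓕⁻ g x = ∫ k, (𝓕⁻ φ) k * g k := by
  constructor
  · exact φ.integrable.mul_bdd (continuous_fourierInv_of_integrable hg).aestronglyMeasurable
      (ae_of_all _ (norm_fourierInv_le g))
  · have h := VectorFourier.integral_fourierIntegral_smul_eq_flip (L := innerₗ (Space d))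
      Real.continuous_fourierChar continuous_inner (f := fun x => φ (-x)) (g := g)
      (μ := volume) (ν := volume) φ.integrable.comp_neg hg
    have h1 : ∀ k, (𝓕⁻ φ) k = 𝓕 (fun x => φ (-x)) k := fun k => by
      rw [SchwartzMap.fourierInv_coe, Real.fourierInv_eq_fourier_comp_neg]
    rw [← integral_neg_eq_self]
    simp only [Real.fourierInv_eq_fourier_neg g, neg_neg, h1]
    simp only [smul_eq_mul, flip_innerₗ] at h
    exact h.symm

theorem fourierInv_even {g : Space d → ℂ} (hg : Integrable g) (he : ∀ k, g (-k) = g k)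
    (x : Space d) : 𝓕⁻ g x = ∫ k, (Real.cos (2 * Real.pi * inner ℝ x k) : ℂ) * g k := by
  have hsin : Integrable fun k => (Real.sin (2 * Real.pi * inner ℝ x k) : ℂ) * g k := by
    refine hg.bdd_mul (c := 1) (by fun_prop) (ae_of_all _ fun ξ => ?_)
    rw [Complex.norm_real]
    exact Real.abs_sin_le_one _
  have hcos : Integrable fun k => (Real.cos (2 * Real.pi * inner ℝ x k) : ℂ) * g k := by
    refine hg.bdd_mul (c := 1) (by fun_prop) (ae_of_all _ fun ξ => ?_)
    rw [Complex.norm_real]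
    exact Real.abs_cos_le_one _
  have hodd : ∫ k, (Real.sin (2 * Real.pi * inner ℝ x k) : ℂ) * g k = 0 := by
    refine integral_odd_eq_zero fun ξ => ?_
    rw [he, inner_neg_right, mul_neg, Real.sin_neg, Complex.ofReal_neg, neg_mul]
  rw [Real.fourierInv_eq', ← add_zero (∫ k, (Real.cos _ : ℂ) * g k), ← mul_zero Complex.I, ← hodd,
    ← integral_const_mul, ← integral_add hcos (hsin.const_mul _)]
  congr 1
  ext k
  rw [real_inner_comm, Complex.exp_mul_I, ← Complex.ofReal_cos, ← Complex.ofReal_sin, smul_eq_mul]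
  ring

/-- The substitution `κ = 2πk` produces the factor `(2π)⁻ᵈ`; evenness of the symbol discards the
sine part. -/
theorem fourierInv_scaled_ball {σ : Space d → ℂ} (hmeas : Measurable σ)
    (heven : ∀ κ, σ (-κ) = σ κ) {B R : ℝ} (hB : ∀ κ ∈ Metric.ball (0 : Space d) R, ‖σ κ‖ ≤ B) :
    Integrable (fun k : Space d => (Metric.ball (0 : Space d) R).indicator σ
      ((2 * Real.pi) • k)) ∧
    ∀ x, 𝓕⁻ (fun k : Space d => (Metric.ball (0 : Space d) R).indicator σ ((2 * Real.pi) • k)) x =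
      fourierNorm d * ∫ κ in Metric.ball (0 : Space d) R, (Real.cos (inner ℝ x κ) : ℂ) * σ κ := by
  have hpi : (2 * Real.pi) ≠ 0 := by positivity
  have hi : Integrable ((Metric.ball (0 : Space d) R).indicator σ) :=
    (integrable_indicator_iff Metric.isOpen_ball.measurableSet).2
      (integrableOn_ball_of_bounded hmeas hB)
  have hi2 := hi.comp_smul hpi
  have he : ∀ κ, (Metric.ball (0 : Space d) R).indicator σ (-κ) =
      (Metric.ball (0 : Space d) R).indicator σ κ := fun κ => by
    have : -κ ∈ Metric.ball (0 : Space d) R ↔ κ ∈ Metric.ball (0 : Space d) R := by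
      rw [mem_ball_zero_iff, mem_ball_zero_iff, norm_neg]
    by_cases hξ : κ ∈ Metric.ball (0 : Space d) R
    · rw [Set.indicator_of_mem hξ, Set.indicator_of_mem (this.2 hξ), heven]
    · rw [Set.indicator_of_notMem hξ, Set.indicator_of_notMem (mt this.1 hξ)]
  refine ⟨hi2, fun x => ?_⟩
  rw [fourierInv_even hi2 (fun k => by rw [smul_neg, he]), fourierNorm]
  have h := Measure.integral_comp_smul (volume : Measure (Space d))
    (fun κ => (Real.cos (inner ℝ x κ) : ℂ) * (Metric.ball (0 : Space d) R).indicator σ κ)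
    (2 * Real.pi)
  simp only [real_inner_smul_right] at h
  rw [h, finrank_euclideanSpace, Fintype.card_fin, abs_of_nonneg (by positivity),
    ← integral_indicator Metric.isOpen_ball.measurableSet, Complex.real_smul]
  congr 2
  ext κ
  by_cases hκ : κ ∈ Metric.ball (0 : Space d) R <;> simp [hκ]

/-- The symbol may change with the cutoff radius, which is needed for `u_A`. After Parseval the
cutoffs are paired with a Schwartz function, so a uniform bound and pointwise convergence suffice
for dominated convergence. -/
theorem isImproperIntegral_of_symbols {σ : ℝ → Space d → ℂ} {σ' : Space d → ℂ}
    (hmeas : ∀ R, Measurable (σ R)) (heven : ∀ R κ, σ R (-κ) = σ R κ) {B : ℝ}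
    (hB : ∀ R ≥ 0, ∀ κ ∈ Metric.ball (0 : Space d) R, ‖σ R κ‖ ≤ B)
    (hlim : ∀ κ, Tendsto (fun R => σ R κ) atTop (𝓝 (σ' κ)))
    (hm : MemLp (fun k => σ' ((2 * Real.pi) • k)) ⊤) {f : Space d → ℝ → ℂ}
    (hfi : ∀ x : Space d, x ≠ 0 → ∀ R : ℝ, 0 ≤ R → IntervalIntegrable (f x) volume 0 R)
    (hf : ∀ x : Space d, x ≠ 0 → ∀ R : ℝ, 0 ≤ R → ∫ k in (0 : ℝ)..R, f x k =
      fourierNorm d * ∫ κ in Metric.ball (0 : Space d) R,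
        (Real.cos (inner ℝ x κ) : ℂ) * σ R κ) (h0 : ∀ᵐ x : Space d, x ≠ 0) :
    IsImproperIntegral (invFourierOfBounded _ hm) f := by
  have key : ∀ R ≥ 0, ∀ φ : 𝓢(Space d, ℂ),
      Integrable (fun x : Space d => φ x * ∫ k in (0 : ℝ)..R, f x k) ∧
      ∫ x : Space d, φ x * (∫ k in (0 : ℝ)..R, f x k) =
        ∫ k, (𝓕⁻ φ) k * (Metric.ball (0 : Space d) R).indicator (σ R) ((2 * Real.pi) • k) := by
    intro R hR φ
    obtain ⟨h1, h2⟩ := fourierInv_scaled_ball (hmeas R) (heven R) (hB R hR)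
    obtain ⟨h3, h4⟩ := integral_schwartz_mul_fourierInv φ h1
    have he : (fun x : Space d => φ x * ∫ k in (0 : ℝ)..R, f x k) =ᵐ[volume] fun x =>
        φ x * 𝓕⁻ (fun k : Space d => (Metric.ball (0 : Space d) R).indicator (σ R)
          ((2 * Real.pi) • k)) x := by
      filter_upwards [h0] with x hx
      rw [hf x hx R hR, h2]
    exact ⟨h3.congr he.symm, (integral_congr_ae he).trans h4⟩
  refine ⟨hfi, fun R hR φ => (key R hR φ).1, fun φ => ?_⟩
  rw [invFourierOfBounded_apply]
  have hB0 : 0 ≤ max B 0 := le_max_right _ _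
  refine Tendsto.congr' ((eventually_ge_atTop 0).mono fun R hR => ((key R hR φ).2).symm) ?_
  refine tendsto_integral_filter_of_dominated_convergence (fun k => ‖(𝓕⁻ φ) k‖ * max B 0)
    (Eventually.of_forall fun R => ?_) ((eventually_ge_atTop 0).mono fun R hR =>
      ae_of_all _ fun k => ?_)
    ((𝓕⁻ φ).integrable.norm.mul_const _) (ae_of_all _ fun k => ?_)
  · refine (𝓕⁻ φ).continuous.aestronglyMeasurable.mul ?_
    exact (((hmeas R).indicator Metric.isOpen_ball.measurableSet).comp
      (measurable_const_smul (2 * Real.pi))).aestronglyMeasurable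
  · rw [norm_mul]
    refine mul_le_mul_of_nonneg_left ?_ (norm_nonneg _)
    by_cases hk : (2 * Real.pi) • k ∈ Metric.ball (0 : Space d) R
    · rw [Set.indicator_of_mem hk]
      exact (hB R hR _ hk).trans (le_max_left _ _)
    · rw [Set.indicator_of_notMem hk, norm_zero]
      exact hB0
  · refine Tendsto.const_mul _ (Tendsto.congr' ?_ (hlim _))
    filter_upwards [eventually_gt_atTop ‖(2 * Real.pi) • k‖] with R hR
    rw [Set.indicator_of_mem (mem_ball_zero_iff.2 hR)]

variable {T T' : 𝓢'(Space d, ℂ)} {f f' : Space d → ℝ → ℂ}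

theorem IsImproperIntegral.congr (h : IsImproperIntegral T f) (h0 : ∀ᵐ x : Space d, x ≠ 0)
    (he : ∀ x : Space d, x ≠ 0 → ∀ k > 0, f x k = f' x k) : IsImproperIntegral T f' := by
  have hi : ∀ x : Space d, x ≠ 0 → ∀ R : ℝ, 0 ≤ R →
      ∫ k in (0 : ℝ)..R, f x k = ∫ k in (0 : ℝ)..R, f' x k := fun x hx R hR => by
    rw [intervalIntegral.integral_of_le hR, intervalIntegral.integral_of_le hR]
    exact setIntegral_congr_fun measurableSet_Ioc fun k hk => he x hx k hk.1
  have hae : ∀ R : ℝ, 0 ≤ R → ∀ φ : 𝓢(Space d, ℂ),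
      (fun x : Space d => φ x * ∫ k in (0 : ℝ)..R, f x k) =ᵐ[volume]
        fun x : Space d => φ x * ∫ k in (0 : ℝ)..R, f' x k := fun R hR φ => by
    filter_upwards [h0] with x hx
    rw [hi x hx R hR]
  refine ⟨fun x hx R hR => ?_, fun R hR φ => (h.2.1 R hR φ).congr (hae R hR φ), fun φ => ?_⟩
  · have h1 := h.1 x hx R hR
    rw [intervalIntegrable_iff_integrableOn_Ioc_of_le hR] at h1 ⊢
    exact h1.congr_fun (fun k hk => he x hx k hk.1) measurableSet_Ioc
  · exact (h.2.2 φ).congr' ((eventually_ge_atTop 0).mono fun R hR =>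
      integral_congr_ae (hae R hR φ))

theorem IsImproperIntegral.add (h : IsImproperIntegral T f) (h' : IsImproperIntegral T' f')
    (h0 : ∀ᵐ x : Space d, x ≠ 0) : IsImproperIntegral (T + T') fun x k => f x k + f' x k := by
  have hae : ∀ R : ℝ, 0 ≤ R → ∀ φ : 𝓢(Space d, ℂ),
      ((fun x : Space d => φ x * ∫ k in (0 : ℝ)..R, f x k) +
        fun x : Space d => φ x * ∫ k in (0 : ℝ)..R, f' x k) =ᵐ[volume]
        fun x : Space d => φ x * ∫ k in (0 : ℝ)..R, f x k + f' x k := fun R hR φ => by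
    filter_upwards [h0] with x hx
    rw [Pi.add_apply, intervalIntegral.integral_add (h.1 x hx R hR) (h'.1 x hx R hR), mul_add]
  refine ⟨fun x hx R hR => (h.1 x hx R hR).add (h'.1 x hx R hR), fun R hR φ =>
    ((h.2.1 R hR φ).add (h'.2.1 R hR φ)).congr (hae R hR φ), fun φ => ?_⟩
  refine Tendsto.congr' ((eventually_ge_atTop 0).mono fun R hR => ?_)
    ((h.2.2 φ).add (h'.2.2 φ))
  dsimp only
  rw [← integral_congr_ae (hae R hR φ), ← integral_add (h.2.1 R hR φ) (h'.2.1 R hR φ)]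
  rfl

theorem IsImproperIntegral.const_smul (h : IsImproperIntegral T f) (a : ℂ) :
    IsImproperIntegral (a • T) fun x k => a * f x k := by
  have e : ∀ (φ : 𝓢(Space d, ℂ)) (R : ℝ), (fun x : Space d => φ x * ∫ k in (0 : ℝ)..R, a * f x k) =
      fun x => a * (φ x * ∫ k in (0 : ℝ)..R, f x k) := fun φ R => by
    ext x
    rw [intervalIntegral.integral_const_mul]
    ring
  refine ⟨fun x hx R hR => (h.1 x hx R hR).const_mul a, fun R hR φ => ?_, fun φ => ?_⟩
  · rw [e]
    exact (h.2.1 R hR φ).const_mul a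
  · simp only [e, integral_const_mul]
    exact (h.2.2 φ).const_mul a

theorem IsImproperIntegral.sub (h : IsImproperIntegral T f) (h' : IsImproperIntegral T' f')
    (h0 : ∀ᵐ x : Space d, x ≠ 0) : IsImproperIntegral (T - T') fun x k => f x k - f' x k := by
  have := h.add (h'.const_smul (-1)) h0
  rw [show T + (-1 : ℂ) • T' = T - T' by module] at this
  exact this.congr h0 fun x _ k _ => by ring

theorem IsImproperIntegral.sum {ι : Type*} (s : Finset ι) {T : ι → 𝓢'(Space d, ℂ)}
    {f : ι → Space d → ℝ → ℂ} (h : ∀ i, IsImproperIntegral (T i) (f i))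
    (h0 : ∀ᵐ x : Space d, x ≠ 0) :
    IsImproperIntegral (∑ i ∈ s, T i) fun x k => ∑ i ∈ s, f i x k := by
  classical
  induction s using Finset.induction_on with
  | empty =>
    simp only [Finset.sum_empty]
    refine ⟨by simp, by simp, fun φ => ?_⟩
    simp
  | insert a s ha ih =>
    simp only [Finset.sum_insert ha]
    exact (h a).add ih h0

theorem IsImproperIntegral.integrableOn_Ioi (h : IsImproperIntegral T f) {G : ℝ → ℝ}
    (hG : IntegrableOn G (Set.Ioi 0)) (hfG : ∀ x : Space d, x ≠ 0 → ∀ k > 0, ‖f x k‖ ≤ G k)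
    {x : Space d} (hx : x ≠ 0) : IntegrableOn (f x) (Set.Ioi 0) := by
  -- Measurability on the half line is assembled from the intervals `(0, n]`, on which local
  -- integrability is part of the hypothesis.
  have hm : AEStronglyMeasurable (f x) (volume.restrict (Set.Ioi 0)) := by
    rw [show Set.Ioi (0 : ℝ) = ⋃ n : ℕ, Set.Ioc (0 : ℝ) n by
      ext k
      simp only [Set.mem_Ioi, Set.mem_iUnion, Set.mem_Ioc]
      exact ⟨fun hk => (exists_nat_ge k).imp fun n hn => ⟨hk, hn⟩, fun ⟨n, hn⟩ => hn.1⟩]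
    refine AEStronglyMeasurable.iUnion fun n => ?_
    have := h.1 x hx n (Nat.cast_nonneg n)
    rw [intervalIntegrable_iff_integrableOn_Ioc_of_le (Nat.cast_nonneg n)] at this
    exact this.aestronglyMeasurable
  exact hG.mono' hm ((ae_restrict_iff' measurableSet_Ioi).2 (ae_of_all _ fun k hk => hfG x hx k hk))

/-- An improper integral that converges absolutely and uniformly in `x` is a function. -/
theorem IsImproperIntegral.isFunction (h : IsImproperIntegral T f)
    (h0 : ∀ᵐ x : Space d, x ≠ 0) {G : ℝ → ℝ}
    (hG : IntegrableOn G (Set.Ioi 0)) (hfG : ∀ x : Space d, x ≠ 0 → ∀ k > 0, ‖f x k‖ ≤ G k) :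
    IsFunction T fun x => ∫ k in Set.Ioi (0 : ℝ), f x k := by
  intro φ
  have hlim : ∀ᵐ x : Space d, Tendsto (fun R : ℝ => φ x * ∫ k in (0 : ℝ)..R, f x k) atTop
      (𝓝 (φ x * ∫ k in Set.Ioi (0 : ℝ), f x k)) := by
    filter_upwards [h0] with x hx
    exact (intervalIntegral_tendsto_integral_Ioi 0 (h.integrableOn_Ioi hG hfG hx)
      tendsto_id).const_mul _
  have hbd : ∀ R : ℝ, 0 ≤ R → ∀ᵐ x : Space d, ‖φ x * ∫ k in (0 : ℝ)..R, f x k‖ ≤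
      ‖φ x‖ * ∫ k in Set.Ioi (0 : ℝ), G k := by
    intro R hR
    filter_upwards [h0] with x hx
    rw [norm_mul, intervalIntegral.integral_of_le hR]
    gcongr
    have hsub : Set.Ioc 0 R ⊆ Set.Ioi (0 : ℝ) := fun k hk => hk.1
    calc _ ≤ ∫ k in Set.Ioc 0 R, ‖f x k‖ := norm_integral_le_integral_norm _
      _ ≤ ∫ k in Set.Ioi (0 : ℝ), ‖f x k‖ :=
        setIntegral_mono_set (h.integrableOn_Ioi hG hfG hx).norm (ae_of_all _ fun _ =>
          norm_nonneg _) (LE.le.eventuallyLE hsub)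
      _ ≤ _ := setIntegral_mono_on (h.integrableOn_Ioi hG hfG hx).norm hG measurableSet_Ioi
        fun k hk => hfG x hx k hk
  have hint : Integrable fun x : Space d => ‖φ x‖ * ∫ k in Set.Ioi (0 : ℝ), G k :=
    φ.integrable.norm.mul_const _
  have hmeas : AEStronglyMeasurable (fun x : Space d => φ x * ∫ k in Set.Ioi (0 : ℝ), f x k) :=
    aestronglyMeasurable_of_tendsto_ae (u := (atTop : Filter ℕ))
      (f := fun n x => φ x * ∫ k in (0 : ℝ)..(n : ℝ), f x k)
      (fun n => (h.2.1 n (Nat.cast_nonneg n) φ).aestronglyMeasurable)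
      (hlim.mono fun x hx => hx.comp tendsto_natCast_atTop_atTop)
  constructor
  · refine hint.mono' hmeas ?_
    have hall : ∀ᵐ x : Space d, ∀ n : ℕ, ‖φ x * ∫ k in (0 : ℝ)..(n : ℝ), f x k‖ ≤
        ‖φ x‖ * ∫ k in Set.Ioi (0 : ℝ), G k := ae_all_iff.2 fun n => hbd n (Nat.cast_nonneg n)
    filter_upwards [hlim, hall] with x hx hn
    exact le_of_tendsto ((hx.comp tendsto_natCast_atTop_atTop).norm)
      (Eventually.of_forall fun n => hn n)
  · refine tendsto_nhds_unique (h.2.2 φ) ?_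
    exact tendsto_integral_filter_of_dominated_convergence _
      ((eventually_ge_atTop 0).mono fun R hR => (h.2.1 R hR φ).aestronglyMeasurable)
      ((eventually_ge_atTop 0).mono fun R hR => hbd R hR) hint hlim

end Distributions

/-! ### A contraction principle for convolution inequalities -/

section Contraction

theorem exists_schwartz_integral_sub_le {f : Space d → ℂ} (hf : Integrable f) {ε : ℝ}
    (hε : 0 < ε) : ∃ φ : 𝓢(Space d, ℂ), ∫ x, ‖f x - φ x‖ ≤ ε := by
  obtain ⟨g, hg1, hg2, hg3⟩ := (memLp_one_iff_integrable.2 hf).exist_eLpNorm_sub_le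
    ENNReal.one_ne_top le_rfl hε
  refine ⟨hg1.toSchwartzMap hg2, ?_⟩
  have hgi : Integrable g := hg2.continuous.integrable_of_hasCompactSupport hg1
  rw [eLpNorm_one_eq_lintegral_enorm] at hg3
  change ∫ x, ‖(f - g) x‖ ≤ ε
  rw [integral_norm_eq_lintegral_enorm (hf.sub hgi).aestronglyMeasurable]
  exact ENNReal.toReal_le_of_le_ofReal hε.le hg3

/-- A bounded family that is dominated by a null family plus its own convolution with a kernel
of mass less than one tends to zero. -/
theorem tendsto_zero_of_le_add_convolution {ι : Type*} {l : Filter ι} [l.IsCountablyGenerated]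
    {A h : ι → Space d → ℝ} {κ : Space d → ℝ} (hκ : Integrable κ) (hκ0 : ∀ ξ, 0 ≤ κ ξ)
    (hκ1 : ∫ ξ, κ ξ < 1) (hA : ∀ n, Continuous (A n)) (hA0 : ∀ n y, 0 ≤ A n y)
    (hAb : ∀ n, ∃ B, ∀ y, A n y ≤ B)
    (hle : ∀ n y, A n y ≤ h n y + ∫ ξ, κ ξ * A n (y - ξ)) {H : ℝ} (hH : ∀ n y, h n y ≤ H)
    (hh : ∀ y, Tendsto (fun n => h n y) l (𝓝 0)) (y : Space d) :
    Tendsto (fun n => A n y) l (𝓝 0) := by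
  set θ := ∫ ξ, κ ξ with hθ
  have hθ0 : 0 ≤ θ := integral_nonneg hκ0
  have h1θ : 0 < 1 - θ := by linarith
  have hint : ∀ n y, Integrable fun ξ => κ ξ * A n (y - ξ) := fun n y => by
    obtain ⟨B, hB⟩ := hAb n
    refine hκ.mul_bdd (c := B) ((hA n).comp (continuous_const.sub
      continuous_id)).aestronglyMeasurable (ae_of_all _ fun ξ => ?_)
    rw [Real.norm_of_nonneg (hA0 _ _)]
    exact hB _
  set K := H / (1 - θ) with hK
  -- Each supremum is finite, though with a bound depending on `n`. Absorbing `θ` times the supremum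
  -- into the left side makes the bound uniform.
  have hbound : ∀ n y, A n y ≤ K := by
    intro n
    obtain ⟨B, hB⟩ := hAb n
    have hbdd : BddAbove (Set.range (A n)) := ⟨B, by rintro _ ⟨y, rfl⟩; exact hB y⟩
    have hsup : (⨆ y, A n y) ≤ H + θ * ⨆ y, A n y := by
      refine ciSup_le fun y => (hle n y).trans (add_le_add (hH n y) ?_)
      rw [hθ, ← integral_mul_const]
      exact integral_mono (hint n y) (hκ.mul_const _) fun ξ =>
        mul_le_mul_of_nonneg_left (le_ciSup hbdd _) (hκ0 ξ)
    intro y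
    refine (le_ciSup hbdd y).trans ?_
    rw [hK, le_div_iff₀ h1θ]
    linarith
  have hK0 : ∀ [Nonempty ι], 0 ≤ K := fun {hι} => (hA0 hι.some 0).trans (hbound _ _)
  rcases isEmpty_or_nonempty ι with hι | hι
  · rw [Filter.filter_eq_bot_of_isEmpty l]
    exact tendsto_bot
  have hK0 : 0 ≤ K := hK0
  -- Bootstrap: once the excess over `θ^j K` tends to zero, its convolution does so by dominated
  -- convergence, and the inequality lowers the threshold to `θ^(j+1) K`.
  have step : ∀ j : ℕ, ∀ y, Tendsto (fun n => max (A n y - θ ^ j * K) 0) l (𝓝 0) := by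
    intro j
    induction j with
    | zero =>
      intro y
      refine tendsto_const_nhds.congr fun n => ?_
      rw [pow_zero, one_mul, max_eq_right (by linarith [hbound n y])]
    | succ j ih =>
      intro y
      have hm : ∀ n, Continuous fun ξ => max (A n (y - ξ) - θ ^ j * K) 0 := fun n =>
        (((hA n).comp (continuous_const.sub continuous_id)).sub continuous_const).max
          continuous_const
      have hmb : ∀ n ξ, ‖max (A n (y - ξ) - θ ^ j * K) 0‖ ≤ K := fun n ξ => by
        rw [Real.norm_of_nonneg (le_max_right _ _)]
        have : 0 ≤ θ ^ j * K := by positivity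
        exact max_le (by linarith [hbound n (y - ξ)]) hK0
      have hmi : ∀ n, Integrable fun ξ => κ ξ * max (A n (y - ξ) - θ ^ j * K) 0 := fun n =>
        hκ.mul_bdd (c := K) (hm n).aestronglyMeasurable (ae_of_all _ (hmb n))
      have hlim : Tendsto (fun n => ∫ ξ, κ ξ * max (A n (y - ξ) - θ ^ j * K) 0) l (𝓝 0) := by
        have := tendsto_integral_filter_of_dominated_convergence (μ := volume) (l := l)
          (F := fun n ξ => κ ξ * max (A n (y - ξ) - θ ^ j * K) 0) (f := fun _ => 0)
          (fun ξ => κ ξ * K) (Eventually.of_forall fun n => (hmi n).aestronglyMeasurable)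
          (Eventually.of_forall fun n => ae_of_all _ fun ξ => ?_) (hκ.mul_const _)
          (ae_of_all _ fun ξ => ?_)
        · simpa using this
        · rw [norm_mul, Real.norm_of_nonneg (hκ0 ξ)]
          exact mul_le_mul_of_nonneg_left (hmb n ξ) (hκ0 ξ)
        · simpa using (ih (y - ξ)).const_mul (κ ξ)
      have hsum := ((hh y).max (tendsto_const_nhds (x := (0 : ℝ)))).add hlim
      rw [max_self, add_zero] at hsum
      refine squeeze_zero (fun n => le_max_right _ _) (fun n => ?_) hsum
      have hnn : 0 ≤ ∫ ξ, κ ξ * max (A n (y - ξ) - θ ^ j * K) 0 :=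
        integral_nonneg fun ξ => mul_nonneg (hκ0 ξ) (le_max_right _ _)
      refine max_le ?_ (add_nonneg (le_max_right _ _) hnn)
      have h1 : ∫ ξ, κ ξ * A n (y - ξ) ≤
          θ * (θ ^ j * K) + ∫ ξ, κ ξ * max (A n (y - ξ) - θ ^ j * K) 0 := by
        rw [hθ, ← integral_mul_const, ← integral_add (hκ.mul_const _) (hmi n)]
        refine integral_mono (hint n y) ((hκ.mul_const _).add (hmi n)) fun ξ => ?_
        dsimp only [Pi.add_apply]
        rw [← mul_add]
        exact mul_le_mul_of_nonneg_left (by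
          have := le_max_left (A n (y - ξ) - θ ^ j * K) 0
          linarith) (hκ0 ξ)
      have h2 := le_max_left (h n y) 0
      have h3 := hle n y
      rw [pow_succ']
      linarith [mul_assoc θ (θ ^ j) K]
  rw [Metric.tendsto_nhds]
  intro ε hε
  have hpow : Tendsto (fun j : ℕ => θ ^ j * K) atTop (𝓝 0) := by
    simpa using (tendsto_pow_atTop_nhds_zero_of_lt_one hθ0 hκ1).mul_const K
  obtain ⟨j, hj⟩ := (hpow.eventually (gt_mem_nhds (half_pos hε))).exists
  filter_upwards [(step j y).eventually (gt_mem_nhds (half_pos hε))] with n hn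
  rw [dist_zero_right, Real.norm_of_nonneg (hA0 _ _)]
  have := le_max_left (A n y - θ ^ j * K) 0
  linarith

theorem continuous_fourier_of_integrable {f : Space d → ℂ} (hf : Integrable f) :
    Continuous (𝓕 f) :=
  VectorFourier.fourierIntegral_continuous Real.continuous_fourierChar continuous_inner hf

theorem norm_fourier_le (f : Space d → ℂ) (x : Space d) : ‖𝓕 f x‖ ≤ ∫ k, ‖f k‖ :=
  VectorFourier.norm_fourierIntegral_le_integral_norm _ _ _ _ _

theorem integrable_fourier_mul {f g : Space d → ℂ} (hf : Integrable f) (hg : Integrable g) :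
    Integrable fun k => 𝓕 f k * g k :=
  hg.bdd_mul (continuous_fourier_of_integrable hf).aestronglyMeasurable
    (ae_of_all _ (norm_fourier_le f))

/-- The convolution theorem, by Fubini for the Fourier integral; the transform of `f` itself need
not be integrable. -/
theorem fourierInv_fourier_mul {f g : Space d → ℂ} (hf : Integrable f) (hg : Integrable g)
    (y : Space d) : 𝓕⁻ (fun k => 𝓕 f k * g k) y = ∫ ξ, f ξ * 𝓕⁻ g (y - ξ) := by
  have hgy : Integrable fun k => Complex.exp (((2 * Real.pi * inner ℝ k y : ℝ) : ℂ) * Complex.I) *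
      g k := by
    refine hg.bdd_mul (c := 1) (by fun_prop) (ae_of_all _ fun k => ?_)
    rw [Complex.norm_exp_ofReal_mul_I]
  have h := VectorFourier.integral_fourierIntegral_smul_eq_flip (L := innerₗ (Space d))
    Real.continuous_fourierChar continuous_inner (μ := volume) (ν := volume) hf hgy
  simp only [smul_eq_mul, flip_innerₗ] at h
  rw [Real.fourierInv_eq']
  have e1 : ∀ k : Space d, Complex.exp (((2 * Real.pi * inner ℝ k y : ℝ) : ℂ) * Complex.I) •
      (𝓕 f k * g k) = 𝓕 f k *
        (Complex.exp (((2 * Real.pi * inner ℝ k y : ℝ) : ℂ) * Complex.I) * g k) := fun k => by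
    rw [smul_eq_mul]
    ring
  simp only [e1]
  refine h.trans ?_
  congr 1
  ext ξ
  congr 1
  change 𝓕 (fun k => Complex.exp (((2 * Real.pi * inner ℝ k y : ℝ) : ℂ) * Complex.I) * g k) ξ = _
  rw [Real.fourier_eq', Real.fourierInv_eq']
  congr 1
  ext k
  rw [smul_eq_mul, smul_eq_mul, ← mul_assoc, ← Complex.exp_add, inner_sub_right]
  congr 2
  push_cast
  ring

end Contraction

/-! ### A mean-zero weight on annuli -/

section Annulus

theorem setIntegral_annulus {f f' : Space d → ℂ} {r₁ r₂ : ℝ} (h : r₁ ≤ r₂)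
    (hf : IntegrableOn f' (Metric.ball (0 : Space d) r₂))
    (he : ∀ κ : Space d, r₁ ≤ ‖κ‖ → f κ = f' κ) :
    ∫ κ in Metric.ball (0 : Space d) r₂ \ Metric.ball 0 r₁, f κ =
      (∫ κ in Metric.ball (0 : Space d) r₂, f' κ) - ∫ κ in Metric.ball (0 : Space d) r₁, f' κ := by
  rw [← setIntegral_sdiff Metric.isOpen_ball.measurableSet hf (Metric.ball_subset_ball h)]
  refine setIntegral_congr_fun (Metric.isOpen_ball.measurableSet.diff
    Metric.isOpen_ball.measurableSet) fun κ hκ => he κ ?_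
  simpa using hκ.2

variable [NeZero d]

/-- The function `(κ₀² / |κ|² - 1 / d) / |κ|ᵈ`, which has mean zero over spheres. -/
def shellWeight (κ : Space d) : ℝ := (directionTensor 0 0 κ - (d : ℝ)⁻¹) * (‖κ‖ ^ d)⁻¹

theorem measurable_shellWeight : Measurable (shellWeight (d := d)) :=
  ((measurable_directionTensor 0 0).sub measurable_const).mul
    (measurable_norm.pow_const d).inv

theorem shellWeight_neg (κ : Space d) : shellWeight (-κ) = shellWeight κ := by
  simp [shellWeight, directionTensor]

theorem inv_dim_le_one : (d : ℝ)⁻¹ ≤ 1 :=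
  inv_le_one_of_one_le₀ (by exact_mod_cast NeZero.one_le)

theorem abs_shellWeight_le {κ : Space d} (hκ : 1 ≤ ‖κ‖) : |shellWeight κ| ≤ 2 := by
  have h2 : (‖κ‖ ^ d)⁻¹ ≤ 1 := inv_le_one_of_one_le₀ (one_le_pow₀ hκ)
  have h3 := abs_directionTensor_le 0 0 κ
  have h4 : |(d : ℝ)⁻¹| ≤ 1 := by rw [abs_of_nonneg (by positivity)]; exact inv_dim_le_one
  have h5 := (abs_sub (directionTensor 0 0 κ) (d : ℝ)⁻¹).trans (add_le_add h3 h4)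
  rw [shellWeight, abs_mul, abs_of_nonneg (inv_nonneg.2 (pow_nonneg (norm_nonneg κ) d))]
  calc _ ≤ ((1 : ℝ) + 1) * 1 := by gcongr
    _ = 2 := by norm_num

theorem directionTensor_zero_zero (κ : Space d) : directionTensor 0 0 κ = (κ 0 / ‖κ‖) ^ 2 := by
  rw [directionTensor, div_pow, sq (κ.ofLp 0)]

theorem integrableOn_ball_polar {h : ℝ × ℝ → ℝ} (hh : Continuous h) {g : ℝ → ℂ}
    (hg : Continuous g) (R : ℝ) :
    IntegrableOn (fun κ : Space d => (h (‖κ‖, κ 0 / ‖κ‖) : ℂ) * g ‖κ‖) (Metric.ball 0 R) := by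
  obtain ⟨B, hB⟩ := (isCompact_Icc.prod isCompact_Icc :
    IsCompact (Set.Icc (0 : ℝ) R ×ˢ Set.Icc (-1 : ℝ) 1)).exists_bound_of_continuousOn
      (f := fun p : ℝ × ℝ => (h p : ℂ) * g p.1) (by fun_prop)
  refine integrableOn_ball_of_bounded (B := B) ?_ fun κ hκ => hB (‖κ‖, κ 0 / ‖κ‖) ⟨⟨norm_nonneg _,
    (mem_ball_zero_iff.1 hκ).le⟩, ?_⟩
  · have h0 : Measurable fun κ : Space d => (‖κ‖, κ 0 / ‖κ‖) :=
      measurable_norm.prodMk ((by fun_prop : Measurable fun κ : Space d => κ 0).div measurable_norm)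
    exact (by fun_prop : Continuous fun p : ℝ × ℝ => (h p : ℂ) * g p.1).measurable.comp h0
  · rw [Set.mem_Icc, ← abs_le, abs_div, abs_norm]
    exact div_le_one_of_le₀ (PiLp.norm_apply_le κ 0) (norm_nonneg _)

/-- Replacing `k` by `max k r` removes the singularity at the origin without changing anything
outside radius `r`. The ball formulas for continuous data then apply, and an annulus is a difference
of two balls. -/
theorem continuous_inv_max_pow (n : ℕ) {r : ℝ} (hr : 0 < r) :
    Continuous fun k : ℝ => ((max k r ^ n)⁻¹ : ℝ) :=
  Continuous.inv₀ (by fun_prop) fun k => (pow_pos (hr.trans_le (le_max_right _ _)) n).ne'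

theorem intervalIntegral_sub_max {f : ℝ → ℂ} {r₁ r₂ : ℝ} (h : r₁ ≤ r₂) {F : ℝ → ℂ}
    (hF : Continuous F) (he : ∀ k ∈ Set.Icc r₁ r₂, F k = f k) :
    (∫ k in (0 : ℝ)..r₂, F k) - (∫ k in (0 : ℝ)..r₁, F k) = ∫ k in r₁..r₂, f k := by
  rw [intervalIntegral.integral_interval_sub_left (hF.intervalIntegrable _ _)
    (hF.intervalIntegrable _ _)]
  exact intervalIntegral.integral_congr fun k hk => he k (by rwa [Set.uIcc_of_le h] at hk)

theorem pow_pred_mul_inv_pow {k : ℝ} (hk : k ≠ 0) : k ^ (d - 1) * (k ^ d)⁻¹ = k⁻¹ := by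
  obtain ⟨n, rfl⟩ := Nat.exists_eq_succ_of_ne_zero (NeZero.ne d)
  rw [Nat.succ_sub_one, pow_succ, mul_inv, ← mul_assoc, mul_inv_cancel₀ (pow_ne_zero n hk), one_mul]

theorem continuous_axialIntegral (hd : d = 1 ∨ d = 2 ∨ d = 3) {h : ℝ × ℝ → ℝ}
    (hh : Continuous h) : Continuous fun k => axialIntegral d fun t => h (k, t) := by
  rcases hd with rfl | rfl | rfl
  · simp only [axialIntegral]
    fun_prop
  · simp only [axialIntegral]
    exact (intervalIntegral.continuous_parametric_intervalIntegral_of_continuous'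
      (by fun_prop) _ _).const_mul _
  · simp only [axialIntegral]
    exact (intervalIntegral.continuous_parametric_intervalIntegral_of_continuous'
      (by fun_prop) _ _).const_mul _

theorem setIntegral_annulus_polar (hd : d = 1 ∨ d = 2 ∨ d = 3) {h : ℝ × ℝ → ℝ}
    (hh : Continuous h) {g : ℝ → ℂ} (hg : Continuous g) {r₁ r₂ : ℝ} (h1 : 0 < r₁) (h2 : r₁ ≤ r₂) :
    ∫ κ in Metric.ball (0 : Space d) r₂ \ Metric.ball 0 r₁,
      (h (‖κ‖, κ 0 / ‖κ‖) : ℂ) * (g ‖κ‖ * ((‖κ‖ ^ d)⁻¹ : ℝ)) =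
      ∫ k in r₁..r₂, (axialIntegral d fun t => h (k, t)) * (g k * (k⁻¹ : ℝ)) := by
  have hm := continuous_inv_max_pow d h1
  have hg' : Continuous fun k : ℝ => g k * ((max k r₁ ^ d)⁻¹ : ℝ) := by fun_prop
  have hax := continuous_axialIntegral hd hh
  rw [setIntegral_annulus h2 (integrableOn_ball_polar hh hg' r₂)
    (fun κ hκ => by rw [max_eq_left hκ]), setIntegral_ball_polar hd hh hg' (h1.le.trans h2),
    setIntegral_ball_polar hd hh hg' h1.le]
  refine intervalIntegral_sub_max h2 (by fun_prop) fun k hk => ?_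
  rw [max_eq_left hk.1, ← pow_pred_mul_inv_pow (d := d) (h1.trans_le hk.1).ne']
  push_cast
  ring

theorem axialIntegral_sub (hd : d = 1 ∨ d = 2 ∨ d = 3) {f g : ℝ → ℝ} (hf : Continuous f)
    (hg : Continuous g) :
    axialIntegral d (fun t => f t - g t) = axialIntegral d f - axialIntegral d g := by
  rcases hd with rfl | rfl | rfl
  · simp only [axialIntegral]
    ring
  · simp only [axialIntegral]
    rw [intervalIntegral.integral_sub ((by fun_prop : Continuous _).intervalIntegrable _ _)
      ((by fun_prop : Continuous _).intervalIntegrable _ _), mul_sub]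
  · simp only [axialIntegral, mul_sub]
    rw [intervalIntegral.integral_sub ((by fun_prop : Continuous _).intervalIntegrable _ _)
      ((by fun_prop : Continuous _).intervalIntegrable _ _), mul_sub]

theorem axialIntegral_const_mul (hd : d = 1 ∨ d = 2 ∨ d = 3) (a : ℝ) (f : ℝ → ℝ) :
    axialIntegral d (fun t => a * f t) = a * axialIntegral d f := by
  rcases hd with rfl | rfl | rfl
  · simp only [axialIntegral]
    ring
  · simp only [axialIntegral]
    rw [intervalIntegral.integral_const_mul]
    ring
  · simp only [axialIntegral]
    rw [show (fun θ => Real.sin θ * (a * f (Real.cos θ))) =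
      fun θ => a * (Real.sin θ * f (Real.cos θ)) from funext fun θ => by ring,
      intervalIntegral.integral_const_mul]
    ring

theorem sphericalL_zero : sphericalL d 0 = (d : ℝ)⁻¹ * sphericalJ d 0 := by
  simp only [sphericalL, mul_zero, intervalIntegral.integral_mul_const, integral_pow]
  have h : ((d - 1 : ℕ) : ℝ) + 1 = d := by
    rw [Nat.cast_sub NeZero.one_le]
    simp
  rw [h, Nat.sub_add_cancel NeZero.one_le]
  simp [NeZero.ne d]

/-- At `z = 0` the kernels satisfy `L = J / d`, so the mean of `t²` over the sphere is `1 / d`. -/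
theorem axialIntegral_sq_sub (hd : d = 1 ∨ d = 2 ∨ d = 3) :
    axialIntegral d (fun t => t ^ 2 - (d : ℝ)⁻¹) = 0 := by
  have h1 := axialIntegral_cos_mul_sq hd 0
  have h2 : sphericalJ d 0 = axialIntegral d fun _ => 1 := by simp [sphericalJ]
  simp only [zero_mul, Real.cos_zero, one_mul, sphericalL_zero] at h1
  have h3 := axialIntegral_const_mul hd (d : ℝ)⁻¹ fun _ => 1
  rw [mul_one] at h3
  have hd0 : (d : ℝ) ≠ 0 := by exact_mod_cast NeZero.ne d
  rw [axialIntegral_sub hd (by fun_prop) continuous_const, h1, h3, ← h2]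
  field_simp
  ring

/-- Up to the area of the sphere this is the variance of `t²`. It is positive exactly because `t²`
is not constant on the sphere, which fails for `d = 1`; the tail of `Θ` is recovered by dividing by
it. -/
theorem axialIntegral_quartic_pos (hd : d = 2 ∨ d = 3) :
    0 < axialIntegral d (fun t => (t ^ 2 - (d : ℝ)⁻¹) * t ^ 2) := by
  rcases hd with rfl | rfl
  · have h : ∀ θ ∈ Set.uIcc 0 Real.pi, HasDerivAt (fun θ => Real.sin θ * Real.cos θ ^ 3 / 4 +
        θ / 8 + Real.sin θ * Real.cos θ / 8)
        ((Real.cos θ ^ 2 - ((2 : ℕ) : ℝ)⁻¹) * Real.cos θ ^ 2) θ := fun θ _ => by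
      have hs := Real.hasDerivAt_sin θ
      have hc := Real.hasDerivAt_cos θ
      refine ((((hs.mul (hc.pow 3)).div_const 4).add ((hasDerivAt_id θ).div_const 8)).add
        ((hs.mul hc).div_const 8)).congr_deriv ?_
      have := Real.sin_sq_add_cos_sq θ
      simp only [Pi.pow_apply]
      push_cast
      have e : Real.sin θ ^ 2 = 1 - Real.cos θ ^ 2 := by linarith
      ring_nf
      rw [e]
      ring
    have := intervalIntegral.integral_eq_sub_of_hasDerivAt h
      ((by fun_prop : Continuous _).intervalIntegrable _ _)
    simp only [axialIntegral, this, Real.sin_pi, Real.sin_zero]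
    have := Real.pi_pos
    simp
    positivity
  · have h : ∀ θ ∈ Set.uIcc 0 Real.pi, HasDerivAt (fun θ => Real.cos θ ^ 3 / 9 -
        Real.cos θ ^ 5 / 5)
        (Real.sin θ * ((Real.cos θ ^ 2 - ((3 : ℕ) : ℝ)⁻¹) * Real.cos θ ^ 2)) θ := fun θ _ => by
      have hc := Real.hasDerivAt_cos θ
      refine (((hc.pow 3).div_const 9).sub ((hc.pow 5).div_const 5)).congr_deriv ?_
      push_cast
      ring
    have := intervalIntegral.integral_eq_sub_of_hasDerivAt h
      ((by fun_prop : Continuous _).intervalIntegrable _ _)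
    simp only [axialIntegral, this, Real.cos_pi, Real.cos_zero]
    have := Real.pi_pos
    norm_num
    positivity

/-- The kernel of `u_B`, divided by `k`, is an exact derivative. This is why the transform of the
weight telescopes to boundary terms. -/
theorem hasDerivAt_sphericalL (hd : d = 1 ∨ d = 2 ∨ d = 3) (r : ℝ) {k : ℝ} (hk : k ≠ 0) :
    HasDerivAt (fun k => sphericalL d (k * r))
      ((sphericalJ d (k * r) - d * sphericalL d (k * r)) * k⁻¹) k := by
  have h1 := hasDerivAt_pow_mul_sphericalL hd r k
  have h2 := (hasDerivAt_pow d k).inv (pow_ne_zero d hk)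
  have h3 := h1.mul h2
  refine (h3.congr_of_eventuallyEq ?_).congr_deriv ?_
  · filter_upwards [isOpen_ne.mem_nhds hk] with q hq
    simp only [Pi.mul_apply, Pi.inv_apply]
    rw [mul_right_comm, mul_inv_cancel₀ (pow_ne_zero d hq), one_mul]
  · rw [← pow_pred_mul_inv_pow (d := d) hk]
    simp only [Pi.inv_apply]
    have := pow_ne_zero d hk
    field_simp
    ring

/-- Subtracting `1/d` of the radial transform from the tensor transform leaves `y₀²/|y|² - 1/d`
times the integral of `(J - d L)/k`, a difference of values of `L`. At `y = 0` the vanishing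
spherical mean replaces this computation. -/
theorem setIntegral_annulus_cos_shellWeight (hd : d = 1 ∨ d = 2 ∨ d = 3) {r₁ r₂ : ℝ}
    (h1 : 0 < r₁) (h2 : r₁ ≤ r₂) (y : Space d) :
    ∫ κ in Metric.ball (0 : Space d) r₂ \ Metric.ball 0 r₁,
      (Real.cos (inner ℝ y κ) : ℂ) * (shellWeight κ : ℂ) =
      (((directionTensor 0 0 y - (d : ℝ)⁻¹) *
        (sphericalL d (r₂ * ‖y‖) - sphericalL d (r₁ * ‖y‖)) : ℝ) : ℂ) := by
  by_cases hy : y = 0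
  · have h := setIntegral_annulus_polar hd (h := fun p => p.2 ^ 2 - (d : ℝ)⁻¹) (by fun_prop)
      (g := fun _ => 1) continuous_const h1 h2
    simp only [axialIntegral_sq_sub hd, Complex.ofReal_zero, zero_mul,
      intervalIntegral.integral_zero] at h
    rw [hy, norm_zero, mul_zero, mul_zero, sub_self, mul_zero, Complex.ofReal_zero, ← h]
    congr 1
    ext κ
    rw [inner_zero_left, Real.cos_zero, shellWeight, directionTensor_zero_zero]
    push_cast
    ring
  · have hJ := continuous_sphericalJ hd
    have hL := continuous_sphericalL hd
    have hm := continuous_inv_max_pow d h1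
    set g : ℝ → ℂ := fun k => ((max k r₁ ^ d)⁻¹ : ℝ) with hg
    have hgc : Continuous g := by fun_prop
    have hi1 : ∀ R : ℝ, IntegrableOn (fun κ : Space d => (Real.cos (inner ℝ y κ) : ℂ) *
        ((directionTensor 0 0 κ : ℂ) * g ‖κ‖)) (Metric.ball 0 R) := fun R =>
      integrableOn_ball_cos_tensor hgc R y 0 0
    have hi2 : ∀ R : ℝ, IntegrableOn (fun κ : Space d => (Real.cos (inner ℝ y κ) : ℂ) * g ‖κ‖)
        (Metric.ball 0 R) := fun R =>
      ((by fun_prop : Continuous fun κ : Space d => (Real.cos (inner ℝ y κ) : ℂ) *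
        g ‖κ‖).continuousOn.integrableOn_compact (isCompact_closedBall 0 R)).mono_set
        Metric.ball_subset_closedBall
    have hball : ∀ R : ℝ, 0 ≤ R → ∫ κ in Metric.ball (0 : Space d) R,
        ((Real.cos (inner ℝ y κ) : ℂ) * ((directionTensor 0 0 κ : ℂ) * g ‖κ‖) -
          (d : ℂ)⁻¹ * ((Real.cos (inner ℝ y κ) : ℂ) * g ‖κ‖)) =
        ((directionTensor 0 0 y - (d : ℝ)⁻¹ : ℝ) : ℂ) * ∫ k in (0 : ℝ)..R, (k : ℂ) ^ (d - 1) *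
          (((sphericalJ d (k * ‖y‖) : ℂ) - d * (sphericalL d (k * ‖y‖) : ℂ)) * g k) := by
      intro R hR
      rw [integral_sub (hi1 R) ((hi2 R).const_mul _), integral_const_mul,
        setIntegral_ball_cos_tensor hd hgc hR hy, setIntegral_ball_cos_radial hd hgc hR, if_pos rfl,
        one_mul]
      have hd0 : (d : ℂ) ≠ 0 := by exact_mod_cast NeZero.ne d
      have e : ∫ k in (0 : ℝ)..R, (k : ℂ) ^ (d - 1) * ((sphericalL d (k * ‖y‖) : ℂ) * g k) =
          (d : ℂ)⁻¹ * ((∫ k in (0 : ℝ)..R, (k : ℂ) ^ (d - 1) *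
            ((sphericalJ d (k * ‖y‖) : ℂ) * g k)) - ∫ k in (0 : ℝ)..R, (k : ℂ) ^ (d - 1) *
          (((sphericalJ d (k * ‖y‖) : ℂ) - d * (sphericalL d (k * ‖y‖) : ℂ)) * g k)) := by
        rw [← intervalIntegral.integral_sub ((by fun_prop : Continuous _).intervalIntegrable _ _)
          ((by fun_prop : Continuous _).intervalIntegrable _ _),
          ← intervalIntegral.integral_const_mul]
        congr 1
        ext k
        field_simp
        ring
      rw [e]
      push_cast
      ring
    have hFTC : ∫ k in r₁..r₂, (sphericalJ d (k * ‖y‖) - d * sphericalL d (k * ‖y‖)) * k⁻¹ =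
        sphericalL d (r₂ * ‖y‖) - sphericalL d (r₁ * ‖y‖) := by
      refine intervalIntegral.integral_eq_sub_of_hasDerivAt
        (f := fun k => sphericalL d (k * ‖y‖)) (fun k hk => ?_) ?_
      · rw [Set.uIcc_of_le h2] at hk
        exact hasDerivAt_sphericalL hd _ (h1.trans_le hk.1).ne'
      · refine ContinuousOn.intervalIntegrable (ContinuousOn.mul
          (by fun_prop : Continuous _).continuousOn (continuousOn_inv₀.mono fun k hk => ?_))
        rw [Set.uIcc_of_le h2] at hk
        exact (h1.trans_le hk.1).ne'
    rw [setIntegral_annulus h2 (f' := fun κ => (Real.cos (inner ℝ y κ) : ℂ) *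
      ((directionTensor 0 0 κ : ℂ) * g ‖κ‖) - (d : ℂ)⁻¹ * ((Real.cos (inner ℝ y κ) : ℂ) * g ‖κ‖))
      ((hi1 r₂).sub ((hi2 r₂).const_mul _)) (fun κ hκ => by
        rw [hg, shellWeight]
        dsimp only
        rw [max_eq_left hκ]
        push_cast
        ring), hball r₂ (h1.le.trans h2), hball r₁ h1.le, ← mul_sub,
      intervalIntegral_sub_max h2 (f := fun k => (((sphericalJ d (k * ‖y‖) -
        d * sphericalL d (k * ‖y‖)) * k⁻¹ : ℝ) : ℂ)) (by fun_prop) (fun k hk => by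
        rw [hg, ← pow_pred_mul_inv_pow (d := d) (h1.trans_le hk.1).ne']
        dsimp only
        rw [max_eq_left hk.1]
        push_cast
        ring), intervalIntegral.integral_ofReal, hFTC, ← Complex.ofReal_mul]

/-- The isotropic part `Q` is annihilated by the mean-zero weight, so only the anisotropic part `P -
Q` is seen. -/
theorem setIntegral_annulus_shellWeight_mul (hd : d = 1 ∨ d = 2 ∨ d = 3) {P Q : ℝ → ℂ}
    (hP : Continuous P) (hQ : Continuous Q) {r₁ r₂ : ℝ} (h1 : 0 < r₁) (h2 : r₁ ≤ r₂) :
    ∫ κ in Metric.ball (0 : Space d) r₂ \ Metric.ball 0 r₁, (shellWeight κ : ℂ) *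
        (Q ‖κ‖ + (directionTensor 0 0 κ : ℂ) * (P ‖κ‖ - Q ‖κ‖)) =
      (axialIntegral d (fun t => (t ^ 2 - (d : ℝ)⁻¹) * t ^ 2) : ℂ) *
        ∫ k in r₁..r₂, (P k - Q k) * (k⁻¹ : ℝ) := by
  have hm := continuous_inv_max_pow d h1
  have hi : ∀ {h : ℝ × ℝ → ℝ} {g : ℝ → ℂ}, Continuous h → Continuous g →
      IntegrableOn (fun κ : Space d => (h (‖κ‖, κ 0 / ‖κ‖) : ℂ) * (g ‖κ‖ * ((‖κ‖ ^ d)⁻¹ : ℝ)))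
        (Metric.ball (0 : Space d) r₂ \ Metric.ball 0 r₁) := by
    intro h g hh hg
    refine ((integrableOn_ball_polar hh (g := fun k => g k * ((max k r₁ ^ d)⁻¹ : ℝ))
      (by fun_prop) r₂).mono_set Set.sdiff_subset).congr_fun (fun κ hκ => ?_)
      (Metric.isOpen_ball.measurableSet.diff Metric.isOpen_ball.measurableSet)
    dsimp only
    rw [max_eq_left (by simpa using hκ.2)]
  have hA : Continuous fun p : ℝ × ℝ => p.2 ^ 2 - (d : ℝ)⁻¹ := by fun_prop
  have hB : Continuous fun p : ℝ × ℝ => (p.2 ^ 2 - (d : ℝ)⁻¹) * p.2 ^ 2 := by fun_prop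
  have e1 := setIntegral_annulus_polar hd hA hQ h1 h2
  have e2 := setIntegral_annulus_polar hd hB (hP.sub hQ) h1 h2
  simp only [axialIntegral_sq_sub hd, Complex.ofReal_zero, zero_mul,
    intervalIntegral.integral_zero] at e1
  simp only [intervalIntegral.integral_const_mul, Pi.sub_apply] at e2
  have e3 := integral_add (hi hA hQ) (hi hB (hP.sub hQ))
  simp only [Pi.sub_apply] at e3
  rw [e1, e2, zero_add] at e3
  rw [← e3]
  congr 1
  ext κ
  rw [shellWeight, directionTensor_zero_zero]
  push_cast
  ring

end Annulus

/-! ### Linear systems of convolution equations -/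

section NeumannSystem

theorem fourier_add_of_integrable {f g : Space d → ℂ} (hf : Integrable f) (hg : Integrable g) :
    𝓕 (fun k => f k + g k) = 𝓕 f + 𝓕 g :=
  VectorFourier.fourierIntegral_add Real.continuous_fourierChar continuous_inner hf hg

theorem fourierInv_add_of_integrable {f g : Space d → ℂ} (hf : Integrable f) (hg : Integrable g)
    (y : Space d) : 𝓕⁻ (fun k => f k + g k) y = 𝓕⁻ f y + 𝓕⁻ g y := by
  simp only [Real.fourierInv_eq_fourier_neg, fourier_add_of_integrable hf hg, Pi.add_apply]

theorem fourierInv_const_mul (a : ℂ) (f : Space d → ℂ) (y : Space d) :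
    𝓕⁻ (fun k => a * f k) y = a * 𝓕⁻ f y := by
  simp only [Real.fourierInv_eq, smul_eq_mul, Circle.smul_def, ← integral_const_mul]
  congr 1
  ext k
  ring

theorem fourierInv_sum_of_integrable {ι : Type*} (s : Finset ι) {f : ι → Space d → ℂ}
    (hf : ∀ i, Integrable (f i)) (y : Space d) :
    𝓕⁻ (fun k => ∑ i ∈ s, f i k) y = ∑ i ∈ s, 𝓕⁻ (f i) y := by
  classical
  induction s using Finset.induction_on with
  | empty => simp [Real.fourierInv_eq]
  | insert a s ha ih =>
    simp only [Finset.sum_insert ha]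
    rw [fourierInv_add_of_integrable (hf a) (integrable_finsetSum _ fun i _ => hf i), ih]

theorem tendsto_integral_norm_schwartz_mul {ι : Type*} {l : Filter ι} [l.IsCountablyGenerated]
    (φ : 𝓢(Space d, ℂ)) {F : ι → Space d → ℂ} (hF : ∀ n, AEStronglyMeasurable (F n)) {B : ℝ}
    (hFb : ∀ n k, ‖F n k‖ ≤ B) (hF0 : ∀ k, Tendsto (fun n => F n k) l (𝓝 0)) :
    (∀ n, ∫ k, ‖φ k * F n k‖ ≤ B * ∫ k, ‖φ k‖) ∧
      Tendsto (fun n => ∫ k, ‖φ k * F n k‖) l (𝓝 0) := by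
  have hle : ∀ n k, ‖φ k * F n k‖ ≤ B * ‖φ k‖ := fun n k => by
    rw [norm_mul, mul_comm]
    exact mul_le_mul_of_nonneg_right (hFb n k) (norm_nonneg _)
  have hm : ∀ n, AEStronglyMeasurable (fun k => φ k * F n k) := fun n =>
    φ.continuous.aestronglyMeasurable.mul (hF n)
  have hi : Integrable fun k => B * ‖φ k‖ := φ.integrable.norm.const_mul _
  constructor
  · intro n
    rw [← integral_const_mul]
    exact integral_mono (hi.mono' (hm n) (ae_of_all _ (hle n))).norm hi (hle n)
  · have := tendsto_integral_filter_of_dominated_convergence (μ := volume) (l := l)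
      (F := fun n k => ‖φ k * F n k‖) (f := fun _ => 0) (fun k => B * ‖φ k‖)
      (Eventually.of_forall fun n => (hm n).norm)
      (Eventually.of_forall fun n => ae_of_all _ fun k => by
        rw [norm_norm]
        exact hle n k) hi
      (ae_of_all _ fun k => by simpa using ((hF0 k).const_mul (φ k)).norm)
    simpa using this

theorem fourierInv_mul_eq_of_system {σ : Type*} [Fintype σ] {F : Space d → ℂ} (hF : Integrable F)
    {ψ : σ → Space d → ℂ} (hψ : ∀ j, Integrable (ψ j)) (φ : σ → 𝓢(Space d, ℂ))
    {N : σ → Space d → ℂ} (hFN : ∀ j, Integrable fun k => F k * N j k) {M : Space d → ℂ} {e : ℂ}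
    (hM : ∀ k, M k = e + ∑ j, (𝓕 (ψ j) k + (𝓕 (φ j)) k) * N j k) (y : Space d) :
    𝓕⁻ (fun k => F k * M k) y = e * 𝓕⁻ F y +
      ∑ j, ((∫ ξ, ψ j ξ * 𝓕⁻ (fun k => F k * N j k) (y - ξ)) +
        𝓕⁻ (fun k => (𝓕 (φ j)) k * (F k * N j k)) y) := by
  have h1 : (fun k => F k * M k) = fun k => e * F k +
      ∑ j, (𝓕 (ψ j) k * (F k * N j k) + (𝓕 (φ j)) k * (F k * N j k)) := by
    ext k
    rw [hM k, mul_add, Finset.mul_sum, mul_comm (F k)]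
    congr 1
    refine Finset.sum_congr rfl fun j _ => ?_
    ring
  have h2 := fun j => integrable_fourier_mul (hψ j) (hFN j)
  have h3 : ∀ j, Integrable fun k => (𝓕 (φ j)) k * (F k * N j k) := fun j => by
    rw [SchwartzMap.fourier_coe]
    exact integrable_fourier_mul (φ j).integrable (hFN j)
  have h4 : ∀ j, Integrable fun k => 𝓕 (ψ j) k * (F k * N j k) + (𝓕 (φ j)) k * (F k * N j k) :=
    fun j => (h2 j).add (h3 j)
  rw [h1, fourierInv_add_of_integrable (hF.const_mul _) (integrable_finsetSum _ fun j _ => h4 j),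
    fourierInv_const_mul, fourierInv_sum_of_integrable _ h4]
  congr 1
  refine Finset.sum_congr rfl fun j _ => ?_
  rw [fourierInv_add_of_integrable (h2 j) (h3 j), fourierInv_fourier_mul (hψ j) (hFN j)]

/-- If bounded symbols `N` solve a linear system whose coefficients are constants plus Fourier
transforms of integrable functions, then the transforms of cutoffs of `N` vanish in the limit
as soon as those of the cutoffs themselves do. -/
theorem tendsto_fourierInv_cutoff_mul {ι σ : Type*} [Fintype σ] {l : Filter ι}
    [l.IsCountablyGenerated] {F : ι → Space d → ℂ} (hF : ∀ n, Integrable (F n)) {B : ℝ}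
    (hFb : ∀ n k, ‖F n k‖ ≤ B) (hF0 : ∀ k, Tendsto (fun n => F n k) l (𝓝 0)) {H : ℝ}
    (hGb : ∀ n y, ‖𝓕⁻ (F n) y‖ ≤ H) (hG : ∀ y, Tendsto (fun n => 𝓕⁻ (F n) y) l (𝓝 0))
    {K : σ → σ → Space d → ℂ} (hK : ∀ i j, Integrable (K i j)) {N : σ → Space d → ℂ}
    (hNm : ∀ i, Measurable (N i)) {B' : ℝ} (hNb : ∀ i k, ‖N i k‖ ≤ B') {e : σ → ℂ}
    (hN : ∀ i k, N i k = e i + ∑ j, 𝓕 (K i j) k * N j k) (i : σ) (y : Space d) :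
    Tendsto (fun n => 𝓕⁻ (fun k => F n k * N i k) y) l (𝓝 0) := by
  classical
  have hFN : ∀ n i, Integrable fun k => F n k * N i k := fun n i =>
    (hF n).mul_bdd (hNm i).aestronglyMeasurable (ae_of_all _ (hNb i))
  -- There are `(card σ)²` kernels. With this choice their remainders after Schwartz approximation
  -- have total mass less than one.
  set ε : ℝ := ((Fintype.card σ : ℝ) ^ 2 + 1)⁻¹ / 2 with hε
  have hε0 : 0 < ε := by positivity
  choose φ hφ using fun i j => exists_schwartz_integral_sub_le (hK i j) hε0
  set ψ : σ → σ → Space d → ℂ := fun i j x => K i j x - φ i j x with hψ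
  have hψi : ∀ i j, Integrable (ψ i j) := fun i j => (hK i j).sub (φ i j).integrable
  have hKsplit : ∀ i j k, 𝓕 (K i j) k = 𝓕 (ψ i j) k + (𝓕 (φ i j)) k := fun i j k => by
    rw [SchwartzMap.fourier_coe]
    have := congrFun (fourier_add_of_integrable (hψi i j) (φ i j).integrable) k
    simp only [hψ, sub_add_cancel] at this
    exact this
  set a : ι → σ → Space d → ℂ := fun n i y => 𝓕⁻ (fun k => F n k * N i k) y with ha
  set rem : ι → σ → σ → ℝ := fun n i j => ∫ k, ‖(𝓕 (φ i j)) k * (F n k * N j k)‖ with hrem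
  have hac : ∀ n i, Continuous (a n i) := fun n i => continuous_fourierInv_of_integrable (hFN n i)
  have hab : ∀ n i y, ‖a n i y‖ ≤ ∫ k, ‖F n k * N i k‖ := fun n i y => norm_fourierInv_le _ y
  have hai : ∀ n i j y, Integrable fun ξ => ‖ψ i j ξ‖ * ‖a n j (y - ξ)‖ := fun n i j y =>
    (hψi i j).norm.mul_bdd ((hac n j).comp (continuous_const.sub
      continuous_id)).norm.aestronglyMeasurable (ae_of_all _ fun ξ => by
        rw [norm_norm]
        exact hab n j _)
  have hid : ∀ n i y, a n i y = e i * 𝓕⁻ (F n) y +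
      ∑ j, ((∫ ξ, ψ i j ξ * a n j (y - ξ)) +
        𝓕⁻ (fun k => (𝓕 (φ i j)) k * (F n k * N j k)) y) :=
    fun n i y => fourierInv_mul_eq_of_system (hF n) (hψi i) (φ i) (hFN n)
      (fun k => by simp only [hN i k, hKsplit]) y
  -- The Schwartz parts give a remainder bounded in `L¹` independently of `y`; it vanishes since the
  -- cutoffs are bounded and tend to zero pointwise.
  have hremle := fun i j => tendsto_integral_norm_schwartz_mul (l := l) (𝓕 (φ i j))
    (B := B * B') (fun n => (hFN n j).aestronglyMeasurable) (fun n k => by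
      rw [norm_mul]
      exact mul_le_mul (hFb n k) (hNb j k) (norm_nonneg _) ((norm_nonneg _).trans (hFb n k)))
    (fun k => by simpa using (hF0 k).mul_const (N j k))
  -- The contraction is applied to the sum over all components, because the system couples them.
  have key := tendsto_zero_of_le_add_convolution (l := l) (A := fun n y => ∑ i, ‖a n i y‖)
    (h := fun n y => ∑ i, (‖e i‖ * ‖𝓕⁻ (F n) y‖ + ∑ j, rem n i j))
    (κ := fun ξ => ∑ i, ∑ j, ‖ψ i j ξ‖)
    (H := ∑ i, (‖e i‖ * H + ∑ j, B * B' * ∫ k, ‖(𝓕 (φ i j)) k‖))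
    (integrable_finsetSum _ fun i _ => integrable_finsetSum _ fun j _ => (hψi i j).norm)
    (fun ξ => Finset.sum_nonneg fun i _ => Finset.sum_nonneg fun j _ => norm_nonneg _) ?_
    (fun n => continuous_finsetSum _ fun i _ => (hac n i).norm)
    (fun n y => Finset.sum_nonneg fun i _ => norm_nonneg _)
    (fun n => ⟨∑ i, ∫ k, ‖F n k * N i k‖, fun y => Finset.sum_le_sum fun i _ => hab n i y⟩)
    (fun n y => ?_) (fun n y => ?_) (fun y => ?_) y
  · refine squeeze_zero_norm (fun n => ?_) key
    exact Finset.single_le_sum (f := fun i => ‖a n i y‖) (fun i _ => norm_nonneg _)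
      (Finset.mem_univ i)
  · rw [integral_finsetSum _ fun i _ => integrable_finsetSum _ fun j _ => (hψi i j).norm]
    simp only [integral_finsetSum Finset.univ fun j _ => (hψi _ j).norm]
    calc ∑ i, ∑ j, ∫ ξ, ‖ψ i j ξ‖ ≤ ∑ i : σ, ∑ j : σ, ε :=
          Finset.sum_le_sum fun i _ => Finset.sum_le_sum fun j _ => hφ i j
      _ = (Fintype.card σ : ℝ) ^ 2 * ε := by
          simp only [Finset.sum_const, Finset.card_univ, nsmul_eq_mul]
          ring
      _ < 1 := by
          rw [hε, mul_div_assoc', ← div_eq_mul_inv, div_div, div_lt_one (by positivity)]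
          nlinarith [sq_nonneg (Fintype.card σ : ℝ)]
  · have hint : ∀ i j, Integrable fun ξ => ‖ψ i j ξ‖ * ∑ p, ‖a n p (y - ξ)‖ := fun i j => by
      simp only [Finset.mul_sum]
      refine integrable_finsetSum _ fun p _ => (hψi i j).norm.mul_bdd (c := ∫ k, ‖F n k * N p k‖)
        ((hac n p).comp (continuous_const.sub continuous_id)).norm.aestronglyMeasurable
        (ae_of_all _ fun ξ => ?_)
      rw [norm_norm]
      exact hab n p _
    have e2 : ∫ ξ, (∑ i, ∑ j, ‖ψ i j ξ‖) * ∑ p, ‖a n p (y - ξ)‖ =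
        ∑ i, ∑ j, ∫ ξ, ‖ψ i j ξ‖ * ∑ p, ‖a n p (y - ξ)‖ := by
      simp only [Finset.sum_mul]
      rw [integral_finsetSum _ fun i _ => integrable_finsetSum _ fun j _ => hint i j]
      simp only [integral_finsetSum Finset.univ fun j _ => hint _ j]
    rw [e2, ← Finset.sum_add_distrib]
    refine Finset.sum_le_sum fun i _ => ?_
    rw [hid, add_assoc, ← Finset.sum_add_distrib]
    refine (norm_add_le _ _).trans (add_le_add (norm_mul_le _ _) ((norm_sum_le _ _).trans
      (Finset.sum_le_sum fun j _ => (norm_add_le _ _).trans ?_)))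
    rw [add_comm]
    refine add_le_add (norm_fourierInv_le _ y) ((norm_integral_le_integral_norm _).trans ?_)
    simp only [norm_mul]
    refine integral_mono (hai n i j y) (hint i j) fun ξ => ?_
    exact mul_le_mul_of_nonneg_left (Finset.single_le_sum (f := fun p => ‖a n p (y - ξ)‖)
      (fun p _ => norm_nonneg _) (Finset.mem_univ j)) (norm_nonneg _)
  · exact Finset.sum_le_sum fun i _ => add_le_add (mul_le_mul_of_nonneg_left (hGb n y)
      (norm_nonneg _)) (Finset.sum_le_sum fun j _ => (hremle i j).1 n)
  · have : Tendsto (fun n => ∑ i, (‖e i‖ * ‖𝓕⁻ (F n) y‖ + ∑ j, rem n i j)) l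
        (𝓝 (∑ i : σ, (‖e i‖ * ‖(0 : ℂ)‖ + ∑ _j : σ, (0 : ℝ)))) :=
      tendsto_finsetSum _ fun i _ => ((hG y).norm.const_mul _).add
        (tendsto_finsetSum _ fun j _ => (hremle i j).2)
    simpa using this

end NeumannSystem

/-! ### Conditional convergence of `∫ (P - Q)/k` -/

section TailConvergence

theorem fourier_const_mul (a : ℂ) (f : Space d → ℂ) (k : Space d) :
    𝓕 (fun x => a * f x) k = a * 𝓕 f k := by
  simp only [Real.fourier_eq, smul_eq_mul, Circle.smul_def, ← integral_const_mul]
  congr 1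
  ext x
  ring

variable [NeZero d] {C : Space d → Matrix (Fin d) (Fin d) ℝ} {ρ : ℝ} {s : ℂ}

theorem integral_modulus_nonneg (hC : IsRadialTensor C) (hint : ∀ i j, Integrable fun ξ => C ξ i j)
    (hM : ∀ κ, (stiffness C κ).PosSemidef) : 0 ≤ ∫ ξ, C ξ 0 0 :=
  ge_of_tendsto (tendsto_tensile hC hint) (Eventually.of_forall fun k => tensile_nonneg hM k)

theorem dynamic_ne_zero (hρ : 0 < ρ) (hs : s ^ 2 ∈ Complex.slitPlane) {m : ℝ} (hm : 0 ≤ m) :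
    (ρ : ℂ) * s ^ 2 + (m : ℂ) ≠ 0 := by
  obtain ⟨δ, hδ, h⟩ := exists_pos_le_norm_dynamic hρ hs
  exact norm_pos_iff.1 (hδ.trans_le (h m hm))

/-- The resolvent identity: a difference of reciprocals is the product of the two bounded
reciprocals with the difference of the stiffnesses. -/
theorem exists_norm_compliance_sub_le (hρ : 0 < ρ) (hs : s ^ 2 ∈ Complex.slitPlane) :
    ∃ B, 0 ≤ B ∧ ∀ m m' : ℝ, 0 ≤ m → 0 ≤ m' →
      ‖compliance ρ s m - compliance ρ s m'‖ ≤ B * |m - m'| := by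
  obtain ⟨B, hB⟩ := exists_norm_compliance_le hρ hs
  refine ⟨B * B, mul_self_nonneg B, fun m m' hm hm' => ?_⟩
  have e : compliance ρ s m - compliance ρ s m' =
      compliance ρ s m * compliance ρ s m' * ((m' - m : ℝ) : ℂ) := by
    have h1 := dynamic_ne_zero hρ hs hm
    have h2 := dynamic_ne_zero hρ hs hm'
    simp only [compliance]
    push_cast
    field_simp
    ring
  rw [e, norm_mul, norm_mul, Complex.norm_real, Real.norm_eq_abs, abs_sub_comm]
  have h0 : 0 ≤ B := (norm_nonneg _).trans (hB m hm)
  gcongr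
  · exact hB m hm
  · exact hB m' hm'

/-- The matrix `ρ s² I + M` is the invertible scalar `ρ s² + M(∞)` minus the Fourier transform of
`C`; dividing its product with the inverse by that scalar gives the fixed-point form. -/
theorem greenSymbol_eq_system (hρ : 0 < ρ) (hs : s ^ 2 ∈ Complex.slitPlane)
    (hC : IsRadialTensor C) (hint : ∀ i j, Integrable fun ξ => C ξ i j)
    (hM : ∀ κ, (stiffness C κ).PosSemidef) (i j : Fin d) (k : Space d) :
    greenSymbol C ρ s ((2 * Real.pi) • k) i j =
      compliance ρ s (∫ ξ, C ξ 0 0) * (if i = j then 1 else 0) +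
      ∑ l, 𝓕 (fun ξ => compliance ρ s (∫ ξ, C ξ 0 0) * (C ξ i l : ℂ)) k *
        greenSymbol C ρ s ((2 * Real.pi) • k) l j := by
  have h := congrFun (congrFun (dynamicStiffness_mul_greenSymbol hρ hs hC hint hM
    ((2 * Real.pi) • k)) i) j
  have hne := dynamic_ne_zero hρ hs (integral_modulus_nonneg hC hint hM)
  have e : ∀ l, dynamicStiffness C ρ s ((2 * Real.pi) • k) i l =
      ((ρ : ℂ) * s ^ 2 + ((∫ ξ, C ξ 0 0 : ℝ) : ℂ)) * (if i = l then 1 else 0) -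
        𝓕 (fun ξ => (C ξ i l : ℂ)) k := fun l => by
    rw [dynamicStiffness, Matrix.add_apply, Matrix.smul_apply, Matrix.map_apply,
      stiffness_eq_fourier hC hint, integral_modulus hC hint, Matrix.one_apply]
    by_cases hil : i = l
    · simp [hil]
      ring
    · simp [hil]
  rw [Matrix.mul_apply, Matrix.one_apply] at h
  simp only [e, sub_mul, Finset.sum_sub_distrib, mul_assoc, ite_mul, one_mul, zero_mul] at h
  rw [← Finset.mul_sum, Finset.sum_ite_eq, if_pos (Finset.mem_univ i), sub_eq_iff_eq_add] at h
  simp only [fourier_const_mul, mul_assoc, ← Finset.mul_sum]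
  rw [← mul_add, ← h, compliance]
  field_simp

theorem greenSymbol_neg (κ : Space d) : greenSymbol C ρ s (-κ) = greenSymbol C ρ s κ := by
  ext i j
  simp [greenSymbol, directionTensor]

theorem measurable_greenSymbol (hρ : 0 < ρ) (hs : s ^ 2 ∈ Complex.slitPlane)
    (hint : ∀ i j, Integrable fun ξ => C ξ i j)
    (hM : ∀ κ, (stiffness C κ).PosSemidef) (i j : Fin d) :
    Measurable fun κ => greenSymbol C ρ s κ i j := by
  have h1 := (continuous_compliance hρ hs (continuous_shear hint)
    (shear_nonneg hM)).measurable.comp (measurable_norm (α := Space d))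
  have h2 := (continuous_compliance hρ hs (continuous_tensile hint)
    (tensile_nonneg hM)).measurable.comp (measurable_norm (α := Space d))
  exact (measurable_const.mul h1).add
    ((Complex.measurable_ofReal.comp (measurable_directionTensor i j)).mul (h2.sub h1))

/-- The function `shellWeight` restricted to an annulus, as a function of the wave vector. -/
def shellCutoff (r₁ r₂ : ℝ) (k : Space d) : ℂ :=
  (Metric.ball (0 : Space d) r₂).indicator
    ((Metric.ball (0 : Space d) r₁)ᶜ.indicator fun κ => (shellWeight κ : ℂ)) ((2 * Real.pi) • k)

theorem norm_indicator_shellWeight_le {r₁ : ℝ} (h1 : 1 ≤ r₁) (κ : Space d) :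
    ‖(Metric.ball (0 : Space d) r₁)ᶜ.indicator (fun κ => (shellWeight κ : ℂ)) κ‖ ≤ 2 := by
  by_cases hκ : κ ∈ (Metric.ball (0 : Space d) r₁)ᶜ
  · rw [Set.indicator_of_mem hκ, Complex.norm_real]
    exact abs_shellWeight_le (h1.trans (by simpa using hκ))
  · rw [Set.indicator_of_notMem hκ, norm_zero]
    exact zero_le_two

theorem measurable_indicator_shellWeight (r₁ : ℝ) : Measurable
    ((Metric.ball (0 : Space d) r₁)ᶜ.indicator fun κ => (shellWeight κ : ℂ)) :=
  (Complex.measurable_ofReal.comp measurable_shellWeight).indicator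
    Metric.isOpen_ball.measurableSet.compl

theorem indicator_shellWeight_neg (r₁ : ℝ) (κ : Space d) :
    (Metric.ball (0 : Space d) r₁)ᶜ.indicator (fun κ => (shellWeight κ : ℂ)) (-κ) =
      (Metric.ball (0 : Space d) r₁)ᶜ.indicator (fun κ => (shellWeight κ : ℂ)) κ := by
  have : -κ ∈ (Metric.ball (0 : Space d) r₁)ᶜ ↔ κ ∈ (Metric.ball (0 : Space d) r₁)ᶜ := by simp
  by_cases hκ : κ ∈ (Metric.ball (0 : Space d) r₁)ᶜ
  · rw [Set.indicator_of_mem hκ, Set.indicator_of_mem (this.2 hκ), shellWeight_neg]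
  · rw [Set.indicator_of_notMem hκ, Set.indicator_of_notMem (mt this.1 hκ)]

theorem norm_shellCutoff_le {r₁ : ℝ} (h1 : 1 ≤ r₁) (r₂ : ℝ) (k : Space d) :
    ‖shellCutoff r₁ r₂ k‖ ≤ 2 := by
  rw [shellCutoff]
  by_cases hκ : (2 * Real.pi) • k ∈ Metric.ball (0 : Space d) r₂
  · rw [Set.indicator_of_mem hκ]
    exact norm_indicator_shellWeight_le h1 _
  · rw [Set.indicator_of_notMem hκ, norm_zero]
    exact zero_le_two

theorem shellCutoff_eq_zero {r₁ r₂ : ℝ} {k : Space d} (h : ‖(2 * Real.pi) • k‖ < r₁) :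
    shellCutoff r₁ r₂ k = 0 := by
  rw [shellCutoff]
  by_cases hκ : (2 * Real.pi) • k ∈ Metric.ball (0 : Space d) r₂
  · rw [Set.indicator_of_mem hκ, Set.indicator_of_notMem]
    rw [Set.notMem_compl_iff]
    exact mem_ball_zero_iff.2 h
  · rw [Set.indicator_of_notMem hκ]

/-- The transform of a cutoff of an even bounded symbol. -/
theorem fourierInv_shellCutoff_mul {r₁ r₂ : ℝ} (h1 : 1 ≤ r₁) {σ : Space d → ℂ}
    (hσ : Measurable σ) (he : ∀ κ, σ (-κ) = σ κ) {B : ℝ} (hB : ∀ κ, ‖σ κ‖ ≤ B) (y : Space d) :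
    Integrable (fun k => shellCutoff r₁ r₂ k * σ ((2 * Real.pi) • k)) ∧
    𝓕⁻ (fun k => shellCutoff r₁ r₂ k * σ ((2 * Real.pi) • k)) y = fourierNorm d *
      ∫ κ in Metric.ball (0 : Space d) r₂ \ Metric.ball 0 r₁,
        (Real.cos (inner ℝ y κ) : ℂ) * ((shellWeight κ : ℂ) * σ κ) := by
  obtain ⟨ha, hb⟩ := fourierInv_scaled_ball (σ := fun κ =>
    (Metric.ball (0 : Space d) r₁)ᶜ.indicator (fun κ => (shellWeight κ : ℂ)) κ * σ κ)
    (R := r₂) (B := 2 * B) ((measurable_indicator_shellWeight r₁).mul hσ)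
    (fun κ => by rw [indicator_shellWeight_neg, he]) (fun κ _ => by
      rw [norm_mul]
      exact mul_le_mul (norm_indicator_shellWeight_le h1 κ) (hB κ) (norm_nonneg _) zero_le_two)
  have e : (fun k : Space d => (Metric.ball (0 : Space d) r₂).indicator (fun κ =>
      (Metric.ball (0 : Space d) r₁)ᶜ.indicator (fun κ => (shellWeight κ : ℂ)) κ * σ κ)
      ((2 * Real.pi) • k)) = fun k => shellCutoff r₁ r₂ k * σ ((2 * Real.pi) • k) := by
    ext k
    rw [shellCutoff, Set.indicator_mul_left]
  rw [e] at ha hb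
  refine ⟨ha, ?_⟩
  rw [hb, Set.sdiff_eq, ← setIntegral_indicator Metric.isOpen_ball.measurableSet.compl]
  congr 2
  ext κ
  by_cases hκ : κ ∈ (Metric.ball (0 : Space d) r₁)ᶜ
  · rw [Set.indicator_of_mem hκ, Set.indicator_of_mem hκ]
  · rw [Set.indicator_of_notMem hκ, Set.indicator_of_notMem hκ, zero_mul, mul_zero]

/-- The key estimate: the integral is read off at the origin from the transform of an escaping
cutoff times the inverse symbol. The transforms of the cutoffs alone are controlled by the
boundedness and decay of `L`. A general filter is allowed so that both endpoints can vary
independently. -/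
theorem tendsto_integral_compliance_sub (hd : d = 2 ∨ d = 3) (hρ : 0 < ρ)
    (hs : s ^ 2 ∈ Complex.slitPlane) (hC : IsRadialTensor C)
    (hint : ∀ i j, Integrable fun ξ => C ξ i j) (hM : ∀ κ, (stiffness C κ).PosSemidef)
    {ι : Type*} {l : Filter ι} [l.IsCountablyGenerated] {r₁ r₂ : ι → ℝ} (h1 : ∀ n, 1 ≤ r₁ n)
    (h2 : ∀ n, r₁ n ≤ r₂ n) (hr : Tendsto r₁ l atTop) :
    Tendsto (fun n => ∫ k in r₁ n..r₂ n,
      (compliance ρ s (tensile C k) - compliance ρ s (shear C k)) * (k⁻¹ : ℝ)) l (𝓝 0) := by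
  have hd' : d = 1 ∨ d = 2 ∨ d = 3 := Or.inr hd
  have hr' : Tendsto r₂ l atTop := tendsto_atTop_mono h2 hr
  obtain ⟨B, hB⟩ := exists_norm_greenSymbol_le hρ hs hM
  obtain ⟨BL, hBL⟩ := exists_abs_sphericalL_le hd'
  have hBL0 : 0 ≤ BL := (abs_nonneg _).trans (hBL 0)
  have hcut : ∀ n, Integrable (shellCutoff (d := d) (r₁ n) (r₂ n)) ∧ ∀ y,
      𝓕⁻ (shellCutoff (r₁ n) (r₂ n)) y = fourierNorm d *
        (((directionTensor 0 0 y - (d : ℝ)⁻¹) *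
          (sphericalL d (r₂ n * ‖y‖) - sphericalL d (r₁ n * ‖y‖)) : ℝ) : ℂ) := fun n => by
    have h := fun y : Space d => fourierInv_shellCutoff_mul (d := d) (r₂ := r₂ n) (h1 n)
      (σ := fun _ => 1) measurable_const (fun _ => rfl) (B := 1) (fun _ => by simp) y
    simp only [mul_one, setIntegral_annulus_cos_shellWeight hd'
      (zero_lt_one.trans_le (h1 n)) (h2 n)] at h
    exact ⟨(h 0).1, fun y => (h y).2⟩
  have hdir : ∀ y : Space d, |directionTensor 0 0 y - (d : ℝ)⁻¹| ≤ 2 := fun y => by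
    have h4 : |(d : ℝ)⁻¹| ≤ 1 := by rw [abs_of_nonneg (by positivity)]; exact inv_dim_le_one
    have := (abs_sub (directionTensor 0 0 y) (d : ℝ)⁻¹).trans
      (add_le_add (abs_directionTensor_le 0 0 y) h4)
    linarith
  have key := tendsto_fourierInv_cutoff_mul (l := l) (F := fun n => shellCutoff (r₁ n) (r₂ n))
    (fun n => (hcut n).1) (B := 2) (fun n k => norm_shellCutoff_le (h1 n) _ k)
    (fun k => tendsto_const_nhds.congr' ((hr.eventually_gt_atTop ‖(2 * Real.pi) • k‖).mono
      fun n hn => (shellCutoff_eq_zero hn).symm))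
    (H := ‖fourierNorm d‖ * (2 * (BL + BL)))
    (fun n y => by
      rw [(hcut n).2, norm_mul, Complex.norm_real, Real.norm_eq_abs, abs_mul]
      gcongr
      · exact hdir y
      · exact (abs_sub _ _).trans (add_le_add (hBL _) (hBL _)))
    (fun y => by
      have hL : Tendsto (fun n => sphericalL d (r₂ n * ‖y‖) - sphericalL d (r₁ n * ‖y‖)) l
          (𝓝 0) := by
        by_cases hy : ‖y‖ = 0
        · simpa [hy] using tendsto_const_nhds
        · have hy' : 0 < ‖y‖ := lt_of_le_of_ne (norm_nonneg _) (Ne.symm hy)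
          simpa using ((tendsto_sphericalL hd').comp (hr'.atTop_mul_const hy')).sub
            ((tendsto_sphericalL hd').comp (hr.atTop_mul_const hy'))
      have h3 := ((Complex.continuous_ofReal.tendsto _).comp
        (hL.const_mul (directionTensor 0 0 y - (d : ℝ)⁻¹))).const_mul (fourierNorm d)
      rw [mul_zero, Complex.ofReal_zero, mul_zero] at h3
      exact h3.congr fun n => ((hcut n).2 y).symm)
    (K := fun i j ξ => compliance ρ s (∫ ξ, C ξ 0 0) * (C ξ i j : ℂ))
    (fun i j => (hint i j).ofReal.const_mul _)
    (N := fun i k => greenSymbol C ρ s ((2 * Real.pi) • k) i 0)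
    (fun i => (measurable_greenSymbol hρ hs hint hM i 0).comp (measurable_const_smul _))
    (B' := B) (fun i k => hB _ i 0) (fun i k => greenSymbol_eq_system hρ hs hC hint hM i 0 k) 0 0
  -- At `y = 0` the cosine is one, and the weight isolates the tail with the positive coefficient
  -- `γ`.
  have hγ := axialIntegral_quartic_pos hd
  set γ := axialIntegral d (fun t => (t ^ 2 - (d : ℝ)⁻¹) * t ^ 2) with hγdef
  have hval : ∀ n, 𝓕⁻ (fun k => shellCutoff (r₁ n) (r₂ n) k *
      greenSymbol C ρ s ((2 * Real.pi) • k) 0 0) (0 : Space d) = fourierNorm d * (γ *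
        ∫ k in r₁ n..r₂ n,
          (compliance ρ s (tensile C k) - compliance ρ s (shear C k)) * (k⁻¹ : ℝ)) := fun n => by
    rw [(fourierInv_shellCutoff_mul (h1 n) (measurable_greenSymbol hρ hs hint hM 0 0)
      (fun κ => by rw [greenSymbol_neg]) (fun κ => hB κ 0 0) 0).2]
    have h := setIntegral_annulus_shellWeight_mul hd'
      (continuous_compliance hρ hs (continuous_tensile hint) (tensile_nonneg hM))
      (continuous_compliance hρ hs (continuous_shear hint) (shear_nonneg hM))
      (zero_lt_one.trans_le (h1 n)) (h2 n)
    rw [← hγdef] at h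
    rw [← h]
    simp [greenSymbol]
  have hne : fourierNorm d * γ ≠ 0 := by
    refine mul_ne_zero ?_ (Complex.ofReal_ne_zero.2 hγ.ne')
    rw [fourierNorm]
    exact Complex.ofReal_ne_zero.2 (by positivity)
  have h := key.const_mul (fourierNorm d * γ)⁻¹
  rw [mul_zero] at h
  refine h.congr fun n => ?_
  rw [hval, ← mul_assoc (fourierNorm d), ← mul_assoc, inv_mul_cancel₀ hne, one_mul]

theorem tensile_eq_shear_of_one (h : d = 1) : tensile C = shear C := by
  subst h
  rfl

/-- At the origin the convention `0⁻¹ = 0` gives the right value: the stiffnesses are `O(k²)` there,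
so the quotient is `O(|k|)`. -/
theorem continuous_compliance_sub_mul_inv (hρ : 0 < ρ) (hs : s ^ 2 ∈ Complex.slitPlane)
    (hint : ∀ (n : ℕ) (i j : Fin d), Integrable fun ξ : Space d => ‖ξ‖ ^ n * C ξ i j)
    (hM : ∀ κ, (stiffness C κ).PosSemidef) : Continuous fun k : ℝ =>
      (compliance ρ s (tensile C k) - compliance ρ s (shear C k)) * (k⁻¹ : ℝ) := by
  have hint' := integrable_of_moments hint
  have hP := continuous_compliance hρ hs (continuous_tensile hint') (tensile_nonneg hM)
  have hQ := continuous_compliance hρ hs (continuous_shear hint') (shear_nonneg hM)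
  rw [continuous_iff_continuousAt]
  intro k
  by_cases hk : k = 0
  · subst hk
    obtain ⟨B, hB0, hB⟩ := exists_norm_compliance_sub_le hρ hs
    have hst : ∀ (k : ℝ) (i : Fin d), |stiffness C (EuclideanSpace.single 0 k) i i| ≤
        k ^ 2 * ∫ ξ, |‖ξ‖ ^ 2 * C ξ i i| := fun k i => by
      have := abs_stiffness_le_sq (hint 2) (EuclideanSpace.single 0 k) i i
      rwa [PiLp.norm_single, Real.norm_eq_abs, sq_abs] at this
    set D := (∫ ξ, |‖ξ‖ ^ 2 * C ξ 0 0|) + ∫ ξ, |‖ξ‖ ^ 2 * C ξ 1 1| with hD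
    have hle : ∀ k : ℝ, ‖(compliance ρ s (tensile C k) - compliance ρ s (shear C k)) *
        (k⁻¹ : ℝ)‖ ≤ B * D * |k| := fun k => by
      by_cases hk : k = 0
      · simp [hk]
      · rw [norm_mul, Complex.norm_real, Real.norm_eq_abs, abs_inv, ← div_eq_mul_inv,
          div_le_iff₀ (abs_pos.2 hk), mul_assoc, ← sq, sq_abs]
        refine (hB _ _ (tensile_nonneg hM k) (shear_nonneg hM k)).trans ?_
        rw [mul_assoc]
        refine mul_le_mul_of_nonneg_left ?_ hB0
        have := (abs_sub (tensile C k) (shear C k)).trans (add_le_add (hst k 0) (hst k 1))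
        rw [hD]
        linarith
    rw [ContinuousAt, inv_zero, Complex.ofReal_zero, mul_zero]
    refine squeeze_zero_norm hle ?_
    have : Continuous fun k : ℝ => B * D * |k| := by fun_prop
    simpa using this.tendsto 0
  · exact ((hP.sub hQ).continuousAt).mul
      (Complex.continuous_ofReal.continuousAt.comp (continuousAt_inv₀ hk))

theorem exists_tendsto_integral_compliance_sub (hd : d = 1 ∨ d = 2 ∨ d = 3) (hρ : 0 < ρ)
    (hs : s ^ 2 ∈ Complex.slitPlane) (hC : IsRadialTensor C)
    (hint : ∀ (n : ℕ) (i j : Fin d), Integrable fun ξ : Space d => ‖ξ‖ ^ n * C ξ i j)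
    (hM : ∀ κ, (stiffness C κ).PosSemidef) : ∃ ℓ : ℂ, Tendsto (fun R : ℝ => ∫ k in (0 : ℝ)..R,
      (compliance ρ s (tensile C k) - compliance ρ s (shear C k)) * (k⁻¹ : ℝ)) atTop (𝓝 ℓ) := by
  by_cases h1 : d = 1
  · refine ⟨0, ?_⟩
    simp [tensile_eq_shear_of_one h1]
  have hd' := hd.resolve_left h1
  have hc := continuous_compliance_sub_mul_inv hρ hs hint hM
  -- Cauchy's criterion is checked along pairs of radii; the outer `max 1` secures the lower bound
  -- on the radii for every pair.
  refine cauchySeq_tendsto_of_complete (cauchySeq_iff_tendsto_dist_atTop_0.2 ?_)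
  have hr : Tendsto (fun p : ℝ × ℝ => max 1 (min p.1 p.2)) atTop atTop := by
    rw [← prod_atTop_atTop_eq]
    refine tendsto_atTop_mono (fun p => le_max_right _ _) (tendsto_atTop.2 fun a => ?_)
    filter_upwards [(tendsto_fst (f := atTop) (g := atTop)).eventually (eventually_ge_atTop a),
      (tendsto_snd (f := atTop) (g := atTop)).eventually (eventually_ge_atTop a)] with p h1 h2
    exact le_min h1 h2
  have h := (tendsto_integral_compliance_sub hd' hρ hs hC (integrable_of_moments hint) hM
    (l := atTop) (r₁ := fun p : ℝ × ℝ => max 1 (min p.1 p.2))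
    (r₂ := fun p : ℝ × ℝ => max 1 (max p.1 p.2)) (fun p => le_max_left _ _)
    (fun p => max_le_max le_rfl min_le_max) hr).norm
  rw [norm_zero] at h
  refine h.congr' ?_
  filter_upwards [eventually_ge_atTop ((1, 1) : ℝ × ℝ)] with p hp
  have hp1 : 1 ≤ p.1 := hp.1
  have hp2 : 1 ≤ p.2 := hp.2
  rw [dist_eq_norm, intervalIntegral.integral_interval_sub_left (hc.intervalIntegrable _ _)
    (hc.intervalIntegrable _ _), max_eq_right (le_min hp1 hp2),
    max_eq_right (hp1.trans (le_max_left _ _))]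
  rcases le_total p.1 p.2 with hle | hle
  · rw [min_eq_left hle, max_eq_right hle, intervalIntegral.integral_symm, norm_neg]
  · rw [min_eq_right hle, max_eq_left hle]

end TailConvergence

/-! ### The radial integrals for the Green function -/

section GreenFunction

theorem directionTensor_smul {a : ℝ} (ha : a ≠ 0) (i j : Fin d) (x : Space d) :
    directionTensor i j (a • x) = directionTensor i j x := by
  simp only [directionTensor, norm_smul, PiLp.smul_apply, smul_eq_mul, mul_pow, Real.norm_eq_abs,
    sq_abs]
  rw [← mul_div_mul_left (x i * x j) (‖x‖ ^ 2) (pow_ne_zero 2 ha)]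
  ring

theorem invFourierOfBounded_sub_smul {m m' : Space d → ℂ} (hm : MemLp m ⊤) (hm' : MemLp m' ⊤)
    (a : ℂ) (h : MemLp (fun k => m k - a * m' k) ⊤) :
    invFourierOfBounded m hm - a • invFourierOfBounded m' hm' = invFourierOfBounded _ h := by
  ext φ
  change invFourierOfBounded m hm φ - a • invFourierOfBounded m' hm' φ = _
  simp only [invFourierOfBounded_apply]
  rw [smul_eq_mul, ← integral_const_mul, ← integral_sub (integrable_mul_of_memLp_top _ hm)
    ((integrable_mul_of_memLp_top _ hm').const_mul a)]
  congr 1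
  ext k
  ring

/-- Fourier inversion evaluated at the origin. -/
theorem invFourierOfBounded_const (c : ℂ) (h : MemLp (fun _ : Space d => c) ⊤) :
    invFourierOfBounded _ h = c • TemperedDistribution.delta (0 : Space d) := by
  ext φ
  change _ = c • TemperedDistribution.delta (0 : Space d) φ
  rw [invFourierOfBounded_apply, TemperedDistribution.delta_apply, integral_mul_const, mul_comm,
    smul_eq_mul]
  congr 1
  have h1 : 𝓕 (𝓕⁻ φ) = φ := FourierTransform.fourier_fourierInv_eq φ
  conv_rhs => rw [← h1, SchwartzMap.fourier_coe, Real.fourier_eq']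
  simp

theorem exists_norm_le_of_tendsto_atTop {f : ℝ → ℂ} (hf : Continuous f) {ℓ : ℂ}
    (h : Tendsto f atTop (𝓝 ℓ)) : ∃ B, ∀ k, 0 ≤ k → ‖f k‖ ≤ B := by
  obtain ⟨N, hN⟩ := eventually_atTop.1 (h.norm.eventually (gt_mem_nhds (lt_add_one ‖ℓ‖)))
  obtain ⟨B, hB⟩ := (isCompact_Icc : IsCompact (Set.Icc (0 : ℝ) N)).exists_bound_of_continuousOn
    hf.continuousOn
  refine ⟨max B (‖ℓ‖ + 1), fun k hk => ?_⟩
  rcases le_total k N with hkN | hkN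
  · exact (hB k ⟨hk, hkN⟩).trans (le_max_left _ _)
  · exact (hN k hkN).le.trans (le_max_right _ _)

theorem intervalIntegral_congr_of_pos {f g : ℝ → ℂ} (hg : Continuous g)
    (h : ∀ k > 0, f k = g k) {R : ℝ} (hR : 0 ≤ R) :
    IntervalIntegrable f volume 0 R ∧ ∫ k in (0 : ℝ)..R, f k = ∫ k in (0 : ℝ)..R, g k := by
  constructor
  · have h1 := hg.intervalIntegrable (μ := volume) 0 R
    rw [intervalIntegrable_iff_integrableOn_Ioc_of_le hR] at h1 ⊢
    exact h1.congr_fun (fun k hk => (h k hk.1).symm) measurableSet_Ioc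
  · rw [intervalIntegral.integral_of_le hR, intervalIntegral.integral_of_le hR]
    exact setIntegral_congr_fun measurableSet_Ioc fun k hk => h k hk.1

variable [NeZero d] {C : Space d → Matrix (Fin d) (Fin d) ℝ} {ρ : ℝ} {s : ℂ}

/-- Integration by parts of the kernel `L` against a function of the form `k Θ'(k)`. -/
theorem integral_pow_mul_sphericalL (hd : d = 1 ∨ d = 2 ∨ d = 3) {θ Θ τ : ℝ → ℂ}
    (hθ : Continuous θ) (hΘ : ∀ k, HasDerivAt Θ (θ k) k) (hτ : ∀ k > 0, τ k = k * θ k) (r : ℝ)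
    {R : ℝ} (hR : 0 ≤ R) :
    ∫ k in (0 : ℝ)..R, (k : ℂ) ^ (d - 1) * ((sphericalL d (k * r) : ℂ) * τ k) =
      ∫ k in (0 : ℝ)..R, (k : ℂ) ^ (d - 1) * ((sphericalJ d (k * r) : ℂ) * (Θ R - Θ k)) := by
  have hJ := continuous_sphericalJ hd
  have hL := continuous_sphericalL hd
  have h := intervalIntegral.integral_mul_deriv_eq_deriv_mul (a := 0) (b := R)
    (u := fun k => ((k ^ d * sphericalL d (k * r) : ℝ) : ℂ))
    (u' := fun k => ((k ^ (d - 1) * sphericalJ d (k * r) : ℝ) : ℂ))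
    (v := fun k => Θ k - Θ R) (v' := θ)
    (fun k _ => (hasDerivAt_pow_mul_sphericalL hd r k).ofReal_comp)
    (fun k _ => (hΘ k).sub_const (Θ R))
    ((by fun_prop : Continuous _).intervalIntegrable _ _) (hθ.intervalIntegrable _ _)
  have hd0 : (0 : ℝ) ^ d = 0 := zero_pow (NeZero.ne d)
  rw [sub_self, mul_zero, hd0, zero_mul, Complex.ofReal_zero, zero_mul, sub_zero, zero_sub,
    ← intervalIntegral.integral_neg] at h
  calc _ = ∫ k in (0 : ℝ)..R, ((k ^ d * sphericalL d (k * r) : ℝ) : ℂ) * θ k := by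
        rw [intervalIntegral.integral_of_le hR, intervalIntegral.integral_of_le hR]
        refine setIntegral_congr_fun measurableSet_Ioc fun k hk => ?_
        rw [hτ k hk.1, ← Nat.sub_add_cancel (NeZero.one_le : 1 ≤ d), Nat.add_sub_cancel,
          pow_succ]
        push_cast
        ring
    _ = _ := by
        rw [h]
        congr 1
        ext k
        push_cast
        ring


/-- The function `∫₀ᴿ (P - Q) / k dk`. -/
def complianceLogIntegral (C : Space d → Matrix (Fin d) (Fin d) ℝ) (ρ : ℝ) (s : ℂ) (R : ℝ) : ℂ :=
  ∫ k in (0 : ℝ)..R, (compliance ρ s (tensile C k) - compliance ρ s (shear C k)) * (k⁻¹ : ℝ)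

/-- The radial symbol of `u_A`; the constant `ℓ` is the limit of `complianceLogIntegral`. -/
def radialSymbol (C : Space d → Matrix (Fin d) (Fin d) ℝ) (ρ : ℝ) (s : ℂ) (ℓ : ℂ)
    (κ : Space d) : ℂ :=
  compliance ρ s (shear C ‖κ‖) + (ℓ - complianceLogIntegral C ρ s ‖κ‖)

theorem continuous_complianceLogIntegral (hρ : 0 < ρ) (hs : s ^ 2 ∈ Complex.slitPlane)
    (hint : ∀ (n : ℕ) (i j : Fin d), Integrable fun ξ : Space d => ‖ξ‖ ^ n * C ξ i j)
    (hM : ∀ κ, (stiffness C κ).PosSemidef) : Continuous (complianceLogIntegral C ρ s) :=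
  intervalIntegral.continuous_primitive (fun _ _ =>
    (continuous_compliance_sub_mul_inv hρ hs hint hM).intervalIntegrable _ _) 0

theorem integral_pow_mul_sphericalL_compliance_sub (hd : d = 1 ∨ d = 2 ∨ d = 3) (hρ : 0 < ρ)
    (hs : s ^ 2 ∈ Complex.slitPlane)
    (hint : ∀ (n : ℕ) (i j : Fin d), Integrable fun ξ : Space d => ‖ξ‖ ^ n * C ξ i j)
    (hM : ∀ κ, (stiffness C κ).PosSemidef) (r : ℝ) {R : ℝ} (hR : 0 ≤ R) :
    ∫ k in (0 : ℝ)..R, (k : ℂ) ^ (d - 1) * ((sphericalL d (k * r) : ℂ) *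
        (compliance ρ s (tensile C k) - compliance ρ s (shear C k))) =
      ∫ k in (0 : ℝ)..R, (k : ℂ) ^ (d - 1) * ((sphericalJ d (k * r) : ℂ) *
        (complianceLogIntegral C ρ s R - complianceLogIntegral C ρ s k)) := by
  have hc := continuous_compliance_sub_mul_inv hρ hs hint hM
  refine integral_pow_mul_sphericalL hd hc
    (fun k => intervalIntegral.integral_hasDerivAt_right (hc.intervalIntegrable _ _)
      (hc.stronglyMeasurableAtFilter _ _) hc.continuousAt) (fun k hk => ?_) r hR
  have : (k : ℂ) ≠ 0 := Complex.ofReal_ne_zero.2 hk.ne'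
  push_cast
  field_simp

/-- Integration by parts trades `L (P - Q)` for `J (Θ(R) - Θ(k))`, which makes the truncated
integral the transform of one radial symbol on the ball. -/
theorem integral_greenA (hd : d = 1 ∨ d = 2 ∨ d = 3) (hρ : 0 < ρ) (hs : s ^ 2 ∈ Complex.slitPlane)
    (hint : ∀ (n : ℕ) (i j : Fin d), Integrable fun ξ : Space d => ‖ξ‖ ^ n * C ξ i j)
    (hM : ∀ κ, (stiffness C κ).PosSemidef) {x : Space d} (hx : x ≠ 0) {R : ℝ} (hR : 0 ≤ R) :
    IntervalIntegrable (greenA C ρ s x) volume 0 R ∧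
    ∫ k in (0 : ℝ)..R, greenA C ρ s x k = fourierNorm d * ∫ κ in Metric.ball (0 : Space d) R,
      (Real.cos (inner ℝ x κ) : ℂ) * radialSymbol C ρ s (complianceLogIntegral C ρ s R) κ := by
  have hJ := continuous_sphericalJ hd
  have hL := continuous_sphericalL hd
  have hint' := integrable_of_moments hint
  have hP := continuous_compliance hρ hs (continuous_tensile hint') (tensile_nonneg hM)
  have hQ := continuous_compliance hρ hs (continuous_shear hint') (shear_nonneg hM)
  have hΘ := continuous_complianceLogIntegral hρ hs hint hM
  obtain ⟨h1, h2⟩ := intervalIntegral_congr_of_pos (f := greenA C ρ s x)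
    (g := fun k => fourierNorm d * ((k : ℂ) ^ (d - 1) *
      ((sphericalJ d (k * ‖x‖) : ℂ) * compliance ρ s (shear C k) +
        (sphericalL d (k * ‖x‖) : ℂ) *
          (compliance ρ s (tensile C k) - compliance ρ s (shear C k))))) (by fun_prop)
    (fun k hk => integrandA_eq hd (fun h => by rw [tensile_eq_shear_of_one h])
      (norm_pos_iff.2 hx) hk) hR
  refine ⟨h1, ?_⟩
  have h3 := setIntegral_ball_cos_radial hd (g := fun k => compliance ρ s (shear C k) +
    (complianceLogIntegral C ρ s R - complianceLogIntegral C ρ s k)) (by fun_prop) hR x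
  simp only [radialSymbol]
  rw [h2, h3, intervalIntegral.integral_const_mul]
  congr 1
  simp only [mul_add]
  rw [intervalIntegral.integral_add ((by fun_prop : Continuous _).intervalIntegrable _ _)
    ((by fun_prop : Continuous _).intervalIntegrable _ _),
    intervalIntegral.integral_add ((by fun_prop : Continuous _).intervalIntegrable _ _)
    ((by fun_prop : Continuous _).intervalIntegrable _ _),
    integral_pow_mul_sphericalL_compliance_sub hd hρ hs hint hM _ hR]

/-- The tensor transform over the ball splits into `δ_ij` times an `L` integral plus the direction
tensor times the `u_B` integral. The former is the part absorbed by the radial symbol of `u_A`. -/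
theorem integral_directionTensor_mul_greenB (hd : d = 1 ∨ d = 2 ∨ d = 3) (hρ : 0 < ρ)
    (hs : s ^ 2 ∈ Complex.slitPlane)
    (hint : ∀ (n : ℕ) (i j : Fin d), Integrable fun ξ : Space d => ‖ξ‖ ^ n * C ξ i j)
    (hM : ∀ κ, (stiffness C κ).PosSemidef) (i j : Fin d) {x : Space d} (hx : x ≠ 0) {R : ℝ}
    (hR : 0 ≤ R) :
    IntervalIntegrable (fun k => (directionTensor i j x : ℂ) * greenB C ρ s x k) volume 0 R ∧
    ∫ k in (0 : ℝ)..R, (directionTensor i j x : ℂ) * greenB C ρ s x k =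
      fourierNorm d * ∫ κ in Metric.ball (0 : Space d) R, (Real.cos (inner ℝ x κ) : ℂ) *
        (greenSymbol C ρ s κ i j - (if i = j then (1 : ℂ) else 0) *
          radialSymbol C ρ s (complianceLogIntegral C ρ s R) κ) := by
  have hJ := continuous_sphericalJ hd
  have hL := continuous_sphericalL hd
  have hint' := integrable_of_moments hint
  have hP := continuous_compliance hρ hs (continuous_tensile hint') (tensile_nonneg hM)
  have hQ := continuous_compliance hρ hs (continuous_shear hint') (shear_nonneg hM)
  have hΘ := continuous_complianceLogIntegral hρ hs hint hM
  set τ : ℝ → ℂ := fun k => compliance ρ s (tensile C k) - compliance ρ s (shear C k) with hτ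
  have hτc : Continuous τ := hP.sub hQ
  obtain ⟨h1, h2⟩ := intervalIntegral_congr_of_pos (f := greenB C ρ s x)
    (g := fun k => fourierNorm d * ((k : ℂ) ^ (d - 1) *
      (((sphericalJ d (k * ‖x‖) : ℂ) - d * (sphericalL d (k * ‖x‖) : ℂ)) * τ k))) (by fun_prop)
    (fun k hk => integrandB_eq hd (fun h => by rw [tensile_eq_shear_of_one h])
      (norm_pos_iff.2 hx) hk) hR
  refine ⟨h1.const_mul _, ?_⟩
  set g : ℝ → ℂ := fun k => complianceLogIntegral C ρ s R - complianceLogIntegral C ρ s k with hg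
  have hgc : Continuous g := by fun_prop
  have h3 := setIntegral_ball_cos_radial hd hgc hR x
  have h4 := setIntegral_ball_cos_tensor hd hτc hR hx i j
  have h5 := integral_pow_mul_sphericalL_compliance_sub hd hρ hs hint hM ‖x‖ hR
  have hi : IntegrableOn (fun κ : Space d => (Real.cos (inner ℝ x κ) : ℂ) * g ‖κ‖)
      (Metric.ball 0 R) :=
    ((by fun_prop : Continuous fun κ : Space d => (Real.cos (inner ℝ x κ) : ℂ) *
      g ‖κ‖).continuousOn.integrableOn_compact (isCompact_closedBall 0 R)).mono_set
      Metric.ball_subset_closedBall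
  have e : ∀ κ : Space d, (Real.cos (inner ℝ x κ) : ℂ) *
      (greenSymbol C ρ s κ i j - (if i = j then (1 : ℂ) else 0) *
        radialSymbol C ρ s (complianceLogIntegral C ρ s R) κ) =
      (Real.cos (inner ℝ x κ) : ℂ) * ((directionTensor i j κ : ℂ) * τ ‖κ‖) -
        (if i = j then (1 : ℂ) else 0) * ((Real.cos (inner ℝ x κ) : ℂ) * g ‖κ‖) := fun κ => by
    simp only [greenSymbol, Matrix.of_apply, radialSymbol, hτ, hg]
    ring
  simp only [e]
  rw [integral_sub (integrableOn_ball_cos_tensor hτc R x i j) (hi.const_mul _),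
    integral_const_mul, h3, h4, h5, add_sub_cancel_left, intervalIntegral.integral_const_mul, h2,
    intervalIntegral.integral_const_mul]
  ring

theorem exists_norm_radialSymbol_le (hd : d = 1 ∨ d = 2 ∨ d = 3) (hρ : 0 < ρ)
    (hs : s ^ 2 ∈ Complex.slitPlane) (hC : IsRadialTensor C)
    (hint : ∀ (n : ℕ) (i j : Fin d), Integrable fun ξ : Space d => ‖ξ‖ ^ n * C ξ i j)
    (hM : ∀ κ, (stiffness C κ).PosSemidef) : ∃ B, ∀ R, 0 ≤ R → ∀ κ : Space d,
      ‖radialSymbol C ρ s (complianceLogIntegral C ρ s R) κ‖ ≤ B := by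
  obtain ⟨B, hB⟩ := exists_norm_compliance_le hρ hs
  obtain ⟨ℓ, hℓ⟩ := exists_tendsto_integral_compliance_sub hd hρ hs hC hint hM
  obtain ⟨B', hB'⟩ := exists_norm_le_of_tendsto_atTop
    (continuous_complianceLogIntegral hρ hs hint hM) hℓ
  refine ⟨B + (B' + B'), fun R hR κ => (norm_add_le _ _).trans (add_le_add
    (hB _ (shear_nonneg hM _)) ((norm_sub_le _ _).trans (add_le_add (hB' R hR)
      (hB' _ (norm_nonneg κ)))))⟩

theorem measurable_radialSymbol (hρ : 0 < ρ) (hs : s ^ 2 ∈ Complex.slitPlane)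
    (hint : ∀ (n : ℕ) (i j : Fin d), Integrable fun ξ : Space d => ‖ξ‖ ^ n * C ξ i j)
    (hM : ∀ κ, (stiffness C κ).PosSemidef) (ℓ : ℂ) :
    Measurable (radialSymbol C ρ s ℓ) := by
  have hQ := continuous_compliance hρ hs (continuous_shear (integrable_of_moments hint))
    (shear_nonneg hM)
  have hΘ := continuous_complianceLogIntegral hρ hs hint hM
  exact ((hQ.comp continuous_norm).add (continuous_const.sub (hΘ.comp continuous_norm))).measurable

theorem radialSymbol_neg (ℓ : ℂ) (κ : Space d) :
    radialSymbol C ρ s ℓ (-κ) = radialSymbol C ρ s ℓ κ := by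
  simp [radialSymbol]

theorem tendsto_radialSymbol {ℓ : ℂ} (hℓ : Tendsto (complianceLogIntegral C ρ s) atTop (𝓝 ℓ))
    (κ : Space d) : Tendsto (fun R => radialSymbol C ρ s (complianceLogIntegral C ρ s R) κ) atTop
      (𝓝 (radialSymbol C ρ s ℓ κ)) :=
  (hℓ.sub_const _).const_add _

theorem memLp_top_radialSymbol (hd : d = 1 ∨ d = 2 ∨ d = 3) (hρ : 0 < ρ)
    (hs : s ^ 2 ∈ Complex.slitPlane) (hC : IsRadialTensor C)
    (hint : ∀ (n : ℕ) (i j : Fin d), Integrable fun ξ : Space d => ‖ξ‖ ^ n * C ξ i j)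
    (hM : ∀ κ, (stiffness C κ).PosSemidef) {ℓ : ℂ}
    (hℓ : Tendsto (complianceLogIntegral C ρ s) atTop (𝓝 ℓ)) :
    MemLp (fun k : Space d => radialSymbol C ρ s ℓ ((2 * Real.pi) • k)) ⊤ := by
  obtain ⟨B, hB⟩ := exists_norm_radialSymbol_le hd hρ hs hC hint hM
  refine memLp_top_of_bound ((measurable_radialSymbol hρ hs hint hM ℓ).comp
    (measurable_const_smul _)).aestronglyMeasurable B (ae_of_all _ fun k => ?_)
  exact le_of_tendsto (tendsto_radialSymbol hℓ _).norm
    ((eventually_ge_atTop 0).mono fun R hR => hB R hR _)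

theorem isImproperIntegral_greenA (hd : d = 1 ∨ d = 2 ∨ d = 3) (hρ : 0 < ρ)
    (hs : s ^ 2 ∈ Complex.slitPlane) (hC : IsRadialTensor C)
    (hint : ∀ (n : ℕ) (i j : Fin d), Integrable fun ξ : Space d => ‖ξ‖ ^ n * C ξ i j)
    (hM : ∀ κ, (stiffness C κ).PosSemidef) {ℓ : ℂ}
    (hℓ : Tendsto (complianceLogIntegral C ρ s) atTop (𝓝 ℓ)) :
    IsImproperIntegral (invFourierOfBounded _ (memLp_top_radialSymbol hd hρ hs hC hint hM hℓ))
      (greenA C ρ s) := by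
  obtain ⟨B, hB⟩ := exists_norm_radialSymbol_le hd hρ hs hC hint hM
  exact isImproperIntegral_of_symbols (fun R => measurable_radialSymbol hρ hs hint hM _)
    (fun R κ => radialSymbol_neg _ κ) (fun R hR κ _ => hB R hR κ) (tendsto_radialSymbol hℓ) _
    (fun x hx R hR => (integral_greenA hd hρ hs hint hM hx hR).1)
    (fun x hx R hR => (integral_greenA hd hρ hs hint hM hx hR).2) ae_ne_zero

theorem isImproperIntegral_directionTensor_mul_greenB (hd : d = 1 ∨ d = 2 ∨ d = 3) (hρ : 0 < ρ)
    (hs : s ^ 2 ∈ Complex.slitPlane) (hC : IsRadialTensor C)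
    (hint : ∀ (n : ℕ) (i j : Fin d), Integrable fun ξ : Space d => ‖ξ‖ ^ n * C ξ i j)
    (hM : ∀ κ, (stiffness C κ).PosSemidef) {ℓ : ℂ}
    (hℓ : Tendsto (complianceLogIntegral C ρ s) atTop (𝓝 ℓ)) (i j : Fin d) :
    IsImproperIntegral (invFourierOfBounded _ (memLp_top_greenSymbol hρ hs hC hint hM i j) -
        (if i = j then (1 : ℂ) else 0) •
          invFourierOfBounded _ (memLp_top_radialSymbol hd hρ hs hC hint hM hℓ))
      (fun x k => (directionTensor i j x : ℂ) * greenB C ρ s x k) := by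
  obtain ⟨B, hB⟩ := exists_norm_radialSymbol_le hd hρ hs hC hint hM
  obtain ⟨B', hB'⟩ := exists_norm_greenSymbol_le hρ hs hM
  have hm1 := memLp_top_greenSymbol hρ hs hC hint hM i j
  have hm2 := memLp_top_radialSymbol hd hρ hs hC hint hM hℓ
  rw [invFourierOfBounded_sub_smul hm1 hm2 _ (hm1.sub (hm2.const_mul _))]
  refine isImproperIntegral_of_symbols (σ := fun R κ => greenSymbol C ρ s κ i j -
      (if i = j then (1 : ℂ) else 0) * radialSymbol C ρ s (complianceLogIntegral C ρ s R) κ)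
    (σ' := fun κ => greenSymbol C ρ s κ i j -
      (if i = j then (1 : ℂ) else 0) * radialSymbol C ρ s ℓ κ) (B := B' + B)
    (fun R => (measurable_greenSymbol hρ hs (integrable_of_moments hint) hM i j).sub
      (measurable_const.mul (measurable_radialSymbol hρ hs hint hM _)))
    (fun R κ => by rw [greenSymbol_neg, radialSymbol_neg]) (fun R hR κ _ => ?_)
    (fun κ => ((tendsto_radialSymbol hℓ κ).const_mul _).const_sub _) _
    (fun x hx R hR => (integral_directionTensor_mul_greenB hd hρ hs hint hM i j hx hR).1)
    (fun x hx R hR => (integral_directionTensor_mul_greenB hd hρ hs hint hM i j hx hR).2)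
    ae_ne_zero
  refine (norm_sub_le _ _).trans (add_le_add (hB' κ i j) ?_)
  rw [norm_mul]
  have h1 : ‖(if i = j then (1 : ℂ) else 0)‖ ≤ 1 := by split_ifs <;> simp
  exact (mul_le_mul h1 (hB R hR κ) (norm_nonneg _) zero_le_one).trans_eq (one_mul _)

theorem isImproperIntegral_greenB (hd : d = 1 ∨ d = 2 ∨ d = 3) (hρ : 0 < ρ)
    (hs : s ^ 2 ∈ Complex.slitPlane) (hC : IsRadialTensor C)
    (hint : ∀ (n : ℕ) (i j : Fin d), Integrable fun ξ : Space d => ‖ξ‖ ^ n * C ξ i j)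
    (hM : ∀ κ, (stiffness C κ).PosSemidef) {ℓ : ℂ}
    (hℓ : Tendsto (complianceLogIntegral C ρ s) atTop (𝓝 ℓ)) :
    IsImproperIntegral (∑ i, (invFourierOfBounded _ (memLp_top_greenSymbol hρ hs hC hint hM i i) -
        (if i = i then (1 : ℂ) else 0) •
          invFourierOfBounded _ (memLp_top_radialSymbol hd hρ hs hC hint hM hℓ)))
      (greenB C ρ s) := by
  -- The trace of `x_i x_j / x²` is one, so the sum of the diagonal distributions is `u_B` itself.
  refine (IsImproperIntegral.sum Finset.univ (fun i =>
    isImproperIntegral_directionTensor_mul_greenB hd hρ hs hC hint hM hℓ i i) ae_ne_zero).congr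
    ae_ne_zero fun x hx k _ => ?_
  rw [← Finset.sum_mul, ← Complex.ofReal_sum, sum_directionTensor hx, Complex.ofReal_one, one_mul]

/-- The radial integral of a constant symbol is a multiple of the Dirac distribution. -/
theorem isImproperIntegral_const_smul_delta (hd : d = 1 ∨ d = 2 ∨ d = 3) (c : ℂ) :
    IsImproperIntegral (c • TemperedDistribution.delta (0 : Space d))
      (fun x k => integrandA d (fun _ => c) (fun _ => c) ‖x‖ k) := by
  have hJ := continuous_sphericalJ hd
  have h := fun (x : Space d) (hx : x ≠ 0) (R : ℝ) (hR : 0 ≤ R) => intervalIntegral_congr_of_pos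
    (f := integrandA d (fun _ => c) (fun _ => c) ‖x‖)
    (g := fun k => fourierNorm d * ((k : ℂ) ^ (d - 1) * ((sphericalJ d (k * ‖x‖) : ℂ) * c)))
    (by fun_prop) (fun k hk => by
      rw [integrandA_eq hd (fun _ => rfl) (norm_pos_iff.2 hx) hk, sub_self, mul_zero, add_zero]) hR
  rw [← invFourierOfBounded_const c (memLp_top_const c)]
  refine isImproperIntegral_of_symbols (σ := fun _ _ => c) (σ' := fun _ => c) (B := ‖c‖)
    (fun _ => measurable_const) (fun _ _ => rfl) (fun _ _ _ _ => le_rfl)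
    (fun _ => tendsto_const_nhds) _ (fun x hx R hR => (h x hx R hR).1) (fun x hx R hR => ?_)
    ae_ne_zero
  rw [(h x hx R hR).2, intervalIntegral.integral_const_mul,
    setIntegral_ball_cos_radial hd (g := fun _ => c) continuous_const hR]

theorem greenARegular_eq_sub (hd : d = 1 ∨ d = 2 ∨ d = 3) (Minf : ℝ) {x : Space d} (hx : x ≠ 0)
    {k : ℝ} (hk : 0 < k) : greenARegular C ρ s Minf x k = greenA C ρ s x k -
      integrandA d (fun _ => compliance ρ s Minf) (fun _ => compliance ρ s Minf) ‖x‖ k :=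
  integrandARegular_eq hd (fun h => by rw [tensile_eq_shear_of_one h]) (norm_pos_iff.2 hx) hk _

/-- Both integrands are dominated, uniformly in the position, by the deviations of the stiffnesses
from their limit. -/
theorem exists_norm_green_le (hd : d = 1 ∨ d = 2 ∨ d = 3) (hρ : 0 < ρ)
    (hs : s ^ 2 ∈ Complex.slitPlane) (hM : ∀ κ, (stiffness C κ).PosSemidef) {Minf : ℝ}
    (hMinf : 0 ≤ Minf) : ∃ B, ∀ x : Space d, x ≠ 0 → ∀ k > 0,
      ‖greenARegular C ρ s Minf x k‖ ≤ B * (|k ^ (d - 1) * (tensile C k - Minf)| +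
        |k ^ (d - 1) * (shear C k - Minf)|) ∧
      ‖greenB C ρ s x k‖ ≤ B * (|k ^ (d - 1) * (tensile C k - Minf)| +
        |k ^ (d - 1) * (shear C k - Minf)|) := by
  obtain ⟨B, hB0, hB⟩ := exists_norm_compliance_sub_le hρ hs
  obtain ⟨BJ, hBJ⟩ := exists_abs_sphericalJ_le hd
  obtain ⟨BL, hBL⟩ := exists_abs_sphericalL_le hd
  have hBJ0 : 0 ≤ BJ := (abs_nonneg _).trans (hBJ 0)
  have hBL0 : 0 ≤ BL := (abs_nonneg _).trans (hBL 0)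
  have h1d : (1 : ℝ) ≤ d := by exact_mod_cast NeZero.one_le
  refine ⟨‖fourierNorm d‖ * ((BJ + d * BL) * B), fun x hx k hk => ?_⟩
  have hr : 0 < ‖x‖ := norm_pos_iff.2 hx
  have hPQ : d = 1 → (fun k => compliance ρ s (tensile C k)) =
      fun k => compliance ρ s (shear C k) := fun h => by rw [tensile_eq_shear_of_one h]
  have hT := hB _ _ (tensile_nonneg hM k) hMinf
  have hS := hB _ _ (shear_nonneg hM k) hMinf
  set p := |tensile C k - Minf|
  set q := |shear C k - Minf|
  have hτ : ‖compliance ρ s (tensile C k) - compliance ρ s (shear C k)‖ ≤ B * (p + q) := by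
    rw [← sub_sub_sub_cancel_right _ _ (compliance ρ s Minf)]
    refine (norm_sub_le _ _).trans ?_
    rw [mul_add]
    exact add_le_add hT hS
  have hS' : ‖compliance ρ s (shear C k) - compliance ρ s Minf‖ ≤ B * (p + q) :=
    hS.trans (mul_le_mul_of_nonneg_left (le_add_of_nonneg_left (abs_nonneg _)) hB0)
  have hpq : 0 ≤ B * (p + q) := (norm_nonneg _).trans hS'
  have hk0 : 0 ≤ k ^ (d - 1) := pow_nonneg hk.le _
  have hsum : |k ^ (d - 1) * (tensile C k - Minf)| + |k ^ (d - 1) * (shear C k - Minf)| =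
      k ^ (d - 1) * (p + q) := by
    rw [abs_mul, abs_mul, abs_of_nonneg hk0, mul_add]
  have hkn : ‖(k : ℂ) ^ (d - 1)‖ = k ^ (d - 1) := by
    rw [norm_pow, Complex.norm_real, Real.norm_of_nonneg hk.le]
  have hJn : ‖(sphericalJ d (k * ‖x‖) : ℂ)‖ ≤ BJ := by
    rw [Complex.norm_real]
    exact hBJ _
  have hLn : ‖(sphericalL d (k * ‖x‖) : ℂ)‖ ≤ BL := by
    rw [Complex.norm_real]
    exact hBL _
  have hfinal : ∀ z : ℂ, ‖z‖ ≤ (BJ + d * BL) * (B * (p + q)) →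
      ‖fourierNorm d * ((k : ℂ) ^ (d - 1) * z)‖ ≤
        ‖fourierNorm d‖ * ((BJ + d * BL) * B) * (k ^ (d - 1) * (p + q)) := fun z hz => by
    rw [norm_mul, norm_mul, hkn]
    calc _ ≤ ‖fourierNorm d‖ * (k ^ (d - 1) * ((BJ + d * BL) * (B * (p + q)))) := by gcongr
      _ = _ := by ring
  rw [hsum]
  constructor
  · rw [greenARegular_eq_sub hd Minf hx hk, greenA, integrandA_eq hd hPQ hr hk,
      integrandA_eq hd (fun _ => rfl) hr hk, sub_self, mul_zero, add_zero, ← mul_sub, ← mul_sub,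
      add_sub_right_comm, ← mul_sub]
    refine hfinal _ ((norm_add_le _ _).trans ?_)
    rw [norm_mul, norm_mul, add_mul]
    refine add_le_add (mul_le_mul hJn hS' (norm_nonneg _) hBJ0)
      (mul_le_mul (hLn.trans ?_) hτ (norm_nonneg _) (by positivity))
    exact le_mul_of_one_le_left hBL0 h1d
  · rw [greenB, integrandB_eq hd hPQ hr hk]
    refine hfinal _ ?_
    rw [norm_mul]
    refine mul_le_mul ((norm_sub_le _ _).trans (add_le_add hJn ?_)) hτ (norm_nonneg _)
      (by positivity)
    rw [norm_mul, Complex.norm_natCast]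
    exact mul_le_mul_of_nonneg_left hLn (by positivity)

end GreenFunction

end Peridynamics

end

theorem mainTheorem4 (d : ℕ) [NeZero d] (hd : d = 1 ∨ d = 2 ∨ d = 3)
    (C : Peridynamics.Space d → Matrix (Fin d) (Fin d) ℝ) (ρ : ℝ) (s : ℂ)
    (hρ : 0 < ρ) (hs : s ^ 2 ∈ Complex.slitPlane)
    (hC : Peridynamics.IsRadialTensor C)
    (hCint : ∀ (n : ℕ) (i j : Fin d),
      Integrable (fun ξ : Peridynamics.Space d => ‖ξ‖ ^ n * C ξ i j))
    (hM : ∀ κ : Peridynamics.Space d, (Peridynamics.stiffness C κ).PosSemidef) :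
    -- `M(κ)` is described by the shear and tensile stiffnesses, and `ρ s² I + M(κ)` is invertible
    (∀ (κ : Peridynamics.Space d) (i j : Fin d), Peridynamics.stiffness C κ i j =
        Peridynamics.shear C ‖κ‖ * (if i = j then 1 else 0) +
        Peridynamics.directionTensor i j κ *
          (Peridynamics.tensile C ‖κ‖ - Peridynamics.shear C ‖κ‖)) ∧
    (∀ κ : Peridynamics.Space d, IsUnit (Peridynamics.dynamicStiffness C ρ s κ)) ∧
    ∃ u : Fin d → Fin d → 𝓢'(Peridynamics.Space d, ℂ),
      -- `u i` is the unique tempered fundamental solution for a unit force in direction `e_i`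
      (∀ (i : Fin d) (v : Fin d → 𝓢'(Peridynamics.Space d, ℂ)),
        Peridynamics.IsFundamentalSolution C ρ s i v ↔ v = u i) ∧
      -- `u i` is the inverse Fourier transform of `(ρ s² I + M)⁻¹ e_i`
      (∀ i j : Fin d, Peridynamics.IsFunction (𝓕 (u i j)) (fun k =>
        ((Peridynamics.dynamicStiffness C ρ s ((2 * Real.pi) • k))⁻¹.mulVec (Pi.single i 1)) j)) ∧
      -- the same in components
      (∀ i j : Fin d, Peridynamics.IsFunction (𝓕 (u i j)) (fun k =>
        (if i = j then 1 else 0) *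
            Peridynamics.compliance ρ s (Peridynamics.shear C (2 * Real.pi * ‖k‖)) +
          (Peridynamics.directionTensor i j k : ℂ) *
            (Peridynamics.compliance ρ s (Peridynamics.tensile C (2 * Real.pi * ‖k‖)) -
              Peridynamics.compliance ρ s (Peridynamics.shear C (2 * Real.pi * ‖k‖))))) ∧
      ∃ (uA uB : 𝓢'(Peridynamics.Space d, ℂ)) (Minf : ℝ),
        -- the radial integrals for `u_A` and `u_B`
        Peridynamics.IsImproperIntegral uA (Peridynamics.greenA C ρ s) ∧
        Peridynamics.IsImproperIntegral uB (Peridynamics.greenB C ρ s) ∧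
        -- `u_ij = u_A δ_ij + (x_i x_j / x²) u_B`
        (∀ i j : Fin d, Peridynamics.IsImproperIntegral
          (u i j - (if i = j then (1 : ℂ) else 0) • uA)
          (fun x k => (Peridynamics.directionTensor i j x : ℂ) *
            Peridynamics.greenB C ρ s x k)) ∧
        -- the common limit `M(∞)` of the stiffnesses
        Tendsto (Peridynamics.tensile C) atTop (𝓝 Minf) ∧
        Tendsto (Peridynamics.shear C) atTop (𝓝 Minf) ∧
        (ρ : ℂ) * s ^ 2 + (Minf : ℂ) ≠ 0 ∧
        -- the Dirac function is split off from `u_A`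
        Peridynamics.IsImproperIntegral
          (uA - Peridynamics.compliance ρ s Minf • TemperedDistribution.delta 0)
          (Peridynamics.greenARegular C ρ s Minf) ∧
        -- if the stiffnesses approach `M(∞)` fast enough, the remaining integrals converge
        -- absolutely at every `x ≠ 0`, and the remaining parts are the functions so defined
        (IntegrableOn (fun k : ℝ => k ^ (d - 1) * (Peridynamics.tensile C k - Minf)) (Set.Ioi 0) →
          IntegrableOn (fun k : ℝ => k ^ (d - 1) * (Peridynamics.shear C k - Minf)) (Set.Ioi 0) →
          (∀ x : Peridynamics.Space d, x ≠ 0 →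
            IntegrableOn (Peridynamics.greenARegular C ρ s Minf x) (Set.Ioi 0) ∧
            IntegrableOn (Peridynamics.greenB C ρ s x) (Set.Ioi 0)) ∧
          Peridynamics.IsFunction
            (uA - Peridynamics.compliance ρ s Minf • TemperedDistribution.delta 0)
            (fun x => ∫ k in Set.Ioi (0 : ℝ), Peridynamics.greenARegular C ρ s Minf x k) ∧
          Peridynamics.IsFunction uB
            (fun x => ∫ k in Set.Ioi (0 : ℝ), Peridynamics.greenB C ρ s x k) ∧
          ∀ i j : Fin d, Peridynamics.IsFunction
            (u i j - (if i = j then (1 : ℂ) else 0) • uA)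
            (fun x => (Peridynamics.directionTensor i j x : ℂ) *
              ∫ k in Set.Ioi (0 : ℝ), Peridynamics.greenB C ρ s x k)) := by
  have hint := Peridynamics.integrable_of_moments hCint
  obtain ⟨ℓ, hℓ⟩ := Peridynamics.exists_tendsto_integral_compliance_sub hd hρ hs hC hCint hM
  have hMinf := Peridynamics.integral_modulus_nonneg hC hint hM
  have hT := Peridynamics.isImproperIntegral_directionTensor_mul_greenB hd hρ hs hC hCint hM hℓ
  have hB := Peridynamics.isImproperIntegral_greenB hd hρ hs hC hCint hM hℓ
  have hA := Peridynamics.isImproperIntegral_greenA hd hρ hs hC hCint hM hℓ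
  -- Subtracting the radial integral of the constant symbol `1/(ρ s² + M(∞))` removes exactly its
  -- Dirac contribution.
  have hReg := (hA.sub (Peridynamics.isImproperIntegral_const_smul_delta hd
    (Peridynamics.compliance ρ s (∫ ξ, C ξ 0 0))) Peridynamics.ae_ne_zero).congr
    Peridynamics.ae_ne_zero fun x hx k hk =>
      (Peridynamics.greenARegular_eq_sub (C := C) (ρ := ρ) (s := s) hd _ hx hk).symm
  refine ⟨Peridynamics.stiffness_apply_eq hC hint,
    Peridynamics.isUnit_dynamicStiffness hρ hs hC hint hM,
    fun i j => Peridynamics.invFourierOfBounded _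
      (Peridynamics.memLp_top_greenSymbol hρ hs hC hCint hM i j),
    Peridynamics.isFundamentalSolution_iff hρ hs hC hCint hM, fun i j => ?_, fun i j => ?_,
    Peridynamics.invFourierOfBounded _
      (Peridynamics.memLp_top_radialSymbol hd hρ hs hC hCint hM hℓ), _, ∫ ξ, C ξ 0 0,
    hA, hB, hT, Peridynamics.tendsto_tensile hC hint, Peridynamics.tendsto_shear hC hint,
    Peridynamics.dynamic_ne_zero hρ hs hMinf, hReg, fun h1 h2 => ?_⟩
  · have h := Peridynamics.isFunction_fourier_invFourierOfBounded
      (Peridynamics.memLp_top_greenSymbol hρ hs hC hCint hM i j)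
    -- The `j`-th entry of the `i`-th column is the `(j, i)` entry of the inverse, so symmetry of
    -- the symbol is needed.
    convert h using 2 with k
    rw [Peridynamics.inv_dynamicStiffness hρ hs hC hint hM, Matrix.mulVec_single_one,
      Matrix.col_apply, Peridynamics.greenSymbol_symm]
  · have h := Peridynamics.isFunction_fourier_invFourierOfBounded
      (Peridynamics.memLp_top_greenSymbol hρ hs hC hCint hM i j)
    convert h using 2 with k
    have hpi : (0 : ℝ) < 2 * Real.pi := by positivity
    rw [Peridynamics.greenSymbol, Matrix.of_apply, norm_smul, Real.norm_of_nonneg hpi.le,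
      Peridynamics.directionTensor_smul hpi.ne']
  · obtain ⟨B, hG⟩ := Peridynamics.exists_norm_green_le (C := C) hd hρ hs hM hMinf
    -- This integrable majorant does not depend on the position. It serves both pointwise absolute
    -- convergence and the identification of the distributions with functions.
    have hGi := (h1.abs.add h2.abs).const_mul B
    have hG1 := fun x hx k hk => (hG x hx k hk).1
    have hG2 := fun x hx k hk => (hG x hx k hk).2
    refine ⟨fun x hx => ⟨hReg.integrableOn_Ioi hGi hG1 hx, hB.integrableOn_Ioi hGi hG2 hx⟩,
      hReg.isFunction Peridynamics.ae_ne_zero hGi hG1,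
      hB.isFunction Peridynamics.ae_ne_zero hGi hG2, fun i j => ?_⟩
    simp only [← integral_const_mul]
    refine (hT i j).isFunction Peridynamics.ae_ne_zero hGi fun x hx k hk => ?_
    rw [norm_mul, Complex.norm_real]
    exact (mul_le_of_le_one_left (norm_nonneg _)
      (Peridynamics.abs_directionTensor_le i j x)).trans (hG2 x hx k hk)
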